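/- Let $Y=U_0\cup_\Sigma U_1$ be a Heegaard splitting of a closed oriented three-manifold, with pointed Heegaard diagram $(\Sigma,\boldsymbol\alpha,\boldsymbol\beta,z)$ of genus $g$: $\Sigma$ is a closed connected surface with a complex structure; $\alpha_1,\dots,\alpha_g$ (resp. $\beta_1,\dots,\beta_g$) are pairwise disjoint smoothly embedded closed curves which are attaching circles of the handlebody $U_0$ (resp. $U_1$); each $\alpha_i$ is transverse to each $\beta_j$; and $z$ lies on none of the curves. Let $\tilde Y\to Y$ be an unbranched double cover induced from a $\mathbb Z$-fold cover $\hat Y\to Y$, i.e. $\tilde Y=\hat Y/2\mathbb Z$. Let $\pi:\tilde\Sigma\to\Sigma$ be the induced double cover of surfaces, with the complex structure making $\pi$ holomorphic, let $\{\tilde z_1,\tilde z_2\}=\pi^{-1}(z)$, and let $\tilde\alpha_1,\dots,\tilde\alpha_{2g}$, $\tilde\beta_1,\dots,\tilde\beta_{2g}$ be the closed curves lifting the $\alpha_i$, $\beta_j$. Put $$M=\mathrm{Sym}^g(\Sigma-\{z\})\subset\tilde M=\mathrm{Sym}^{2g}(\tilde\Sigma-\{\tilde z_1,\tilde z_2\}),\qquad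 D\mapsto\pi^{-1}(D),$$ so that $M$ is the fixed point set of the holomorphic involution $\iota$ of $\tilde M$ induced by the deck transformation of $\pi$, and let $\mathbb T_\alpha=\prod_i\alpha_i$, $\mathbb T_\beta=\prod_j\beta_j\subset M$ and $\mathbb T_{\tilde\alpha}=\prod_i\tilde\alpha_i$, $\mathbb T_{\tilde\beta}=\prod_j\tilde\beta_j\subset\tilde M$. Let $\omega$ be any continuous field of (real, alternating) $2$-forms on $\tilde M$ that is $\iota$-invariant, is compatible with the complex structure $J$ ($\omega(Jv,Jw)=\omega(v,w)$, and $\omega(v,Jv)>0$ for $v\ne0$), and for which $\mathbb T_{\tilde\alpha}$ and $\mathbb T_{\tilde\beta}$ are Lagrangian; for instance an exact symplectic form with these properties. Polarization data over $M$ relative to $\mathbb T_\alpha,\mathbb T_\beta$ is a triple $(E,F_0,F_1)$, where $E\to M$ is a symplectic vector bundle and $F_0\subset E|_{\mathbb T_\alpha}$, $F_1\subset E|_{\mathbb T_\beta}$ are Lagrangian subbundles, transverse over $\mathbb T_\alpha\cap\mathbb T_\beta$. Two such triples $(E,F_0,F_1)$, $(E',F_0',F_1')$ are isomorphic if there is an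 isomorphism $\phi:E\to E'$ of symplectic vector bundles together with homotopies through Lagrangian subbundles, of $E'|_{\mathbb T_\alpha}$ from $\phi(F_0)$ to $F_0'$ and of $E'|_{\mathbb T_\beta}$ from $\phi(F_1)$ to $F_1'$. Then the normal polarization $\mathfrak p=(N_{M\subset\tilde M},\,N_{\mathbb T_\alpha\subset\mathbb T_{\tilde\alpha}},\,N_{\mathbb T_\beta\subset\mathbb T_{\tilde\beta}})$, where the normal bundles are the $-1$-eigenbundles of $d\iota$ on $T\tilde M|_M$, $T\mathbb T_{\tilde\alpha}|_{\mathbb T_\alpha}$, $T\mathbb T_{\tilde\beta}|_{\mathbb T_\beta}$ with the form $\omega$, and the tangential polarization $\mathfrak t=(TM,\,T\mathbb T_\alpha,\,T\mathbb T_\beta)$, with the restriction of $\omega$ to $M$, are polarization data over $M$ relative to $\mathbb T_\alpha,\mathbb T_\beta$, and $\mathfrak p$ is isomorphic to $\mathfrak t$. -/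

import Mathlib

namespace SymProd

open Topology Polynomial

variable {S : Type*} {n : ℕ}

/-- The unordered tuple underlying an ordered one. -/
def ofFun (x : Fin n → S) : Sym S n := ⟨Finset.univ.val.map x, by simp⟩

theorem mem_ofFun {x : Fin n → S} {a : S} : a ∈ ofFun x ↔ ∃ i, x i = a := by
  simp [ofFun]

theorem ofFun_surjective : Function.Surjective (ofFun : (Fin n → S) → Sym S n) := by
  intro D
  obtain ⟨m, hm⟩ := D
  induction m using Quotient.inductionOn with
  | h l =>
    have hl : l.length = n := by simpa using hm
    subst hl
    refine ⟨fun i => l.get i, Sym.coe_injective ?_⟩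
    change Multiset.map (fun i => l.get i) Finset.univ.val = (l : Multiset S)
    rw [Fin.univ_val_map]
    simp

theorem map_ofFun {Z : Type*} (f : S → Z) (x : Fin n → S) :
    Sym.map f (ofFun x) = ofFun (f ∘ x) := by
  apply Sym.coe_injective
  rw [Sym.coe_map]
  exact Multiset.map_map f x Finset.univ.val

/-- The symmetric power carries the quotient topology of the cartesian power. -/
instance instTopologicalSpace [TopologicalSpace S] : TopologicalSpace (Sym S n) :=
  TopologicalSpace.coinduced ofFun inferInstance

variable [TopologicalSpace S]

theorem isQuotientMap_ofFun : IsQuotientMap (ofFun : (Fin n → S) → Sym S n) :=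
  ⟨⟨rfl⟩, ofFun_surjective⟩

theorem isOpen_forall_mem {U : Set S} (hU : IsOpen U) : IsOpen {D : Sym S n | ∀ a ∈ D, a ∈ U} := by
  rw [← isQuotientMap_ofFun.isOpen_preimage]
  have : ofFun ⁻¹' {D : Sym S n | ∀ a ∈ D, a ∈ U} = ⋂ i, (fun x : Fin n → S => x i) ⁻¹' U := by
    ext x; simp [mem_ofFun]
  rw [this]
  exact isOpen_iInter_of_finite fun i => hU.preimage (continuous_apply i)

theorem continuousOn_map {Z : Type*} [TopologicalSpace Z] {U : Set S} (hU : IsOpen U) {f : S → Z}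
    (hf : ContinuousOn f U) : ContinuousOn (Sym.map (n := n) f) {D | ∀ a ∈ D, a ∈ U} := by
  rw [isQuotientMap_ofFun.continuousOn_isOpen_iff (isOpen_forall_mem hU)]
  have : (Sym.map (n := n) f ∘ ofFun) = ofFun ∘ fun x : Fin n → S => f ∘ x := by
    ext1 x; exact map_ofFun f x
  rw [this]
  refine isQuotientMap_ofFun.continuous.comp_continuousOn ?_
  refine continuousOn_pi.2 fun i => hf.comp (continuous_apply i).continuousOn ?_
  intro x hx
  exact hx _ (mem_ofFun.2 ⟨i, rfl⟩)

/-- The elementary symmetric functions `P₁, …, Pₙ` of an unordered `n`-tuple of complex numbers. -/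
noncomputable def esymm (D : Sym ℂ n) : Fin n → ℂ := fun i => D.1.esymm (i + 1)

/-- The monic polynomial whose roots are the entries of the tuple. -/
noncomputable def poly (D : Sym ℂ n) : ℂ[X] := (D.1.map fun a => X - C a).prod

/-- The monic polynomial with given elementary symmetric functions of the roots. -/
noncomputable def polyOf (c : Fin n → ℂ) : ℂ[X] :=
  X ^ n + ∑ i : Fin n, C ((-1) ^ (i.1 + 1) * c i) * X ^ (n - (i.1 + 1))

theorem poly_eq (D : Sym ℂ n) : poly D = polyOf (esymm D) := by
  have h := Multiset.prod_X_sub_X_eq_sum_esymm D.1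
  have hc : Multiset.card D.1 = n := D.2
  rw [hc, Finset.sum_range_succ'] at h
  rw [poly, h, polyOf, add_comm, Finset.sum_range]
  simp [esymm, Multiset.esymm, mul_assoc]

theorem poly_roots (D : Sym ℂ n) : (poly D).roots = D.1 := by
  simp [poly, Polynomial.roots_multiset_prod_X_sub_C]

theorem esymm_injective : Function.Injective (esymm : Sym ℂ n → _) := by
  intro D D' h
  apply Sym.ext
  change D.1 = D'.1
  rw [← poly_roots, ← poly_roots D', poly_eq, poly_eq, h]

theorem degree_sum_lt (c : Fin n → ℂ) :
    (∑ i : Fin n, C ((-1) ^ (i.1 + 1) * c i) * X ^ (n - (i.1 + 1))).degree < (n : WithBot ℕ) := by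
  rw [← Polynomial.mem_degreeLT]
  refine Submodule.sum_mem _ fun i _ => ?_
  rw [Polynomial.mem_degreeLT]
  refine (Polynomial.degree_C_mul_X_pow_le _ _).trans_lt ?_
  have := i.2
  exact_mod_cast (by omega : n - (i.1+1) < n)

theorem polyOf_monic (c : Fin n → ℂ) : (polyOf c).Monic :=
  Polynomial.monic_X_pow_add (degree_sum_lt c)

theorem polyOf_natDegree (c : Fin n → ℂ) : (polyOf c).natDegree = n := by
  rw [polyOf, Polynomial.natDegree_eq_of_degree_eq_some]
  have h : (X ^ n : ℂ[X]).degree = n := Polynomial.degree_X_pow n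
  rw [Polynomial.degree_add_eq_left_of_degree_lt (by rw [h]; exact degree_sum_lt c), h]

theorem polyOf_coeff (c : Fin n → ℂ) (i : Fin n) :
    (polyOf c).coeff (n - (i.1 + 1)) = (-1) ^ (i.1 + 1) * c i := by
  have hi := i.2
  rw [polyOf, Polynomial.coeff_add, Polynomial.coeff_X_pow, if_neg (by omega), zero_add,
    Polynomial.finsetSum_coeff, Finset.sum_eq_single i]
  · rw [Polynomial.coeff_C_mul, Polynomial.coeff_X_pow, if_pos rfl, mul_one]
  · intro j _ hj
    have hj2 := j.2
    have : j.1 ≠ i.1 := fun h => hj (Fin.ext h)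
    rw [Polynomial.coeff_C_mul, Polynomial.coeff_X_pow, if_neg (by omega), mul_zero]
  · simp

/-- The roots of `polyOf c`. -/
noncomputable def rootsOf (c : Fin n → ℂ) : Sym ℂ n :=
  ⟨(polyOf c).roots, by
    rw [← (IsAlgClosed.splits (polyOf c)).natDegree_eq_card_roots, polyOf_natDegree]⟩

theorem polyOf_injective : Function.Injective (polyOf : (Fin n → ℂ) → ℂ[X]) := by
  intro c c' h
  ext i
  have h1 := polyOf_coeff c i
  rw [h, polyOf_coeff c'] at h1
  exact (mul_left_cancel₀ (pow_ne_zero _ (by norm_num)) h1).symm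

theorem poly_rootsOf (c : Fin n → ℂ) : poly (rootsOf c) = polyOf c := by
  have := (IsAlgClosed.splits (polyOf c)).eq_prod_roots
  rw [(polyOf_monic c).leadingCoeff, C_1, one_mul] at this
  exact this.symm

theorem esymm_rootsOf (c : Fin n → ℂ) : esymm (rootsOf c) = c := by
  apply polyOf_injective
  rw [← poly_eq, poly_rootsOf]

theorem rootsOf_esymm (D : Sym ℂ n) : rootsOf (esymm D) = D :=
  esymm_injective (esymm_rootsOf _)

theorem continuous_esymm_ofFun : Continuous fun x : Fin n → ℂ => esymm (ofFun x) := by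
  refine continuous_pi fun i => ?_
  have : (fun x : Fin n → ℂ => esymm (ofFun x) i) =
      fun x => ∑ t ∈ Finset.univ.powersetCard (i.1 + 1), ∏ j ∈ t, x j := by
    ext x
    simp only [esymm, ofFun]
    exact Finset.esymm_map_val x Finset.univ (i.1 + 1)
  rw [this]
  fun_prop

theorem norm_lt_of_mem {D : Sym ℂ n} {a : ℂ} (ha : a ∈ D) : ‖a‖ < ‖esymm D‖ + 2 := by
  have h0 : poly D ≠ 0 := by rw [poly_eq]; exact (polyOf_monic _).ne_zero
  have hroot : (poly D).IsRoot a := by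
    rw [← Polynomial.mem_roots h0, poly_roots]; exact ha
  have := hroot.norm_lt_cauchyBound h0
  refine lt_of_lt_of_le (show ‖a‖ < (cauchyBound (poly D) : ℝ) by exact_mod_cast this) ?_
  have hb : cauchyBound (poly D) ≤ ‖esymm D‖₊ + 1 := by
    rw [poly_eq, cauchyBound, (polyOf_monic _).leadingCoeff, polyOf_natDegree]
    simp only [nnnorm_one, div_one]
    gcongr
    refine Finset.sup_le fun k hk => ?_
    have hk' := Finset.mem_range.1 hk
    have hc := polyOf_coeff (esymm D) ⟨n - 1 - k, by omega⟩
    have e1 : n - (n - 1 - k + 1) = k := by omega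
    simp only [e1] at hc
    rw [hc]
    simp only [nnnorm_mul, nnnorm_pow, nnnorm_neg, nnnorm_one, one_pow, one_mul]
    exact nnnorm_le_pi_nnnorm (esymm D) _
  have : (cauchyBound (poly D) : ℝ) ≤ ‖esymm D‖ + 1 := by exact_mod_cast hb
  linarith

theorem isClosedMap_esymm : IsClosedMap (esymm : Sym ℂ n → (Fin n → ℂ)) := by
  have hp : IsProperMap fun x : Fin n → ℂ => esymm (ofFun x) := by
    refine isProperMap_iff_isCompact_preimage.2 ⟨continuous_esymm_ofFun, fun {K} hK => ?_⟩
    refine Metric.isCompact_of_isClosed_isBounded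
      (hK.isClosed.preimage continuous_esymm_ofFun) ?_
    obtain ⟨R, hR⟩ := hK.isBounded.exists_norm_le
    refine (Metric.isBounded_closedBall (x := (0 : Fin n → ℂ)) (r := max (R + 2) 0)).subset ?_
    intro x hx
    rw [mem_closedBall_zero_iff, pi_norm_le_iff_of_nonneg (le_max_right _ _)]
    intro i
    have := norm_lt_of_mem (D := ofFun x) (mem_ofFun.2 ⟨i, rfl⟩)
    have := hR _ hx
    exact le_max_of_le_left (by linarith)
  intro T hT
  have : esymm '' T = (fun x : Fin n → ℂ => esymm (ofFun x)) '' (ofFun ⁻¹' T) := by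
    rw [← Function.comp_def, Set.image_comp, Set.image_preimage_eq _ ofFun_surjective]
  rw [this]
  exact hp.isClosedMap _ (hT.preimage isQuotientMap_ofFun.continuous)

/-- The elementary symmetric functions identify `Symⁿ ℂ` with `ℂⁿ`. -/
noncomputable def esymmHomeomorph : Sym ℂ n ≃ₜ (Fin n → ℂ) :=
  Equiv.toHomeomorphOfContinuousClosed
    ⟨esymm, rootsOf, rootsOf_esymm, esymm_rootsOf⟩
    (isQuotientMap_ofFun.continuous_iff.2 continuous_esymm_ofFun) isClosedMap_esymm

/-- The chart of `Symⁿ S` induced by a (possibly disconnected) chart of `X`. -/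
noncomputable def chart (φ : OpenPartialHomeomorph S ℂ) :
    OpenPartialHomeomorph (Sym S n) (Fin n → ℂ) :=
  OpenPartialHomeomorph.trans
    { toFun := Sym.map φ
      invFun := Sym.map φ.symm
      source := {D | ∀ a ∈ D, a ∈ φ.source}
      target := {D | ∀ a ∈ D, a ∈ φ.target}
      map_source' := by
        intro D hD b hb
        obtain ⟨a, ha, rfl⟩ := Sym.mem_map.1 hb
        exact φ.map_source (hD a ha)
      map_target' := by
        intro D hD b hb
        obtain ⟨a, ha, rfl⟩ := Sym.mem_map.1 hb
        exact φ.map_target (hD a ha)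
      left_inv' := by
        intro D hD
        rw [Sym.map_map]
        conv_rhs => rw [← Sym.map_id D]
        exact Sym.map_congr fun a ha => φ.left_inv (hD a ha)
      right_inv' := by
        intro D hD
        rw [Sym.map_map]
        conv_rhs => rw [← Sym.map_id D]
        exact Sym.map_congr fun a ha => φ.right_inv (hD a ha)
      open_source := isOpen_forall_mem φ.open_source
      open_target := isOpen_forall_mem φ.open_target
      continuousOn_toFun := continuousOn_map φ.open_source φ.continuousOn
      continuousOn_invFun := continuousOn_map φ.open_target φ.continuousOn_symm }
    esymmHomeomorph.toOpenPartialHomeomorph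

open scoped ContDiff

theorem polyOf_eq_smul (c : Fin n → ℂ) :
    polyOf c = X ^ n + ∑ i : Fin n, c i • ((-1 : ℂ) ^ (i.1 + 1) • (X : ℂ[X]) ^ (n - (i.1 + 1))) := by
  rw [polyOf]
  congr 1
  refine Finset.sum_congr rfl fun i _ => ?_
  rw [smul_smul, Polynomial.smul_eq_C_mul, mul_comm (c i)]

theorem contDiff_linear_polyOf {A : Type*} [NormedAddCommGroup A] [NormedSpace ℂ A]
    (T : ℂ[X] →ₗ[ℂ] A) : ContDiff ℂ ω fun c : Fin n → ℂ => T (polyOf c) := by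
  simp only [polyOf_eq_smul, map_add, map_sum, map_smul]
  exact contDiff_const.add (ContDiff.sum fun i _ => (contDiff_apply ℂ ℂ i).smul contDiff_const)

/-- Integration over a circle as a continuous linear functional on functions on the circle. -/
noncomputable def circleCLM (w : ℂ) {r : ℝ} (hr : 0 ≤ r) : C(Metric.sphere w r, ℂ) →L[ℂ] ℂ :=
  LinearMap.mkContinuous
    { toFun := fun f => ∫ θ in (0 : ℝ)..2 * Real.pi,
        deriv (circleMap w r) θ * f ⟨circleMap w r θ, circleMap_mem_sphere w hr θ⟩
      map_add' := by
        intro f f'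
        simp only [ContinuousMap.add_apply, mul_add]
        refine intervalIntegral.integral_add ?_ ?_ <;>
        · refine Continuous.intervalIntegrable ?_ _ _
          simp only [deriv_circleMap]
          fun_prop
      map_smul' := by
        intro a f
        simp only [ContinuousMap.smul_apply, smul_eq_mul, RingHom.id_apply]
        rw [← intervalIntegral.integral_const_mul]
        congr 1
        ext θ
        ring }
    (r * |2 * Real.pi - 0|) (by
      intro f
      refine (intervalIntegral.norm_integral_le_of_norm_le_const (C := r * ‖f‖) ?_).trans
        (le_of_eq (by ring))
      intro θ _
      rw [norm_mul]
      gcongr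
      · simp [deriv_circleMap, abs_of_nonneg hr]
      · exact f.norm_coe_le_norm _)

theorem circleCLM_eq (w : ℂ) {r : ℝ} (hr : 0 ≤ r) (f : C(Metric.sphere w r, ℂ)) (F : ℂ → ℂ)
    (h : ∀ z, f z = F z) : circleCLM w hr f = ∮ z in C(w, r), F z := by
  simp only [circleCLM, circleIntegral, LinearMap.mkContinuous_apply, LinearMap.coe_mk,
    AddHom.coe_mk, h, smul_eq_mul]

theorem contDiffAt_circle {h : ℂ → ℂ} {w : ℂ} {r : ℝ} (hr : 0 ≤ r)
    (hh : ContinuousOn h (Metric.sphere w r)) {c₀ : Fin n → ℂ}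
    (h0 : ∀ z ∈ Metric.sphere w r, (polyOf c₀).eval z ≠ 0) :
    ContDiffAt ℂ ω (fun c => ∮ z in C(w, r),
      h z * ((derivative (polyOf c)).eval z / (polyOf c).eval z)) c₀ := by
  let T : ℂ[X] →ₗ[ℂ] C(Metric.sphere w r, ℂ) :=
    (Polynomial.toContinuousMapOnAlgHom (Metric.sphere w r)).toLinearMap
  let hA : C(Metric.sphere w r, ℂ) := ⟨_, hh.domRestrict⟩
  have hT : ∀ (p : ℂ[X]) (z : Metric.sphere w r), T p z = p.eval (z : ℂ) := fun p z => rfl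
  have hu : ∀ c : Fin n → ℂ, (∀ z ∈ Metric.sphere w r, (polyOf c).eval z ≠ 0) ↔
      IsUnit (T (polyOf c)) := by
    intro c
    rw [ContinuousMap.isUnit_iff_forall_ne_zero]
    simp only [hT, Subtype.forall]
  have hcd0 : ContDiff ℂ ω fun c : Fin n → ℂ => T (polyOf c) := contDiff_linear_polyOf T
  have hcd1 : ContDiff ℂ ω fun c : Fin n → ℂ => (T ∘ₗ derivative) (polyOf c) :=
    contDiff_linear_polyOf _
  have hF : ContDiffAt ℂ ω (fun c : Fin n → ℂ => circleCLM w hr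
      (hA * ((T ∘ₗ derivative) (polyOf c) * Ring.inverse (T (polyOf c))))) c₀ := by
    obtain ⟨u, hu0⟩ := (hu c₀).1 h0
    have hi : ContDiffAt ℂ ω (Ring.inverse : C(Metric.sphere w r, ℂ) → _) (T (polyOf c₀)) := by
      rw [← hu0]
      exact contDiffAt_ringInverse ℂ u
    have hi' : ContDiffAt ℂ ω (fun c : Fin n → ℂ => Ring.inverse (T (polyOf c))) c₀ :=
      ContDiffAt.comp (g := Ring.inverse) (f := fun c : Fin n → ℂ => T (polyOf c)) c₀ hi
        hcd0.contDiffAt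
    have hm : ContDiffAt ℂ ω (fun c : Fin n → ℂ =>
        hA * ((T ∘ₗ derivative) (polyOf c) * Ring.inverse (T (polyOf c)))) c₀ :=
      contDiffAt_const.mul (hcd1.contDiffAt.mul hi')
    exact (circleCLM w hr).contDiff.contDiffAt.comp c₀ hm
  refine hF.congr_of_eventuallyEq ?_
  have hopen : ∀ᶠ c in 𝓝 c₀, IsUnit (T (polyOf c)) :=
    hcd0.continuous.continuousAt.eventually (Units.isOpen.mem_nhds ((hu c₀).1 h0))
  filter_upwards [hopen] with c hc
  refine (circleCLM_eq w hr _ _ fun z => ?_).symm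
  have hinv : T (polyOf c) z * Ring.inverse (T (polyOf c)) z = 1 := by
    rw [← ContinuousMap.mul_apply, Ring.mul_inverse_cancel _ hc, ContinuousMap.one_apply]
  have : Ring.inverse (T (polyOf c)) z = ((polyOf c).eval (z : ℂ))⁻¹ := by
    rw [hT] at hinv
    exact eq_inv_of_mul_eq_one_right hinv
  rw [ContinuousMap.mul_apply, ContinuousMap.mul_apply, this, div_eq_mul_inv]
  rfl

/-- The sum of the values of a function over an unordered tuple. -/
noncomputable def sumOver (h : ℂ → ℂ) (D : Sym ℂ n) : ℂ := (D.1.map h).sum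

theorem sumOver_ofFun (h : ℂ → ℂ) (x : Fin n → ℂ) : sumOver h (ofFun x) = ∑ i, h (x i) := by
  simp only [sumOver, ofFun]
  exact congrArg Multiset.sum (Multiset.map_map h x Finset.univ.val)

theorem poly_ofFun (x : Fin n → ℂ) : poly (ofFun x) = ∏ i, (X - C (x i)) := by
  simp only [poly, ofFun]
  exact congrArg Multiset.prod (Multiset.map_map (fun a => X - C a) x Finset.univ.val)

theorem logDeriv_eq (x : Fin n → ℂ) {z : ℂ} (hz : ∀ i, z ≠ x i) :
    (derivative (poly (ofFun x))).eval z / (poly (ofFun x)).eval z = ∑ i, (z - x i)⁻¹ := by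
  have h0 : (poly (ofFun x)).eval z ≠ 0 := by
    rw [poly_ofFun, Polynomial.eval_prod, Finset.prod_ne_zero_iff]
    intro i _
    simpa using sub_ne_zero.2 (hz i)
  rw [(IsAlgClosed.splits _).eval_derivative_div_eval_of_ne_zero h0, poly_roots]
  simp only [ofFun, one_div]
  exact congrArg Multiset.sum (Multiset.map_map (fun a => (z - a)⁻¹) x Finset.univ.val)

theorem circle_single {h : ℂ → ℂ} {w a : ℂ} {r : ℝ} (hr : 0 < r)
    (hh : DifferentiableOn ℂ h (Metric.closedBall w r)) (ha : a ∉ Metric.sphere w r) [Decidable (a ∈ Metric.ball w r)] :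
    (∮ z in C(w, r), h z * (z - a)⁻¹) =
      if a ∈ Metric.ball w r then (2 * Real.pi * Complex.I) * h a else 0 := by
  split_ifs with hb
  · have := hh.circleIntegral_sub_inv_smul hb
    simpa only [smul_eq_mul, mul_comm] using this
  · have hac : a ∉ Metric.closedBall w r := by
      rw [← Metric.ball_union_sphere]; exact fun h => h.elim hb ha
    refine DiffContOnCl.circleIntegral_eq_zero hr.le ?_
    have hd : DifferentiableOn ℂ (fun z => h z * (z - a)⁻¹) (Metric.closedBall w r) := by
      refine hh.mul ?_
      refine DifferentiableOn.inv (by fun_prop) fun z hz => ?_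
      exact sub_ne_zero.2 fun e => hac (e ▸ hz)
    exact (hd.mono Metric.closure_ball_subset_closedBall).diffContOnCl

theorem contDiffAt_sumOver {V : Set ℂ} (hV : IsOpen V) {h : ℂ → ℂ} (hh : DifferentiableOn ℂ h V)
    {c₀ : Fin n → ℂ} (h0 : ∀ a ∈ rootsOf c₀, a ∈ V) :
    ContDiffAt ℂ ω (fun c => sumOver h (rootsOf c)) c₀ := by
  classical
  let W : Finset ℂ := (rootsOf c₀).1.toFinset
  have hW : ∀ a, a ∈ W ↔ a ∈ rootsOf c₀ := fun a => Multiset.mem_toFinset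
  obtain ⟨r, hr, hrV, hrd⟩ : ∃ r : ℝ, 0 < r ∧ (∀ w ∈ W, Metric.closedBall w r ⊆ V) ∧
      ∀ w ∈ W, ∀ w' ∈ W, w ≠ w' → 2 * r < dist w w' := by
    have e1 : ∀ᶠ r in 𝓝[>] (0 : ℝ), ∀ w ∈ W, Metric.closedBall w r ⊆ V := by
      rw [Filter.eventually_all_finset]
      intro w hw
      obtain ⟨ε, hε, hs⟩ := Metric.nhds_basis_closedBall.mem_iff.1
        (hV.mem_nhds (h0 w ((hW w).1 hw)))
      filter_upwards [Ioo_mem_nhdsGT hε] with r hr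
      exact (Metric.closedBall_subset_closedBall hr.2.le).trans hs
    have e2 : ∀ᶠ r in 𝓝[>] (0 : ℝ), ∀ w ∈ W, ∀ w' ∈ W, w ≠ w' → 2 * r < dist w w' := by
      rw [Filter.eventually_all_finset]
      intro w _
      rw [Filter.eventually_all_finset]
      intro w' _
      by_cases hne : w = w'
      · simp [hne]
      · filter_upwards [Ioo_mem_nhdsGT (half_pos (dist_pos.2 hne))] with r hr _
        linarith [hr.2]
    obtain ⟨r, ⟨h1, h2⟩, h3⟩ := ((e1.and e2).and self_mem_nhdsWithin).exists
    exact ⟨r, h3, h1, h2⟩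
  let O : Set ℂ := ⋃ w ∈ W, Metric.ball w r
  have hO : IsOpen O := isOpen_biUnion fun _ _ => Metric.isOpen_ball
  have hsep : ∀ w ∈ W, ∀ a ∈ O, a ∉ Metric.sphere w r := by
    intro w hw a ha hs
    obtain ⟨w', hw', ha'⟩ := Set.mem_iUnion₂.1 ha
    rw [Metric.mem_ball] at ha'
    rw [Metric.mem_sphere] at hs
    by_cases hne : w = w'
    · subst hne; linarith
    · have := hrd w hw w' hw' hne
      have := dist_triangle_left w w' a
      linarith
  have key : ∀ c : Fin n → ℂ, (∀ a ∈ rootsOf c, a ∈ O) → sumOver h (rootsOf c) =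
      ∑ w ∈ W, (2 * Real.pi * Complex.I)⁻¹ * ∮ z in C(w, r),
        h z * ((derivative (polyOf c)).eval z / (polyOf c).eval z) := by
    intro c hc
    obtain ⟨x, hx⟩ := ofFun_surjective (rootsOf c)
    rw [← hx] at hc
    have hxO : ∀ i, x i ∈ O := fun i => hc _ (mem_ofFun.2 ⟨i, rfl⟩)
    have hint : ∀ w ∈ W, (∮ z in C(w, r),
        h z * ((derivative (polyOf c)).eval z / (polyOf c).eval z)) =
        ∑ i, if x i ∈ Metric.ball w r then (2 * Real.pi * Complex.I) * h (x i) else 0 := by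
      intro w hw
      have hne : ∀ z ∈ Metric.sphere w r, ∀ i, z ≠ x i := fun z hz i e =>
        hsep w hw _ (hxO i) (e ▸ hz)
      rw [← poly_rootsOf, ← hx]
      rw [circleIntegral.integral_congr hr.le (g := fun z => ∑ i, h z * (z - x i)⁻¹)
        fun z hz => by simp only [logDeriv_eq x (hne z hz), Finset.mul_sum]]
      rw [circleIntegral.integral_fun_sum]
      · exact Finset.sum_congr rfl fun i _ =>
          circle_single hr (hh.mono (hrV w hw)) (hsep w hw _ (hxO i))
      · intro i _
        refine ContinuousOn.circleIntegrable hr.le ?_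
        refine ContinuousOn.mul (hh.continuousOn.mono
          (Metric.sphere_subset_closedBall.trans (hrV w hw))) ?_
        refine ContinuousOn.inv₀ (by fun_prop) fun z hz => sub_ne_zero.2 (hne z hz i)
    rw [Finset.sum_congr rfl fun w hw => by rw [hint w hw], ← hx, sumOver_ofFun]
    simp only [Finset.mul_sum]
    rw [Finset.sum_comm]
    refine Finset.sum_congr rfl fun i _ => ?_
    obtain ⟨w, hw, hb⟩ := Set.mem_iUnion₂.1 (hxO i)
    rw [Finset.sum_eq_single_of_mem w hw, if_pos hb]
    · rw [← mul_assoc, inv_mul_cancel₀ Complex.two_pi_I_ne_zero, one_mul]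
    · intro w' hw' hne
      rw [if_neg, mul_zero]
      intro hb'
      rw [Metric.mem_ball] at hb hb'
      have := hrd w' hw' w hw hne
      have := dist_triangle_left w' w (x i)
      linarith
  have hcont : Continuous (rootsOf : (Fin n → ℂ) → Sym ℂ n) := esymmHomeomorph.symm.continuous
  have hev : ∀ᶠ c in 𝓝 c₀, ∀ a ∈ rootsOf c, a ∈ O := by
    refine hcont.continuousAt.eventually ((isOpen_forall_mem hO).mem_nhds ?_)
    intro a ha
    exact Set.mem_iUnion₂.2 ⟨a, (hW a).2 ha, Metric.mem_ball_self hr⟩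
  refine ContDiffAt.congr_of_eventuallyEq ?_ (hev.mono fun c hc => key c hc)
  refine ContDiffAt.sum fun w hw => contDiffAt_const.mul (contDiffAt_circle hr.le
    (hh.continuousOn.mono (Metric.sphere_subset_closedBall.trans (hrV w hw))) ?_)
  intro z hz he
  have hroot : z ∈ rootsOf c₀ := by
    change z ∈ (polyOf c₀).roots
    exact (Polynomial.mem_roots (polyOf_monic c₀).ne_zero).2 he
  refine hsep w hw z (Set.mem_iUnion₂.2 ⟨z, (hW z).2 hroot, Metric.mem_ball_self hr⟩) hz

theorem newton (D : Sym ℂ n) (k : ℕ) : (k : ℂ) * D.1.esymm k = (-1) ^ (k + 1) *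
    ∑ a ∈ Finset.HasAntidiagonal.antidiagonal k with a.1 < k,
      (-1) ^ a.1 * D.1.esymm a.1 * sumOver (fun z => z ^ a.2) D := by
  obtain ⟨x, rfl⟩ := ofFun_surjective D
  have h := congrArg (MvPolynomial.aeval x) (MvPolynomial.mul_esymm_eq_sum (Fin n) ℂ k)
  simp only [map_mul, map_natCast, map_pow, map_neg, map_one, map_sum,
    MvPolynomial.aeval_esymm_eq_multiset_esymm] at h
  refine h.trans ?_
  congr 1
  refine Finset.sum_congr rfl fun a _ => ?_
  rw [sumOver_ofFun]
  simp [MvPolynomial.psum, ofFun]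

theorem contDiffAt_esymm_map {V : Set ℂ} (hV : IsOpen V) {f : ℂ → ℂ}
    (hf : DifferentiableOn ℂ f V) {c₀ : Fin n → ℂ} (h0 : ∀ a ∈ rootsOf c₀, a ∈ V) (k : ℕ) :
    ContDiffAt ℂ ω (fun c => (Sym.map f (rootsOf c)).1.esymm k) c₀ := by
  induction k using Nat.strong_induction_on with
  | _ k ih =>
    rcases Nat.eq_zero_or_pos k with rfl | hk
    · simp only [Multiset.esymm, Multiset.powersetCard_zero_left, Multiset.map_singleton,
        Multiset.prod_zero, Multiset.sum_singleton]
      exact contDiffAt_const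
    have hk' : (k : ℂ) ≠ 0 := by exact_mod_cast hk.ne'
    have e : (fun c : Fin n → ℂ => (Sym.map f (rootsOf c)).1.esymm k) = fun c => (k : ℂ)⁻¹ *
        ((-1) ^ (k + 1) * ∑ a ∈ Finset.HasAntidiagonal.antidiagonal k with a.1 < k,
          (-1) ^ a.1 * (Sym.map f (rootsOf c)).1.esymm a.1 *
            sumOver (fun z => f z ^ a.2) (rootsOf c)) := by
      ext c
      rw [eq_inv_mul_iff_mul_eq₀ hk', newton]
      congr 1
      refine Finset.sum_congr rfl fun a _ => ?_
      congr 1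
      simp only [sumOver]
      exact congrArg Multiset.sum (Multiset.map_map _ _ _)
    rw [e]
    refine contDiffAt_const.mul (contDiffAt_const.mul (ContDiffAt.sum fun a ha => ?_))
    refine (contDiffAt_const.mul (ih a.1 (Finset.mem_filter.1 ha).2)).mul ?_
    exact contDiffAt_sumOver hV (hf.pow _) h0

section Manifold
open scoped Manifold

theorem coe_chart (φ : OpenPartialHomeomorph S ℂ) (D : Sym S n) :
    chart φ D = esymm (Sym.map φ D) := rfl

theorem coe_chart_symm (φ : OpenPartialHomeomorph S ℂ) (c : Fin n → ℂ) :
    (chart φ).symm c = Sym.map φ.symm (rootsOf c) := rfl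

theorem mem_chart_source {φ : OpenPartialHomeomorph S ℂ} {D : Sym S n} :
    D ∈ (chart φ).source ↔ ∀ a ∈ D, a ∈ φ.source := by
  simp [chart]

theorem mem_chart_target {φ : OpenPartialHomeomorph S ℂ} {c : Fin n → ℂ} :
    c ∈ (chart φ).target ↔ ∀ a ∈ rootsOf c, a ∈ φ.target := by
  simp only [chart, OpenPartialHomeomorph.trans_target, Homeomorph.toOpenPartialHomeomorph_target,
    Set.univ_inter]
  rfl

variable [ChartedSpace ℂ S]

theorem contDiffOn_transition {φ ψ : OpenPartialHomeomorph S ℂ}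
    (hφ : φ.MDifferentiable 𝓘(ℂ) 𝓘(ℂ)) (hψ : ψ.MDifferentiable 𝓘(ℂ) 𝓘(ℂ)) :
    ContDiffOn ℂ ω ((chart (n := n) φ).symm ≫ₕ chart ψ) ((chart φ).symm ≫ₕ chart ψ).source := by
  have hd : DifferentiableOn ℂ (ψ ∘ φ.symm) (φ.symm ≫ₕ ψ).source :=
    mdifferentiableOn_iff_differentiableOn.1 (hφ.symm.trans hψ).1
  intro c hc
  have hc0 : ∀ a ∈ rootsOf c, a ∈ (φ.symm ≫ₕ ψ).source := by
    rw [OpenPartialHomeomorph.trans_source] at hc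
    intro a ha
    rw [OpenPartialHomeomorph.trans_source]
    refine ⟨mem_chart_target.1 hc.1 a ha, ?_⟩
    have := mem_chart_source.1 hc.2
    rw [coe_chart_symm] at this
    exact this _ (Sym.mem_map.2 ⟨a, ha, rfl⟩)
  refine ContDiffAt.contDiffWithinAt (contDiffAt_pi.2 fun i => ?_)
  refine (contDiffAt_esymm_map (φ.symm ≫ₕ ψ).open_source hd hc0 (i.1 + 1)).congr_of_eventuallyEq
    (Filter.Eventually.of_forall fun c' => ?_)
  change (Sym.map ψ (Sym.map φ.symm (rootsOf c'))).1.esymm (i.1 + 1) = _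
  rw [Sym.map_map]

theorem mdifferentiable_disjointUnion {φ ψ : OpenPartialHomeomorph S ℂ}
    (hφ : φ.MDifferentiable 𝓘(ℂ) 𝓘(ℂ)) (hψ : ψ.MDifferentiable 𝓘(ℂ) 𝓘(ℂ))
    (hs : Disjoint φ.source ψ.source) (ht : Disjoint φ.target ψ.target) :
    ∃ χ : OpenPartialHomeomorph S ℂ, χ.MDifferentiable 𝓘(ℂ) 𝓘(ℂ) ∧
      χ.source = φ.source ∪ ψ.source ∧ χ.target = φ.target ∪ ψ.target := by
  classical
  refine ⟨φ.disjointUnion ψ hs ht, ⟨?_, ?_⟩, rfl, rfl⟩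
  · rintro x (hx | hx)
    · refine ((hφ.mdifferentiableAt hx).congr_of_eventuallyEq ?_).mdifferentiableWithinAt
      filter_upwards [φ.open_source.mem_nhds hx] with y hy
      exact Set.piecewise_eq_of_mem _ _ _ hy
    · refine ((hψ.mdifferentiableAt hx).congr_of_eventuallyEq ?_).mdifferentiableWithinAt
      filter_upwards [ψ.open_source.mem_nhds hx] with y hy
      exact Set.piecewise_eq_of_notMem _ _ _ (Set.disjoint_right.1 hs hy)
  · rintro x (hx | hx)
    · refine ((hφ.mdifferentiableAt_symm hx).congr_of_eventuallyEq ?_).mdifferentiableWithinAt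
      filter_upwards [φ.open_target.mem_nhds hx] with y hy
      exact Set.piecewise_eq_of_mem _ _ _ hy
    · refine ((hψ.mdifferentiableAt_symm hx).congr_of_eventuallyEq ?_).mdifferentiableWithinAt
      filter_upwards [ψ.open_target.mem_nhds hx] with y hy
      exact Set.piecewise_eq_of_notMem _ _ _ (Set.disjoint_right.1 ht hy)

theorem mdifferentiable_restr {φ : OpenPartialHomeomorph S ℂ}
    (hφ : φ.MDifferentiable 𝓘(ℂ) 𝓘(ℂ)) {U : Set S} (hU : IsOpen U) :
    (φ.restrOpen U hU).MDifferentiable 𝓘(ℂ) 𝓘(ℂ) :=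
  ⟨hφ.1.mono fun _ hx => hx.1, hφ.2.mono fun _ hx => hx.1⟩

variable [IsManifold 𝓘(ℂ) ω S]

/-- Every point has a holomorphic chart with values in a given disc, inside a given open set. -/
theorem exists_small_chart (x : S) {U : Set S} (hU : IsOpen U) (hx : x ∈ U) (b : ℂ) :
    ∃ χ : OpenPartialHomeomorph S ℂ, χ.MDifferentiable 𝓘(ℂ) 𝓘(ℂ) ∧ x ∈ χ.source ∧
      χ.source ⊆ U ∧ χ.target ⊆ Metric.ball b 1 := by
  let φ := chartAt ℂ x
  have hφ : φ.MDifferentiable 𝓘(ℂ) 𝓘(ℂ) := mdifferentiable_chart x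
  let t : ℂ ≃ₜ ℂ := Homeomorph.addRight (b - φ x)
  let τ : OpenPartialHomeomorph S ℂ := φ.trans t.toOpenPartialHomeomorph
  have hτ : τ.MDifferentiable 𝓘(ℂ) 𝓘(ℂ) := by
    refine hφ.trans ⟨?_, ?_⟩ <;> rw [mdifferentiableOn_iff_differentiableOn]
    · change DifferentiableOn ℂ (fun z => z + (b - φ x)) _
      fun_prop
    · change DifferentiableOn ℂ (fun z => z + -(b - φ x)) _
      fun_prop
  have hτx : τ x = b := by
    change φ x + (b - φ x) = b
    ring
  have hxs : x ∈ τ.source := by simp [τ, φ]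
  have hV : IsOpen (τ.source ∩ τ ⁻¹' Metric.ball b 1) :=
    τ.isOpen_inter_preimage Metric.isOpen_ball
  refine ⟨τ.restrOpen (U ∩ (τ.source ∩ τ ⁻¹' Metric.ball b 1)) (hU.inter hV),
    mdifferentiable_restr hτ _, ?_, ?_, ?_⟩
  · exact ⟨hxs, hx, hxs, by simp [hτx]⟩
  · exact fun y hy => hy.2.1
  · rintro z ⟨hz, hz'⟩
    have := hz'.2.2
    rw [Set.mem_preimage, τ.right_inv hz] at this
    exact this

variable [T2Space S]

theorem exists_chart [Nonempty S] (s : Finset S) : ∃ φ : OpenPartialHomeomorph S ℂ,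
    φ.MDifferentiable 𝓘(ℂ) 𝓘(ℂ) ∧ (∀ x ∈ s, x ∈ φ.source) ∧ Bornology.IsBounded φ.target := by
  classical
  induction s using Finset.induction_on with
  | empty =>
    refine ⟨(chartAt ℂ (Classical.arbitrary S)).restrOpen ∅ isOpen_empty,
      mdifferentiable_restr (mdifferentiable_chart _) _, by simp, ?_⟩
    exact Bornology.isBounded_empty.subset fun z hz => hz.2.elim
  | insert x s hx ih =>
    obtain ⟨φ, hφ, hs, hb⟩ := ih
    obtain ⟨U, V, hU, hV, hsU, hxV, hUV⟩ := SeparatedNhds.of_finset_finset s {x}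
      (Finset.disjoint_singleton_right.2 hx)
    obtain ⟨R, hR⟩ := hb.subset_closedBall 0
    obtain ⟨χ, hχ, hxχ, hχV, hχt⟩ := exists_small_chart x hV (hxV (by simp)) ((R + 1 : ℝ) : ℂ)
    have hsub : (φ.restrOpen U hU).target ⊆ φ.target := fun z hz => hz.1
    obtain ⟨ρ, hρ, hρs, hρt⟩ := mdifferentiable_disjointUnion (mdifferentiable_restr hφ hU) hχ
      (hUV.mono (fun y hy => hy.2) hχV) (by
        rw [Set.disjoint_left]
        intro z hz hz'
        have h1 := hR (hsub hz)
        have h2 := hχt hz'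
        rw [mem_closedBall_zero_iff] at h1
        rw [Metric.mem_ball, dist_comm, dist_eq_norm] at h2
        have h3 := norm_sub_norm_le ((R + 1 : ℝ) : ℂ) z
        rw [Complex.norm_real] at h3
        have := le_abs_self (R + 1)
        rw [Real.norm_eq_abs] at h3
        linarith)
    refine ⟨ρ, hρ, ?_, ?_⟩
    · intro y hy
      rw [hρs]
      rcases Finset.mem_insert.1 hy with rfl | hy
      · exact Or.inr hxχ
      · exact Or.inl ⟨hs y hy, hsU hy⟩
    · rw [hρt]
      exact (hb.subset hsub).union (Metric.isBounded_ball.subset hχt)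

theorem exists_baseChart (hn : n ≠ 0) (D : Sym S n) : ∃ φ : OpenPartialHomeomorph S ℂ,
    φ.MDifferentiable 𝓘(ℂ) 𝓘(ℂ) ∧ ∀ a ∈ D, a ∈ φ.source := by
  classical
  have : Nonempty S := by
    obtain ⟨x, -⟩ := ofFun_surjective D
    exact ⟨x ⟨0, Nat.pos_of_ne_zero hn⟩⟩
  obtain ⟨φ, hφ, h, -⟩ := exists_chart D.1.toFinset
  exact ⟨φ, hφ, fun a ha => h a (Multiset.mem_toFinset.2 ha)⟩

/-- The chart of the one-point space `Sym⁰ S`. -/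
def pointChart (hn : n = 0) (D : Sym S n) : OpenPartialHomeomorph (Sym S n) (Fin n → ℂ) where
  toFun _ := 0
  invFun _ := D
  source := Set.univ
  target := Set.univ
  map_source' _ _ := trivial
  map_target' _ _ := trivial
  left_inv' D' _ := by subst hn; exact Subsingleton.elim _ _
  right_inv' c _ := by subst hn; exact Subsingleton.elim _ _
  open_source := isOpen_univ
  open_target := isOpen_univ
  continuousOn_toFun := continuousOn_const
  continuousOn_invFun := continuousOn_const

open Classical in
/-- The `n`-fold symmetric product of a Riemann surface as a complex `n`-manifold: the charts are
the elementary symmetric functions of holomorphic coordinates of the points (a holomorphic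
coordinate may have disconnected domain, so that it covers several points at once); `Sym⁰` is a
point. -/
noncomputable instance instChartedSpace : ChartedSpace (Fin n → ℂ) (Sym S n) where
  atlas := {e | (∃ φ : OpenPartialHomeomorph S ℂ, φ.MDifferentiable 𝓘(ℂ) 𝓘(ℂ) ∧ e = chart φ) ∨
    n = 0}
  chartAt D := if hn : n = 0 then pointChart hn D else chart (exists_baseChart hn D).choose
  mem_chart_source D := by
    split_ifs with hn
    · trivial
    · exact mem_chart_source.2 (exists_baseChart hn D).choose_spec.2
  chart_mem_atlas D := by
    split_ifs with hn
    · exact Or.inr hn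
    · exact Or.inl ⟨_, (exists_baseChart hn D).choose_spec.1, rfl⟩

instance instIsManifold : IsManifold 𝓘(ℂ, Fin n → ℂ) ω (Sym S n) := by
  refine isManifold_of_contDiffOn _ _ _ ?_
  intro e e' he he'
  by_cases hn : n = 0
  · subst hn
    exact contDiff_of_subsingleton.contDiffOn
  obtain ⟨φ, hφ, rfl⟩ := he.resolve_right hn
  obtain ⟨ψ, hψ, rfl⟩ := he'.resolve_right hn
  simpa using! contDiffOn_transition (n := n) hφ hψ

end Manifold

end SymProd

/-! ### Polarization data -/

namespace DoubleCover

section Polarization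

open Topology

/-- A family of real subspaces `W t ⊆ V (f t)` is a rank `k` subbundle of `f^* V` if it is locally
spanned by a continuous frame. -/
def IsSubbundle {B T : Type*} [TopologicalSpace T] (F : Type*) {V : B → Type*}
    [∀ b, AddCommGroup (V b)] [∀ b, Module ℝ (V b)] [TopologicalSpace (Bundle.TotalSpace F V)]
    {f : T → B} (k : ℕ) (W : ∀ t, Submodule ℝ (V (f t))) : Prop :=
  ∀ t₀ : T, ∃ U ∈ 𝓝 t₀, ∃ s : Fin k → ∀ t, V (f t),
    (∀ i, ContinuousOn (fun t => (⟨f t, s i t⟩ : Bundle.TotalSpace F V)) U) ∧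
    ∀ t ∈ U, LinearIndependent ℝ (fun i => s i t) ∧
      Submodule.span ℝ (Set.range fun i => s i t) = W t

/-- `W` is a Lagrangian subspace of the symplectic subspace `E`: `W` is its own orthogonal. -/
def IsLagrangian {V : Type*} [AddCommGroup V] [Module ℝ V] (E : Submodule ℝ V)
    (ω : V →ₗ[ℝ] V →ₗ[ℝ] ℝ) (W : Submodule ℝ V) : Prop :=
  ∀ v, v ∈ W ↔ v ∈ E ∧ ∀ w ∈ W, ω v w = 0

/-- The data `(E, F₀, F₁)` over `M ⊇ L₀, L₁`: `E` is a family of subspaces of the pullback along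
`f : M → B` of a bundle `V`, with bilinear forms `form`, and `F₀, F₁` are families of subspaces of `E`,
of which only the values over `L₀`, respectively `L₁`, matter. The conditions on these data are in
`PolarizationData.IsPolarization`. -/
structure PolarizationData {M B : Type*} (L₀ L₁ : Set M) (F : Type*) (V : B → Type*)
    [∀ b, AddCommGroup (V b)] [∀ b, Module ℝ (V b)] (f : M → B) where
  /-- half the real rank of `E` -/
  k : ℕ
  E : ∀ x, Submodule ℝ (V (f x))
  form : ∀ x, V (f x) →ₗ[ℝ] V (f x) →ₗ[ℝ] ℝ
  F₀ : ∀ x, Submodule ℝ (V (f x))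
  F₁ : ∀ x, Submodule ℝ (V (f x))

namespace PolarizationData

variable {M B : Type*} [TopologicalSpace M] [TopologicalSpace B] {L₀ L₁ : Set M}
  {F : Type*} {V : B → Type*} [∀ b, AddCommGroup (V b)] [∀ b, Module ℝ (V b)]
  [TopologicalSpace (Bundle.TotalSpace F V)] {f : M → B}
  {B' : Type*} [TopologicalSpace B'] {F' : Type*} {V' : B' → Type*}
  [∀ b, AddCommGroup (V' b)] [∀ b, Module ℝ (V' b)]
  [TopologicalSpace (Bundle.TotalSpace F' V')] {f' : M → B'}

/-- `E` is a symplectic vector bundle of rank `2k` over `M`, the `Fᵢ` are Lagrangian subbundles of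
`E|_{Lᵢ}`, and they are transverse at the points of `L₀ ∩ L₁`. Continuity of the form is expressed
through continuous sections. -/
structure IsPolarization (p : PolarizationData L₀ L₁ F V f) : Prop where
  continuous_base : Continuous f
  subbundle : IsSubbundle F (2 * p.k) p.E
  continuous_form : ∀ (s s' : ∀ x, V (f x)) (x₀ : M), (∀ x, s x ∈ p.E x) → (∀ x, s' x ∈ p.E x) →
    ContinuousAt (fun x => (⟨f x, s x⟩ : Bundle.TotalSpace F V)) x₀ →
    ContinuousAt (fun x => (⟨f x, s' x⟩ : Bundle.TotalSpace F V)) x₀ →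
    ContinuousAt (fun x => p.form x (s x) (s' x)) x₀
  alternating : ∀ x, ∀ v ∈ p.E x, p.form x v v = 0
  nondegenerate : ∀ x, ∀ v ∈ p.E x, (∀ w ∈ p.E x, p.form x v w = 0) → v = 0
  subbundle₀ : IsSubbundle F p.k fun x : L₀ => p.F₀ x
  subbundle₁ : IsSubbundle F p.k fun x : L₁ => p.F₁ x
  lagrangian₀ : ∀ x ∈ L₀, IsLagrangian (p.E x) (p.form x) (p.F₀ x)
  lagrangian₁ : ∀ x ∈ L₁, IsLagrangian (p.E x) (p.form x) (p.F₁ x)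
  transverse : ∀ x ∈ L₀ ∩ L₁, p.F₀ x ⊓ p.F₁ x = ⊥

/-- The subspace of `V'` that corresponds under an isomorphism `E ≃ E'` to the subspace `W ⊆ E`. -/
def image {V V' : Type*} [AddCommGroup V] [Module ℝ V] [AddCommGroup V'] [Module ℝ V']
    {E : Submodule ℝ V} {E' : Submodule ℝ V'} (φ : E ≃ₗ[ℝ] E') (W : Submodule ℝ V) :
    Submodule ℝ V' :=
  ((W.comap E.subtype).map φ.toLinearMap).map E'.subtype

/-- A homotopy, over `L`, through Lagrangian subbundles of `E` from `W₀` to `W₁`. -/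
def LagrangianHomotopic {M B : Type*} [TopologicalSpace M] (F : Type*) {V : B → Type*}
    [∀ b, AddCommGroup (V b)] [∀ b, Module ℝ (V b)] [TopologicalSpace (Bundle.TotalSpace F V)]
    {f : M → B} (k : ℕ) (E : ∀ x, Submodule ℝ (V (f x)))
    (ω : ∀ x, V (f x) →ₗ[ℝ] V (f x) →ₗ[ℝ] ℝ) (L : Set M)
    (W₀ W₁ : ∀ x, Submodule ℝ (V (f x))) : Prop :=
  ∃ Λ : ∀ q : unitInterval × L, Submodule ℝ (V (f q.2)),
    IsSubbundle F k Λ ∧ (∀ q, IsLagrangian (E q.2) (ω q.2) (Λ q)) ∧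
    (∀ x : L, Λ (0, x) = W₀ x) ∧ (∀ x : L, Λ (1, x) = W₁ x)

/-- Isomorphism of polarization data: an isomorphism `φ : E ≃ E'` of symplectic vector bundles over
`M`, together with homotopies of Lagrangian subbundles of `E'|_{Lᵢ}` from `φ (Fᵢ)` to `Fᵢ'`.
Continuity of `φ` and of its inverse is expressed through continuous sections. -/
def Isomorphic (p : PolarizationData L₀ L₁ F V f) (p' : PolarizationData L₀ L₁ F' V' f') : Prop :=
  ∃ φ : ∀ x, p.E x ≃ₗ[ℝ] p'.E x,
    (∀ (s : ∀ x, p.E x) (x₀ : M),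
      ContinuousAt (fun x => (⟨f x, s x⟩ : Bundle.TotalSpace F V)) x₀ ↔
      ContinuousAt (fun x => (⟨f' x, φ x (s x)⟩ : Bundle.TotalSpace F' V')) x₀) ∧
    (∀ x (v w : p.E x), p'.form x (φ x v) (φ x w) = p.form x v w) ∧
    LagrangianHomotopic F' p'.k p'.E p'.form L₀ (fun x => image (φ x) (p.F₀ x)) p'.F₀ ∧
    LagrangianHomotopic F' p'.k p'.E p'.form L₁ (fun x => image (φ x) (p.F₁ x)) p'.F₁

end PolarizationData

end Polarization

/-! ### Curves, tori and pullback of unordered tuples -/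

section Tori

open scoped Manifold ContDiff

/-- The velocity of a curve in a Riemann surface. -/
noncomputable def velocity {S : Type*} [TopologicalSpace S] [ChartedSpace ℂ S] (c : ℝ → S) (t : ℝ) :
    TangentSpace 𝓘(ℂ) (c t) :=
  mfderiv 𝓘(ℝ) 𝓘(ℝ, ℂ) c t (1 : ℝ)

/-- A smoothly embedded closed curve, parametrized by `ℝ/ℤ`. -/
structure IsSimpleClosedCurve {S : Type*} [TopologicalSpace S] [ChartedSpace ℂ S] (c : ℝ → S) :
    Prop where
  smooth : ContMDiff 𝓘(ℝ) 𝓘(ℝ, ℂ) ∞ c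
  periodic : Function.Periodic c 1
  injOn : Set.InjOn c (Set.Ico 0 1)
  immersed : ∀ t, velocity c t ≠ 0

/-- The tangent bundle of the complex manifold `Symⁿ S`. -/
abbrev SymTangent (S : Type*) [TopologicalSpace S] [T2Space S] [ChartedSpace ℂ S]
    [IsManifold 𝓘(ℂ) ω S] (n : ℕ) : Sym S n → Type :=
  fun D => TangentSpace 𝓘(ℂ, Fin n → ℂ) D

variable {S : Type*} [TopologicalSpace S] [T2Space S] [ChartedSpace ℂ S] [IsManifold 𝓘(ℂ) ω S]
  {κ : Type*} [Fintype κ] {n : ℕ}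

/-- The product of the curves `c k` as a parametrized torus in `Symⁿ S`, `n = #κ`. -/
def torusPoint (hn : Fintype.card κ = n) (c : κ → ℝ → S) (t : κ → ℝ) : Sym S n :=
  ⟨Finset.univ.val.map fun k => c k (t k), by simpa using hn⟩

/-- The torus `∏ c k` in `Symⁿ S`. -/
def torus (hn : Fintype.card κ = n) (c : κ → ℝ → S) : Set (Sym S n) :=
  Set.range (torusPoint hn c)

/-- The real tangent space of the torus at a point `D`, spanned by the derivatives at the parameters
of `D` of the parametrization (it is `0` if `D` is not on the torus). -/
noncomputable def torusTangent (hn : Fintype.card κ = n) (c : κ → ℝ → S) (D : Sym S n) :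
    Submodule ℝ (SymTangent S n D) :=
  Submodule.span ℝ {v | ∃ t u : κ → ℝ, (⟨D, v⟩ : TangentBundle 𝓘(ℂ, Fin n → ℂ) (Sym S n)) =
    ⟨torusPoint hn c t,
      mfderiv 𝓘(ℝ, κ → ℝ) 𝓘(ℝ, Fin n → ℂ) (torusPoint hn c) t u⟩}

variable {A : Type*} [TopologicalSpace A] [T2Space A] [ChartedSpace ℂ A] [IsManifold 𝓘(ℂ) ω A]

theorem finite_fibre {S A : Type*} {π : A → S} (h : ∀ x, (π ⁻¹' {x}).ncard = 2) (x : S) :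
    (π ⁻¹' {x}).Finite :=
  Set.finite_of_ncard_ne_zero (by simp [h])

/-- The map `Symᵍ S → Sym²ᵍ A`, `D ↦ π⁻¹ D`, for a two-to-one map `π : A → S`. -/
noncomputable def pullbackSym {S A : Type*} (π : A → S) (h : ∀ x, (π ⁻¹' {x}).ncard = 2) (g : ℕ)
    (D : Sym S g) : Sym A (2 * g) :=
  ⟨D.1.bind fun x => (finite_fibre h x).toFinset.val, by
    have : ∀ x, (finite_fibre h x).toFinset.card = 2 := fun x => by
      rw [← Set.ncard_eq_toFinset_card _ (finite_fibre h x), h]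
    simp [Multiset.card_bind, Function.comp_def, this, mul_comm]⟩

open Classical in
/-- The deck transformation of a two-to-one map `π`: it exchanges the two points of each fibre. -/
noncomputable def deck {S A : Type*} (π : A → S) (a : A) : A :=
  if h : ∃ a', π a' = π a ∧ a' ≠ a then h.choose else a

/-- The involution of `Symⁿ A` induced by the deck transformation of `π`. -/
noncomputable def symDeck {S A : Type*} (π : A → S) (n : ℕ) : Sym A n → Sym A n := Sym.map (deck π)

/-- The `-1`-eigenspace at a fixed point `D` of the derivative of the involution `symDeck π n`. -/
noncomputable def antiInvariant (π : A → S) (n : ℕ) (D : Sym A n) :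
    Submodule ℝ (SymTangent A n D) :=
  Submodule.span ℝ {v | tangentMap 𝓘(ℂ, Fin n → ℂ) 𝓘(ℂ, Fin n → ℂ) (symDeck π n) ⟨D, v⟩ =
    ⟨D, -v⟩}

/-- A continuous field of real `2`-forms on `Symⁿ A` that is compatible with the complex structure
(hence nondegenerate). -/
structure IsCompatibleForm (ω₀ : ∀ D : Sym A n, SymTangent A n D →ₗ[ℝ] SymTangent A n D →ₗ[ℝ] ℝ) :
    Prop where
  continuous : ∀ (s s' : ∀ D, SymTangent A n D) (D₀ : Sym A n),
    ContinuousAt (fun D => (⟨D, s D⟩ : TangentBundle 𝓘(ℂ, Fin n → ℂ) (Sym A n))) D₀ →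
    ContinuousAt (fun D => (⟨D, s' D⟩ : TangentBundle 𝓘(ℂ, Fin n → ℂ) (Sym A n))) D₀ →
    ContinuousAt (fun D => ω₀ D (s D) (s' D)) D₀
  alternating : ∀ D v, ω₀ D v v = 0
  invariant : ∀ D v w, ω₀ D (Complex.I • v) (Complex.I • w) = ω₀ D v w
  positive : ∀ D v, v ≠ 0 → 0 < ω₀ D v (Complex.I • v)

/-- A form on `Symⁿ A` is invariant under the involution `symDeck π n`. -/
def IsDeckInvariant (π : A → S)
    (ω₀ : ∀ D : Sym A n, SymTangent A n D →ₗ[ℝ] SymTangent A n D →ₗ[ℝ] ℝ) : Prop :=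
  ∀ D v w, ω₀ (symDeck π n D)
    (mfderiv 𝓘(ℂ, Fin n → ℂ) 𝓘(ℂ, Fin n → ℂ) (symDeck π n) D v)
    (mfderiv 𝓘(ℂ, Fin n → ℂ) 𝓘(ℂ, Fin n → ℂ) (symDeck π n) D w) = ω₀ D v w

variable {g : ℕ}

/-- The normal polarization of `Symᵍ S ⊆ Sym²ᵍ A`: the normal bundle `E`, realized as the
`-1`-eigenbundle of the derivative of the involution along its fixed locus `Symᵍ S`, with the normal
bundles `Fᵢ` of the tori `Lᵢ` of curves in `S` in the tori of their lifts to `A`, realized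
as the `-1`-eigenbundles of the tangent bundles of the latter. -/
noncomputable def normalPolarization (π : A → S) (h : ∀ x, (π ⁻¹' {x}).ncard = 2)
    (ω₀ : ∀ D : Sym A (2 * g), SymTangent A (2 * g) D →ₗ[ℝ] SymTangent A (2 * g) D →ₗ[ℝ] ℝ)
    (hκ : Fintype.card κ = 2 * g) (alift blift : κ → ℝ → A) (L₀ L₁ : Set (Sym S g)) :
    PolarizationData L₀ L₁ (Fin (2 * g) → ℂ) (SymTangent A (2 * g)) (pullbackSym π h g) where
  k := g
  E D := antiInvariant π (2 * g) (pullbackSym π h g D)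
  form D := ω₀ (pullbackSym π h g D)
  F₀ D := torusTangent hκ alift (pullbackSym π h g D) ⊓ antiInvariant π (2 * g) (pullbackSym π h g D)
  F₁ D := torusTangent hκ blift (pullbackSym π h g D) ⊓ antiInvariant π (2 * g) (pullbackSym π h g D)

/-- The tangential polarization `(T Symᵍ S, T L₀, T L₁)`, where `L₀, L₁` are the tori of the curves
`a`, `b` and `Symᵍ S` carries the restriction of the form of `Sym²ᵍ A`. -/
noncomputable def tangentialPolarization (π : A → S) (h : ∀ x, (π ⁻¹' {x}).ncard = 2)
    (ω₀ : ∀ D : Sym A (2 * g), SymTangent A (2 * g) D →ₗ[ℝ] SymTangent A (2 * g) D →ₗ[ℝ] ℝ)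
    (hκ : Fintype.card κ = g) (a b : κ → ℝ → S) (L₀ L₁ : Set (Sym S g)) :
    PolarizationData L₀ L₁ (Fin g → ℂ) (SymTangent S g) (id : Sym S g → Sym S g) where
  k := g
  E _ := ⊤
  form D := (ω₀ (pullbackSym π h g D)).compl₁₂
    ((mfderiv 𝓘(ℂ, Fin g → ℂ) 𝓘(ℂ, Fin (2 * g) → ℂ) (pullbackSym π h g)
      D).toLinearMap.restrictScalars ℝ)
    ((mfderiv 𝓘(ℂ, Fin g → ℂ) 𝓘(ℂ, Fin (2 * g) → ℂ) (pullbackSym π h g)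
      D).toLinearMap.restrictScalars ℝ)
  F₀ D := torusTangent hκ a D
  F₁ D := torusTangent hκ b D

end Tori

/-! ### Heegaard diagrams and double covers -/

section Heegaard

open scoped Manifold ContDiff

/-- The thickened closed disc `D² × [-1, 1]`. -/
def thickDisc : Set (ℂ × ℝ) := Metric.closedBall (0 : ℂ) 1 ×ˢ Set.Icc (-1 : ℝ) 1

/-- The subset `D² × (-1, 1)` of the thickened closed disc. -/
def thickDiscInner : Set (ℂ × ℝ) := Metric.closedBall (0 : ℂ) 1 ×ˢ Set.Ioo (-1 : ℝ) 1

/-- `U` is a handlebody with boundary the surface `e S`, for which the `g` curves `c i` are attaching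
circles: there are disjoint thickened discs `h i : D² × [-1, 1] → U`, meeting the surface exactly in
`∂D² × [-1, 1]`, with `c i` bounding the core disc, such that cutting `U` along them gives a closed
ball. -/
structure IsHandlebody {g : ℕ} {S Y : Type*} [TopologicalSpace Y] (e : S → Y) (c : Fin g → ℝ → S)
    (U : Set Y) : Prop where
  isClosed : IsClosed U
  surface_subset : Set.range e ⊆ U
  exists_discs : ∃ h : Fin g → ℂ × ℝ → Y,
    (∀ i, ContinuousOn (h i) thickDisc) ∧
    (∀ i, Set.InjOn (h i) thickDisc) ∧
    (∀ i, Set.MapsTo (h i) thickDisc U) ∧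
    (∀ i j, i ≠ j → Disjoint (h i '' thickDisc) (h j '' thickDisc)) ∧
    (∀ i, ∀ p ∈ thickDisc, h i p ∈ Set.range e ↔ ‖p.1‖ = 1) ∧
    (∀ i (t : ℝ), h i (Complex.exp (2 * Real.pi * t * Complex.I), 0) = e (c i t)) ∧
    Nonempty (↥(U \ ⋃ i, h i '' thickDiscInner) ≃ₜ
      ↥(Metric.closedBall (0 : EuclideanSpace ℝ (Fin 3)) 1))

/-- A pointed Heegaard diagram `(S, α, β, z)` of genus `g` for `Y = U₀ ∪ U₁`. -/
structure HeegaardDiagram (g : ℕ) (S Y : Type*) [TopologicalSpace S] [ChartedSpace ℂ S]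
    [TopologicalSpace Y] where
  embed : S → Y
  U₀ : Set Y
  U₁ : Set Y
  α : Fin g → ℝ → S
  β : Fin g → ℝ → S
  z : S
  isEmbedding : Topology.IsEmbedding embed
  union_eq : U₀ ∪ U₁ = Set.univ
  inter_eq : U₀ ∩ U₁ = Set.range embed
  handlebody₀ : IsHandlebody embed α U₀
  handlebody₁ : IsHandlebody embed β U₁
  curve_α : ∀ i, IsSimpleClosedCurve (α i)
  curve_β : ∀ i, IsSimpleClosedCurve (β i)
  disjoint_α : ∀ i j, i ≠ j → ∀ s t, α i s ≠ α j t
  disjoint_β : ∀ i j, i ≠ j → ∀ s t, β i s ≠ β j t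
  transverse : ∀ i j s t, α i s = β j t →
    LinearIndependent ℝ ![(velocity (α i) s : ℂ), (velocity (β j) t : ℂ)]
  base_α : ∀ i t, α i t ≠ z
  base_β : ∀ i t, β i t ≠ z

/-- `p : Yt → Y` is the unbranched double cover induced from the `ℤ`-fold cover `r : Yh → Y` with
generating deck transformation `T`, that is, `Yt = Yh / T²`, by means of the projection `q`. -/
structure IsInducedDoubleCover {Y Yt Yh : Type*} [TopologicalSpace Y] [TopologicalSpace Yt]
    [TopologicalSpace Yh] (p : Yt → Y) (r : Yh → Y) (T : Yh ≃ₜ Yh) (q : Yh → Yt) : Prop where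
  isCoveringMap : IsCoveringMap p
  ncard_fibre : ∀ y, (p ⁻¹' {y}).ncard = 2
  isCoveringMap' : IsCoveringMap r
  surjective' : Function.Surjective r
  deck : ∀ a, r (T a) = r a
  free_transitive : ∀ a b, r a = r b → ∃! m : ℤ, (T ^ m) a = b
  continuous : Continuous q
  surjective : Function.Surjective q
  comp : ∀ a, p (q a) = r a
  eq_iff : ∀ a b, q a = q b ↔ ∃ m : ℤ, (T ^ (2 * m)) a = b

/-- `π : St → S` is the double cover of the Riemann surface `S ⊆ Y` induced by `p : Yt → Y`, with the
induced complex structure: `St` is identified with `p⁻¹ S`, and `π` is holomorphic. -/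
structure IsInducedSurfaceCover {S St Y Yt : Type*} [TopologicalSpace S] [ChartedSpace ℂ S]
    [TopologicalSpace St] [ChartedSpace ℂ St] [TopologicalSpace Yt]
    (e : S → Y) (p : Yt → Y) (π : C(St, S)) (et : St → Yt) : Prop where
  holomorphic : MDifferentiable 𝓘(ℂ) 𝓘(ℂ) π
  isEmbedding : Topology.IsEmbedding et
  comm : ∀ a, p (et a) = e (π a)
  range_eq : Set.range et = p ⁻¹' Set.range e

variable {S St : Type*} [TopologicalSpace S] [TopologicalSpace St]

theorem IsInducedSurfaceCover.ncard_fibre {Y Yt : Type*} [ChartedSpace ℂ S] [ChartedSpace ℂ St]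
    [TopologicalSpace Yt] {e : S → Y} {p : Yt → Y} {π : C(St, S)} {et : St → Yt}
    (h : IsInducedSurfaceCover e p π et) (he : Function.Injective e)
    (hp : ∀ y, (p ⁻¹' {y}).ncard = 2) (x : S) : (π ⁻¹' {x}).ncard = 2 := by
  rw [← hp (e x), ← Set.ncard_image_of_injective _ h.isEmbedding.injective]
  congr 1
  ext a
  constructor
  · rintro ⟨b, hb, rfl⟩
    have hb' : π b = x := hb
    simp [h.comm, hb']
  · intro ha
    have ha' : p a = e x := ha
    obtain ⟨b, rfl⟩ : a ∈ Set.range et := by rw [h.range_eq]; exact ⟨x, ha'.symm⟩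
    exact ⟨b, he (by rw [← h.comm, ha']), rfl⟩

variable [T1Space S]

/-- The surface `S - {z}`. -/
def puncture (z : S) : TopologicalSpace.Opens S := ⟨{z}ᶜ, isOpen_compl_singleton⟩

/-- The surface `St - π⁻¹ {z}`. -/
def punctureCover (π : C(St, S)) (z : S) : TopologicalSpace.Opens St :=
  TopologicalSpace.Opens.comap π (puncture z)

/-- The restriction of `π` to the punctured surfaces. -/
def restrictCover (π : C(St, S)) (z : S) : punctureCover π z → puncture z :=
  fun a => ⟨π a.1, a.2⟩

theorem ncard_restrictCover {π : C(St, S)} (h : ∀ x, (π ⁻¹' {x}).ncard = 2) (z : S)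
    (x : puncture z) : (restrictCover π z ⁻¹' {x}).ncard = 2 := by
  rw [← h x.1, ← Set.ncard_image_of_injective _ Subtype.val_injective]
  congr 1
  ext a
  constructor
  · rintro ⟨b, hb, rfl⟩
    exact congrArg Subtype.val hb
  · intro ha
    have ha' : π a = x.1 := ha
    exact ⟨⟨a, show π a ∈ puncture z from ha' ▸ x.2⟩, Subtype.ext ha', rfl⟩

/-- The α-curves as curves in the punctured surface. -/
def HeegaardDiagram.αPunct {g : ℕ} {Y : Type*} [ChartedSpace ℂ S] [TopologicalSpace Y]
    (D : HeegaardDiagram g S Y) : Fin g → ℝ → puncture D.z :=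
  fun i t => ⟨D.α i t, D.base_α i t⟩

/-- The β-curves as curves in the punctured surface. -/
def HeegaardDiagram.βPunct {g : ℕ} {Y : Type*} [ChartedSpace ℂ S] [TopologicalSpace Y]
    (D : HeegaardDiagram g S Y) : Fin g → ℝ → puncture D.z :=
  fun i t => ⟨D.β i t, D.base_β i t⟩

theorem card_lifts (g : ℕ) : Fintype.card (Fin g × Fin 2) = 2 * g := by
  simp [mul_comm]

/-- The closed curves `clift (i, 0)` and `clift (i, 1)` are the two lifts of `c i` under `π`. -/
structure IsLift {g : ℕ} {S A : Type*} [TopologicalSpace A] (π : A → S) (c : Fin g → ℝ → S)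
    (clift : Fin g × Fin 2 → ℝ → A) : Prop where
  continuous : ∀ k, Continuous (clift k)
  periodic : ∀ k, Function.Periodic (clift k) 1
  lift : ∀ k t, π (clift k t) = c k.1 t
  distinct : ∀ i t, clift (i, 0) t ≠ clift (i, 1) t

end Heegaard

end DoubleCover

open scoped Manifold ContDiff

/-! A tangent vector of `Symⁿ` at a tuple `D` is determined by its pairings with the differentials
of the sums `h(a₁) + ... + h(aₙ)`, with `h` holomorphic near the points of `D`; this holds also
where points collide, since the charts are functions of power sums (`eq_zero_of_dSum`). In these
terms `D ↦ π⁻¹ D` is dual to the trace of functions (`dSum_dPull`), and a function that is locally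
constant near the points of `D` acts on the tangent space by multiplication of the test functions
(`exists_multiplier`). The differential of `D ↦ π⁻¹ D` takes values in the `+1`-eigenspace of the
involution. Multiplication by an odd, nowhere zero, locally constant function exchanges the
eigenspaces, so it identifies `T_D Symᵍ` with the normal space (`exists_twist`).

Such functions come from the `ℤ`-fold cover. It carries a real height function `h` with `h ∘ T = h +
1` (`exists_height`), and `exp (iπh)` descends to a circle-valued function `u` on the double cover
that is odd under the deck transformation (`exists_phase`). It is not locally constant, but near
each tuple it is approximated by odd locally constant functions. A partition of unity on `Symᵍ`
averages these; the averages stay within `1/2` of `u`, hence have no zeros at the relevant points.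
The outcome is a continuous complex linear isomorphism `Θ` from the tangent bundle to the normal
bundle (`IsTwist`). Compatible forms are the imaginary parts of hermitian metrics, and polar
decomposition with respect to these makes the isomorphism unitary, hence symplectic
(`unitarization`).

Along a torus, `Θ` sends the tangent vector of the `i`-th curve to `vᵢ` times the difference of the
tangent vectors of its two lifts, with `vᵢ` close to the value of `u` on one lift
(`twist_torusVec`). The curve bounds a disc in its handlebody, so the lift closes up in the `ℤ`-fold
cover, `h` is single-valued along it, and `vᵢ = exp lᵢ` with `lᵢ` continuous on the torus
(`exists_phase_along`, `isTorusFrame`). Scaling `lᵢ` to zero deforms the image of the normal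
Lagrangian to the tangential one. Polar decomposition keeps the Gram matrix of the moving frame
equal to a fixed real matrix, which is exactly what makes its real span Lagrangian at all times
(`lagrangianHomotopic_of_frame`). -/

namespace SymProd

open Topology Polynomial

/-! ### Elementary symmetric functions in terms of power sums -/

section PowerSums

variable {n : ℕ}

/-- The elementary symmetric functions are holomorphic functions of the power sums. -/
theorem exists_esymm_eq_powerSums (n k : ℕ) (hk : k ≤ n) : ∃ q : (Fin n → ℂ) → ℂ,
    ContDiff ℂ ω q ∧
      ∀ D : Sym ℂ n, D.1.esymm k = q fun j => sumOver (fun z => z ^ (j.1 + 1)) D := by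
  induction k using Nat.strong_induction_on with
  | _ k ih =>
    rcases Nat.eq_zero_or_pos k with rfl | hk0
    · refine ⟨fun _ => 1, contDiff_const, fun D => ?_⟩
      simp only [Multiset.esymm, Multiset.powersetCard_zero_left, Multiset.map_singleton,
        Multiset.prod_zero, Multiset.sum_singleton]
    have hk' : (k : ℂ) ≠ 0 := by exact_mod_cast hk0.ne'
    choose! q hq hqe using fun a (ha : a < k) => ih a ha (by omega)
    -- Newton's identity solved for the `k`-th elementary symmetric function. The coordinate `a.2 -
    -- 1` holds the power sum of exponent `a.2`; since `1 ≤ a.2 ≤ k ≤ n`, the default value `0` is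
    -- never used.
    refine ⟨fun s => (k : ℂ)⁻¹ * ((-1) ^ (k + 1) *
      ∑ a ∈ Finset.HasAntidiagonal.antidiagonal k with a.1 < k, (-1) ^ a.1 * q a.1 s *
        (if h : a.2 - 1 < n then s ⟨a.2 - 1, h⟩ else 0)), ?_, fun D => ?_⟩
    · refine contDiff_const.mul (contDiff_const.mul (ContDiff.sum fun a ha => ?_))
      refine (contDiff_const.mul (hq a.1 (Finset.mem_filter.1 ha).2)).mul ?_
      split_ifs with h
      · exact contDiff_apply ℂ ℂ _
      · exact contDiff_const
    · rw [eq_inv_mul_iff_mul_eq₀ hk', newton]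
      congr 1
      refine Finset.sum_congr rfl fun a ha => ?_
      obtain ⟨ha, hak⟩ := Finset.mem_filter.1 ha
      have ha := Finset.HasAntidiagonal.mem_antidiagonal.1 ha
      rw [hqe a.1 hak, dif_pos (by omega)]
      have : a.2 - 1 + 1 = a.2 := by omega
      simp only [this]

theorem exists_esymm_eq (n : ℕ) : ∃ q : (Fin n → ℂ) → (Fin n → ℂ), ContDiff ℂ ω q ∧
    ∀ D : Sym ℂ n, esymm D = q fun j => sumOver (fun z => z ^ (j.1 + 1)) D := by
  choose q hq hqe using fun i : Fin n => exists_esymm_eq_powerSums n (i.1 + 1) i.2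
  exact ⟨fun s i => q i s, contDiff_pi.2 hq, fun D => funext fun i => hqe i D⟩

end PowerSums

/-! ### Sums of functions over unordered tuples -/

section Sums

variable {S : Type*} {n : ℕ}

/-- The sum of the values of a function over an unordered tuple of points. -/
noncomputable def symSum (h : S → ℂ) (D : Sym S n) : ℂ := (D.1.map h).sum

theorem symSum_ofFun (h : S → ℂ) (x : Fin n → S) : symSum h (ofFun x) = ∑ i, h (x i) := by
  simp only [symSum, ofFun]
  exact congrArg Multiset.sum (Multiset.map_map h x Finset.univ.val)

theorem symSum_congr {h k : S → ℂ} {D : Sym S n} (hk : ∀ a ∈ D, h a = k a) :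
    symSum h D = symSum k D :=
  congrArg Multiset.sum (Multiset.map_congr rfl hk)

theorem symSum_add (h k : S → ℂ) (D : Sym S n) :
    symSum (fun a => h a + k a) D = symSum h D + symSum k D :=
  Multiset.sum_map_add

theorem symSum_const_mul (c : ℂ) (h : S → ℂ) (D : Sym S n) :
    symSum (fun a => c * h a) D = c * symSum h D :=
  Multiset.sum_map_mul_left

theorem symSum_map {Z : Type*} (f : S → Z) (h : Z → ℂ) (D : Sym S n) :
    symSum h (Sym.map f D) = symSum (h ∘ f) D :=
  congrArg Multiset.sum (Multiset.map_map h f D.1)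

theorem continuous_symSum [TopologicalSpace S] {h : S → ℂ} (hh : Continuous h) :
    Continuous (symSum h : Sym S n → ℂ) := by
  rw [isQuotientMap_ofFun.continuous_iff]
  have : symSum h ∘ ofFun = fun x : Fin n → S => ∑ i, h (x i) := by
    ext x; exact symSum_ofFun h x
  rw [this]
  fun_prop

theorem eventually_forall_mem [TopologicalSpace S] {D : Sym S n} {p : S → Prop}
    (hp : ∀ a ∈ D, ∀ᶠ b in 𝓝 a, p b) : ∀ᶠ E in 𝓝 D, ∀ a ∈ E, p a := by
  have h := (isOpen_forall_mem (n := n) (isOpen_interior (s := {a | p a}))).mem_nhds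
    (show D ∈ _ from fun a ha => mem_interior_iff_mem_nhds.2 (hp a ha))
  filter_upwards [h] with E hE a ha
  exact interior_subset (hE a ha)

theorem symSum_eventuallyEq [TopologicalSpace S] {h k : S → ℂ} {D : Sym S n} (hk : ∀ a ∈ D, h =ᶠ[𝓝 a] k) :
    symSum h =ᶠ[𝓝 D] symSum k := by
  filter_upwards [eventually_forall_mem hk] with E hE
  exact symSum_congr hE

/-- Two different tuples differ in the multiplicity of some point `a`. A bump function that is `1`
at `a` and `0` at the other points of both tuples has a continuous sum, whose values at the tuples
are these multiplicities. -/
instance instT2Space [TopologicalSpace S] [T2Space S] [LocallyCompactSpace S] :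
    T2Space (Sym S n) := by
  classical
  refine ⟨fun D E hDE => ?_⟩
  obtain ⟨a, ha⟩ : ∃ a, D.1.count a ≠ E.1.count a := by
    by_contra! hc
    exact hDE (Sym.coe_injective (Multiset.ext.2 hc))
  let s : Finset S := (D.1.toFinset ∪ E.1.toFinset).erase a
  obtain ⟨f, hf0, hf1, -⟩ := exists_continuous_zero_one_of_isCompact (s := (s : Set S)) (t := {a})
    s.finite_toSet.isCompact isClosed_singleton (by simp [s])
  let h : S → ℂ := fun x => (f x : ℂ)
  have hh : Continuous h := Complex.continuous_ofReal.comp f.continuous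
  have key : ∀ F : Sym S n, (∀ x ∈ F, x = a ∨ x ∈ s) → symSum h F = F.1.count a := by
    intro F hF
    rw [symSum_congr (k := fun x => if a = x then 1 else 0)]
    · change (F.1.map _).sum = _
      induction F.1 using Multiset.induction_on with
      | empty => simp
      | cons b m ih => simp [Multiset.count_cons, ih, add_comm]
    · intro x hx
      rcases hF x hx with rfl | hxs
      · simp [h, hf1 rfl]
      · have : a ≠ x := fun e => by simp [s, e] at hxs
        simp [h, hf0 hxs, this]
  have hD := key D fun x hx => by
    by_cases hxa : x = a
    · exact Or.inl hxa
    · exact Or.inr (by simp [s, hxa]; exact Or.inl hx)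
  have hE := key E fun x hx => by
    by_cases hxa : x = a
    · exact Or.inl hxa
    · exact Or.inr (by simp [s, hxa]; exact Or.inr hx)
  refine separated_by_continuous (continuous_symSum (n := n) hh) ?_
  rw [hD, hE]
  exact_mod_cast ha

end Sums

/-! ### Differentials of sums of holomorphic functions -/

section Differentials

variable {S : Type*} {n : ℕ} [TopologicalSpace S] [ChartedSpace ℂ S]

/-- A function is holomorphic near a point of a Riemann surface. -/
def HolAt (h : S → ℂ) (a : S) : Prop := ∀ᶠ b in 𝓝 a, MDifferentiableAt 𝓘(ℂ) 𝓘(ℂ) h b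

/-- A function is holomorphic near each point of an unordered tuple. -/
def HolNear (h : S → ℂ) (D : Sym S n) : Prop := ∀ a ∈ D, HolAt h a

theorem HolAt.congr {h k : S → ℂ} {a : S} (hh : HolAt h a) (hk : k =ᶠ[𝓝 a] h) : HolAt k a := by
  filter_upwards [hh, hk.eventuallyEq_nhds] with b hb hb'
  exact hb.congr_of_eventuallyEq hb'

theorem HolAt.eventually {h : S → ℂ} {a : S} (hh : HolAt h a) : ∀ᶠ b in 𝓝 a, HolAt h b :=
  eventually_eventually_nhds.2 hh

theorem HolAt.mul {h k : S → ℂ} {a : S} (hh : HolAt h a) (hk : HolAt k a) :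
    HolAt (fun b => h b * k b) a := by
  filter_upwards [hh, hk] with b hb hb'
  exact MDifferentiableAt.mul hb hb'

theorem HolAt.add {h k : S → ℂ} {a : S} (hh : HolAt h a) (hk : HolAt k a) :
    HolAt (fun b => h b + k b) a := by
  filter_upwards [hh, hk] with b hb hb'
  exact MDifferentiableAt.add hb hb'

theorem holAt_const (c : ℂ) (a : S) : HolAt (fun _ => c) a :=
  Filter.Eventually.of_forall fun _ => mdifferentiableAt_const

theorem HolAt.pow {h : S → ℂ} {a : S} (hh : HolAt h a) (k : ℕ) : HolAt (fun b => h b ^ k) a := by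
  induction k with
  | zero => simpa using holAt_const (1 : ℂ) a
  | succ k ih => simpa only [pow_succ] using ih.mul hh

theorem HolAt.sum {ι : Type*} {s : Finset ι} {h : ι → S → ℂ} {a : S}
    (hh : ∀ i ∈ s, HolAt (h i) a) : HolAt (fun b => ∑ i ∈ s, h i b) a := by
  classical
  induction s using Finset.induction_on with
  | empty => simpa using holAt_const (0 : ℂ) a
  | insert i s hi ih =>
    simp only [Finset.sum_insert hi]
    exact (hh i (by simp)).add (ih fun j hj => hh j (by simp [hj]))

theorem HolAt.continuousAt {h : S → ℂ} {a : S} (hh : HolAt h a) : ContinuousAt h a :=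
  hh.self_of_nhds.continuousAt

theorem HolAt.comp {Z : Type*} [TopologicalSpace Z] [ChartedSpace ℂ Z] {h : S → ℂ} {σ : Z → S}
    {x : Z} (hh : HolAt h (σ x)) (hσ : ∀ᶠ y in 𝓝 x, MDifferentiableAt 𝓘(ℂ) 𝓘(ℂ) σ y) :
    HolAt (fun y => h (σ y)) x := by
  filter_upwards [hσ, hσ.self_of_nhds.continuousAt.eventually hh] with y hy hy'
  exact hy'.comp y hy

theorem HolNear.eventually {h : S → ℂ} {D : Sym S n} (hh : HolNear h D) :
    ∀ᶠ E in 𝓝 D, HolNear h E :=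
  eventually_forall_mem fun a ha => (hh a ha).eventually

variable [T2Space S] [IsManifold 𝓘(ℂ) ω S]

theorem chartAt_eq (hn : n ≠ 0) (D : Sym S n) : ∃ φ : OpenPartialHomeomorph S ℂ,
    φ.MDifferentiable 𝓘(ℂ) 𝓘(ℂ) ∧ chartAt (Fin n → ℂ) D = chart φ :=
  ⟨(exists_baseChart hn D).choose, (exists_baseChart hn D).choose_spec.1, by
    change (if hn : n = 0 then pointChart hn D else chart (exists_baseChart hn D).choose) = _
    rw [dif_neg hn]⟩

/-- In a chart this is the sum of a holomorphic function over the roots of a monic polynomial. By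
the residue theorem (`contDiffAt_sumOver`) it is holomorphic in the coefficients, also where roots
collide. -/
theorem contMDiffAt_symSum {h : S → ℂ} {D : Sym S n} (hh : HolNear h D) :
    ContMDiffAt 𝓘(ℂ, Fin n → ℂ) 𝓘(ℂ) ω (symSum h) D := by
  by_cases hn : n = 0
  · have : (symSum h : Sym S n → ℂ) = fun _ => 0 := by
      subst hn
      ext E
      have : E.1 = 0 := Multiset.card_eq_zero.1 E.2
      change (E.1.map h).sum = 0
      rw [this]
      simp
    rw [this]
    exact contMDiffAt_const
  obtain ⟨φ, hφ, e⟩ := chartAt_eq hn D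
  have hD : D ∈ (chartAt (Fin n → ℂ) D).source := ChartedSpace.mem_chart_source D
  have hc : ContMDiffAt 𝓘(ℂ, Fin n → ℂ) 𝓘(ℂ, Fin n → ℂ) ω (chartAt (Fin n → ℂ) D) D :=
    contMDiffAt_of_mem_maximalAtlas (IsManifold.chart_mem_maximalAtlas D) hD
  have hDs : ∀ a ∈ D, a ∈ φ.source := by rw [e] at hD; exact mem_chart_source.1 hD
  let U : Set S := interior {b | MDifferentiableAt 𝓘(ℂ) 𝓘(ℂ) h b}
  have hV : IsOpen (φ.target ∩ φ.symm ⁻¹' U) := φ.symm.isOpen_inter_preimage isOpen_interior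
  have hd : DifferentiableOn ℂ (h ∘ φ.symm) (φ.target ∩ φ.symm ⁻¹' U) := by
    rw [← mdifferentiableOn_iff_differentiableOn]
    rintro z ⟨hz, hz'⟩
    have h1 : MDifferentiableAt 𝓘(ℂ) 𝓘(ℂ) h (φ.symm z) := interior_subset hz'
    exact (h1.comp z (hφ.mdifferentiableAt_symm hz)).mdifferentiableWithinAt
  have hg : ContDiffAt ℂ ω (fun c => sumOver (h ∘ φ.symm) (rootsOf c))
      (chartAt (Fin n → ℂ) D D) := by
    refine contDiffAt_sumOver hV hd fun a ha => ?_
    rw [e, coe_chart, rootsOf_esymm] at ha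
    obtain ⟨b, hb, rfl⟩ := Sym.mem_map.1 ha
    refine ⟨φ.map_source (hDs b hb), ?_⟩
    rw [Set.mem_preimage, φ.left_inv (hDs b hb)]
    exact mem_interior_iff_mem_nhds.2 (hh b hb)
  refine (hg.contMDiffAt.comp D hc).congr_of_eventuallyEq ?_
  filter_upwards [(chartAt (Fin n → ℂ) D).open_source.mem_nhds hD] with E hE
  rw [e] at hE
  rw [e]
  change _ = sumOver (h ∘ φ.symm) (rootsOf (esymm (Sym.map φ E)))
  rw [rootsOf_esymm]
  change _ = symSum (h ∘ φ.symm) (Sym.map φ E)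
  rw [symSum_map]
  refine symSum_congr fun a ha => ?_
  simp [φ.left_inv (mem_chart_source.1 hE a ha)]

/-- Charts of the symmetric product are functions of sums of holomorphic functions. -/
theorem exists_chart_eq_symSum (D₀ : Sym S n) : ∃ (k : Fin n → S → ℂ)
    (q : (Fin n → ℂ) → (Fin n → ℂ)) (O : Set S), ContDiff ℂ ω q ∧ IsOpen O ∧
    (∀ D, D ∈ (chartAt (Fin n → ℂ) D₀).source ↔ ∀ a ∈ D, a ∈ O) ∧
    (∀ D ∈ (chartAt (Fin n → ℂ) D₀).source, ∀ j, HolNear (k j) D) ∧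
    ∀ D, chartAt (Fin n → ℂ) D₀ D = q fun j => symSum (k j) D := by
  by_cases hn : n = 0
  · subst hn
    refine ⟨fun _ _ => 0, id, Set.univ, contDiff_id, isOpen_univ, fun D => ?_,
      fun D _ j => j.elim0, fun D => Subsingleton.elim _ _⟩
    change D ∈ (if hn : (0 : ℕ) = 0 then pointChart hn D₀
      else chart (exists_baseChart hn D₀).choose).source ↔ _
    rw [dif_pos rfl]
    simp [pointChart]
  obtain ⟨φ, hφ, e⟩ := chartAt_eq hn D₀
  obtain ⟨q, hq, hqe⟩ := exists_esymm_eq n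
  -- The power sums of the coordinate `φ` are sums over the tuple, and they determine the elementary
  -- symmetric functions that make up the chart.
  refine ⟨fun j a => φ a ^ (j.1 + 1), q, φ.source, hq, φ.open_source, fun D => ?_,
    fun D hD j => ?_, fun D => ?_⟩
  · rw [e]; exact mem_chart_source
  · rw [e] at hD
    intro a ha
    refine HolAt.pow (h := φ) ?_ _
    filter_upwards [φ.open_source.mem_nhds (mem_chart_source.1 hD a ha)] with b hb
    exact hφ.mdifferentiableAt hb
  · rw [e, coe_chart, hqe]
    congr 1
    ext j
    exact symSum_map φ (fun z => z ^ (j.1 + 1)) D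

/-- The differential of `symSum h`, as a functional on the model space. -/
noncomputable def dSum (h : S → ℂ) (D : Sym S n) : (Fin n → ℂ) →L[ℂ] ℂ :=
  mfderiv 𝓘(ℂ, Fin n → ℂ) 𝓘(ℂ) (symSum h) D

theorem mdifferentiableAt_symSum {h : S → ℂ} {D : Sym S n} (hh : HolNear h D) :
    MDifferentiableAt 𝓘(ℂ, Fin n → ℂ) 𝓘(ℂ) (symSum h) D :=
  (contMDiffAt_symSum hh).mdifferentiableAt (by simp)

theorem dSum_congr {h k : S → ℂ} {D : Sym S n} (hk : ∀ a ∈ D, h =ᶠ[𝓝 a] k) :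
    dSum h D = dSum k D :=
  (symSum_eventuallyEq hk).mfderiv_eq

theorem dSum_add {h k : S → ℂ} {D : Sym S n} (hh : HolNear h D) (hk : HolNear k D) :
    dSum (fun a => h a + k a) D = dSum h D + dSum k D := by
  have e : (symSum (fun a => h a + k a) : Sym S n → ℂ) = symSum h + symSum k :=
    funext fun E => symSum_add h k E
  change mfderiv _ _ _ D = _
  rw [e]
  exact mfderiv_add (mdifferentiableAt_symSum hh) (mdifferentiableAt_symSum hk)

theorem dSum_const_mul (c : ℂ) {h : S → ℂ} {D : Sym S n} (hh : HolNear h D) :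
    dSum (fun a => c * h a) D = c • dSum h D := by
  have e : (symSum (fun a => c * h a) : Sym S n → ℂ) = c • symSum h :=
    funext fun E => symSum_const_mul c h E
  change mfderiv _ _ _ D = _
  rw [e]
  exact const_smul_mfderiv (mdifferentiableAt_symSum hh) c

theorem dSum_zero (D : Sym S n) : dSum (fun _ => 0) D = 0 := by
  have := dSum_const_mul (0 : ℂ) (h := fun _ => 0) (D := D) fun a _ => holAt_const _ a
  simp only [mul_zero] at this
  refine this.trans (ContinuousLinearMap.ext fun v => ?_)
  rw [smul_apply, zero_smul]
  rfl

theorem dSum_sum {ι : Type*} {s : Finset ι} {h : ι → S → ℂ} {D : Sym S n}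
    (hh : ∀ i ∈ s, HolNear (h i) D) :
    dSum (fun b => ∑ i ∈ s, h i b) D = ∑ i ∈ s, dSum (h i) D := by
  classical
  induction s using Finset.induction_on with
  | empty => simpa using dSum_zero D
  | insert i s hi ih =>
    simp only [Finset.sum_insert hi]
    rw [← ih fun j hj => hh j (by simp [hj])]
    exact dSum_add (hh i (by simp)) fun a ha => HolAt.sum fun j hj => hh j (by simp [hj]) a ha

end Differentials

end SymProd

/-! ### Testing vectors, maps and sections by sums of holomorphic functions -/

namespace SymProd

open Topology

section Criteria

variable {S : Type*} {n : ℕ} [TopologicalSpace S] [ChartedSpace ℂ S] [T2Space S]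
  [IsManifold 𝓘(ℂ) ω S]

theorem hasMFDerivAt_pi {E H X ι : Type*} [Fintype ι] [NormedAddCommGroup E] [NormedSpace ℂ E]
    [TopologicalSpace H] {I : ModelWithCorners ℂ E H} [TopologicalSpace X] [ChartedSpace H X]
    {F : ι → X → ℂ} {x : X} {F' : ι → E →L[ℂ] ℂ} (h : ∀ i, HasMFDerivAt I 𝓘(ℂ) (F i) x (F' i)) :
    HasMFDerivAt I 𝓘(ℂ, ι → ℂ) (fun y i => F i y) x (ContinuousLinearMap.pi F') :=
  ⟨continuousAt_pi.2 fun i => (h i).1, hasFDerivWithinAt_pi.2 fun i => (h i).2⟩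

theorem mdifferentiableAt_chartAt {D₀ D : Sym S n}
    (hD : D ∈ (chartAt (Fin n → ℂ) D₀).source) :
    MDifferentiableAt 𝓘(ℂ, Fin n → ℂ) 𝓘(ℂ, Fin n → ℂ) (chartAt (Fin n → ℂ) D₀) D :=
  mdifferentiableAt_atlas (chart_mem_atlas _ D₀) hD

/-- The differential at `D` of the preferred chart at `D₀`, on the model space. -/
noncomputable def dChart (D₀ D : Sym S n) : (Fin n → ℂ) →L[ℂ] (Fin n → ℂ) :=
  mfderiv 𝓘(ℂ, Fin n → ℂ) 𝓘(ℂ, Fin n → ℂ) (chartAt (Fin n → ℂ) D₀) D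

theorem dChart_injective {D₀ D : Sym S n} (hD : D ∈ (chartAt (Fin n → ℂ) D₀).source) :
    Function.Injective (dChart D₀ D) :=
  (mdifferentiable_chart (I := 𝓘(ℂ, Fin n → ℂ)) D₀).mfderiv_injective hD

/-- The differential of a chart in terms of differentials of sums of holomorphic functions. -/
theorem exists_dChart_eq (D₀ : Sym S n) : ∃ (k : Fin n → S → ℂ) (q : (Fin n → ℂ) → (Fin n → ℂ)),
    ContDiff ℂ ω q ∧ (∀ D ∈ (chartAt (Fin n → ℂ) D₀).source, ∀ j, HolNear (k j) D) ∧
    (∀ D, chartAt (Fin n → ℂ) D₀ D = q fun j => symSum (k j) D) ∧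
    ∀ D ∈ (chartAt (Fin n → ℂ) D₀).source, ∀ v, dChart D₀ D v =
      fderiv ℂ q (fun j => symSum (k j) D) fun j => dSum (k j) D v := by
  obtain ⟨k, q, O, hq, -, -, hk, e⟩ := exists_chart_eq_symSum D₀
  refine ⟨k, q, hq, hk, e, fun D hD v => ?_⟩
  have h1 : HasMFDerivAt 𝓘(ℂ, Fin n → ℂ) 𝓘(ℂ, Fin n → ℂ) (fun E : Sym S n => fun j =>
      symSum (k j) E) D (ContinuousLinearMap.pi fun j => dSum (k j) D) :=
    hasMFDerivAt_pi fun j => (mdifferentiableAt_symSum (hk D hD j)).hasMFDerivAt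
  have h2 : HasMFDerivAt 𝓘(ℂ, Fin n → ℂ) 𝓘(ℂ, Fin n → ℂ) q (fun j => symSum (k j) D)
      (fderiv ℂ q (fun j => symSum (k j) D)) :=
    (hq.differentiable (by simp) _).hasFDerivAt.hasMFDerivAt
  have h3 := (HasMFDerivAt.comp D h2 h1).mfderiv
  have h4 : (chartAt (Fin n → ℂ) D₀ : Sym S n → _) = q ∘ fun E : Sym S n => fun j =>
    symSum (k j) E := funext e
  simp only [dChart]
  rw [h4, h3]
  rfl

/-- A tangent vector of the symmetric product vanishes if it is annihilated by the differentials of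
all sums of holomorphic functions. -/
theorem eq_zero_of_dSum {D : Sym S n} {v : Fin n → ℂ}
    (hv : ∀ h : S → ℂ, HolNear h D → dSum h D v = 0) : v = 0 := by
  obtain ⟨k, q, hq, hk, -, hd⟩ := exists_dChart_eq D
  have hD := ChartedSpace.mem_chart_source (H := Fin n → ℂ) D
  refine dChart_injective hD ?_
  rw [hd D hD, map_zero]
  simp only [hv _ (hk D hD _)]
  exact map_zero (fderiv ℂ q _)

/-- The form in which tangent vectors are compared from here on: both sides are evaluated on sums of
holomorphic functions, and charts no longer appear. -/
theorem ext_dSum {D : Sym S n} {v w : Fin n → ℂ}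
    (hv : ∀ h : S → ℂ, HolNear h D → dSum h D v = dSum h D w) : v = w := by
  rw [← sub_eq_zero]
  exact eq_zero_of_dSum fun h hh => by rw [map_sub, hv h hh, sub_self]

/-- Continuity of maps to the symmetric product. -/
theorem continuousAt_of_symSum {X : Type*} [TopologicalSpace X] {F : X → Sym S n} {x₀ : X}
    (h1 : ∀ O : Set S, IsOpen O → (∀ a ∈ F x₀, a ∈ O) → ∀ᶠ x in 𝓝 x₀, ∀ a ∈ F x, a ∈ O)
    (h2 : ∀ h : S → ℂ, HolNear h (F x₀) → ContinuousAt (fun x => symSum h (F x)) x₀) :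
    ContinuousAt F x₀ := by
  obtain ⟨k, q, O, hq, hO, hs, hk, e⟩ := exists_chart_eq_symSum (F x₀)
  let Ψ := chartAt (Fin n → ℂ) (F x₀)
  have hD : F x₀ ∈ Ψ.source := ChartedSpace.mem_chart_source (F x₀)
  have hc : ContinuousAt (fun x => Ψ (F x)) x₀ := by
    simp only [Ψ, e]
    exact hq.continuous.continuousAt.comp (f := fun x => fun j => symSum (k j) (F x))
      (continuousAt_pi.2 fun j => h2 _ (hk _ hD j))
  -- Convergence of the chart functions alone does not keep `F x` inside the chart domain.
  -- Hypothesis `h1` does, and there the inverse chart recovers `F x`.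
  have hc' : ContinuousAt (fun x => Ψ.symm (Ψ (F x))) x₀ :=
    (Ψ.continuousAt_symm (Ψ.map_source hD)).comp (f := fun x => Ψ (F x)) hc
  refine hc'.congr ?_
  filter_upwards [h1 O hO ((hs _).1 hD)] with x hx
  exact Ψ.left_inv ((hs _).2 hx)

/-- Holomorphy of maps to the symmetric product. -/
theorem mdifferentiableAt_of_symSum {E H X : Type*} [NormedAddCommGroup E] [NormedSpace ℂ E]
    [TopologicalSpace H] {I : ModelWithCorners ℂ E H} [TopologicalSpace X] [ChartedSpace H X]
    {F : X → Sym S n} {x₀ : X} (hc : ContinuousAt F x₀)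
    (h2 : ∀ h : S → ℂ, HolNear h (F x₀) →
      MDifferentiableAt I 𝓘(ℂ) (fun x => symSum h (F x)) x₀) :
    MDifferentiableAt I 𝓘(ℂ, Fin n → ℂ) F x₀ := by
  obtain ⟨k, q, O, hq, hO, hs, hk, e⟩ := exists_chart_eq_symSum (F x₀)
  let Ψ := chartAt (Fin n → ℂ) (F x₀)
  have hD : F x₀ ∈ Ψ.source := ChartedSpace.mem_chart_source (F x₀)
  have h3 : MDifferentiableAt I 𝓘(ℂ, Fin n → ℂ) (fun x => fun j => symSum (k j) (F x)) x₀ :=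
    (hasMFDerivAt_pi fun j => (h2 _ (hk _ hD j)).hasMFDerivAt).mdifferentiableAt
  have h4 : MDifferentiableAt I 𝓘(ℂ, Fin n → ℂ) (fun x => Ψ (F x)) x₀ := by
    simp only [Ψ, e]
    exact ((hq.differentiable (by simp) _).mdifferentiableAt).comp x₀ h3
  have h5 : MDifferentiableAt I 𝓘(ℂ, Fin n → ℂ) (fun x => Ψ.symm (Ψ (F x))) x₀ :=
    MDifferentiableAt.comp (I' := 𝓘(ℂ, Fin n → ℂ)) (g := Ψ.symm) (f := fun x => Ψ (F x)) x₀
      (mdifferentiableAt_atlas_symm (chart_mem_atlas _ _) (Ψ.map_source hD)) h4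
  refine h5.congr_of_eventuallyEq ?_
  filter_upwards [hc.eventually (Ψ.open_source.mem_nhds hD)] with x hx
  exact (Ψ.left_inv hx).symm

/-- The chain rule in dual form. The constant `c` is there for maps that hold part of the tuple
fixed, as in `exists_localization`. -/
theorem dSum_mfderiv {m : ℕ} {R : Type*} [TopologicalSpace R] [ChartedSpace ℂ R] [T2Space R]
    [IsManifold 𝓘(ℂ) ω R] {F : Sym R m → Sym S n} {D : Sym R m}
    (hF : MDifferentiableAt 𝓘(ℂ, Fin m → ℂ) 𝓘(ℂ, Fin n → ℂ) F D) {h : S → ℂ}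
    (hh : HolNear h (F D)) {k : R → ℂ} (c : ℂ)
    (hk : (fun E => symSum h (F E)) =ᶠ[𝓝 D] fun E => symSum k E + c) (v : Fin m → ℂ) :
    dSum h (F D) (mfderiv 𝓘(ℂ, Fin m → ℂ) 𝓘(ℂ, Fin n → ℂ) F D v) = dSum k D v := by
  have h1 := mfderiv_comp D (mdifferentiableAt_symSum hh) hF
  have h2 : mfderiv 𝓘(ℂ, Fin m → ℂ) 𝓘(ℂ) (symSum h ∘ F) D = dSum k D := by
    refine (Filter.EventuallyEq.mfderiv_eq hk).trans ?_
    -- Nothing is assumed about `k`: if its sum is not differentiable, then neither is the translate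
    -- by `c`, and both derivatives have the default value zero.
    by_cases hkd : MDifferentiableAt 𝓘(ℂ, Fin m → ℂ) 𝓘(ℂ) (symSum k) D
    · have := mfderiv_add hkd (mdifferentiableAt_const (c := c))
      refine this.trans ?_
      rw [mfderiv_const]
      exact add_zero (dSum k D)
    · have hkd' : ¬ MDifferentiableAt 𝓘(ℂ, Fin m → ℂ) 𝓘(ℂ) (fun E => symSum k E + c) D := by
        intro h
        have := h.sub (mdifferentiableAt_const (c := c))
        exact hkd (by simpa [Pi.sub_def] using this)
      exact (mfderiv_zero_of_not_mdifferentiableAt hkd').trans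
        (mfderiv_zero_of_not_mdifferentiableAt hkd).symm
  rw [h1] at h2
  exact congrArg (fun L : (Fin m → ℂ) →L[ℂ] ℂ => L v) h2

theorem contDiffAt_symSum_comp_symm {h : S → ℂ} {D₀ D : Sym S n}
    (hD : D ∈ (chartAt (Fin n → ℂ) D₀).source) (hh : HolNear h D) :
    ContDiffAt ℂ ω (symSum h ∘ (chartAt (Fin n → ℂ) D₀).symm) (chartAt (Fin n → ℂ) D₀ D) := by
  rw [← contMDiffAt_iff_contDiffAt]
  refine ContMDiffAt.comp (I' := 𝓘(ℂ, Fin n → ℂ)) _ ?_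
    (contMDiffAt_symm_of_mem_maximalAtlas (IsManifold.chart_mem_maximalAtlas D₀)
      ((chartAt (Fin n → ℂ) D₀).map_source hD))
  rw [(chartAt (Fin n → ℂ) D₀).left_inv hD]
  exact contMDiffAt_symSum hh

theorem dSum_eq_fderiv {h : S → ℂ} {D₀ D : Sym S n} (hD : D ∈ (chartAt (Fin n → ℂ) D₀).source)
    (hh : HolNear h D) (v : Fin n → ℂ) : dSum h D v =
      fderiv ℂ (symSum h ∘ (chartAt (Fin n → ℂ) D₀).symm) (chartAt (Fin n → ℂ) D₀ D)
        (dChart D₀ D v) := by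
  let Ψ := chartAt (Fin n → ℂ) D₀
  have e : symSum h =ᶠ[𝓝 D] (symSum h ∘ Ψ.symm) ∘ Ψ := by
    filter_upwards [Ψ.open_source.mem_nhds hD] with E hE
    simp [Ψ.left_inv hE]
  have h1 : MDifferentiableAt 𝓘(ℂ, Fin n → ℂ) 𝓘(ℂ) (symSum h ∘ Ψ.symm) (Ψ D) := by
    refine MDifferentiableAt.comp (I' := 𝓘(ℂ, Fin n → ℂ)) _ ?_
      (mdifferentiableAt_atlas_symm (chart_mem_atlas _ D₀) (Ψ.map_source hD))
    rw [Ψ.left_inv hD]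
    exact mdifferentiableAt_symSum hh
  have h2 := mfderiv_comp D h1 (mdifferentiableAt_chartAt hD)
  rw [← e.mfderiv_eq, mfderiv_eq_fderiv] at h2
  exact congrArg (fun L : (Fin n → ℂ) →L[ℂ] ℂ => L v) h2

/-- Continuity of sections of the tangent bundle of the symmetric product along a map. -/
theorem continuousAt_section_iff {X : Type*} [TopologicalSpace X] {F : X → Sym S n}
    {v : ∀ x, DoubleCover.SymTangent S n (F x)} {x₀ : X} :
    ContinuousAt (fun x => (⟨F x, v x⟩ : TangentBundle 𝓘(ℂ, Fin n → ℂ) (Sym S n))) x₀ ↔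
      ContinuousAt F x₀ ∧ ∀ h : S → ℂ, HolNear h (F x₀) →
        ContinuousAt (fun x => dSum h (F x) (v x)) x₀ := by
  have : IsManifold 𝓘(ℂ, Fin n → ℂ) 1 (Sym S n) := .of_le (n := ω) le_top
  rw [FiberBundle.continuousAt_totalSpace]
  refine and_congr_right fun hF => ?_
  let Ψ := chartAt (Fin n → ℂ) (F x₀)
  have hD : F x₀ ∈ Ψ.source := ChartedSpace.mem_chart_source (F x₀)
  have hev : ∀ᶠ x in 𝓝 x₀, F x ∈ Ψ.source := hF.eventually (Ψ.open_source.mem_nhds hD)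
  -- Over the chart domain the fibre coordinate of the tangent bundle is the differential of the
  -- chart.
  have e : (fun x => (trivializationAt (Fin n → ℂ) (TangentSpace 𝓘(ℂ, Fin n → ℂ)) (F x₀)
      (⟨F x, v x⟩ : TangentBundle 𝓘(ℂ, Fin n → ℂ) (Sym S n))).2) =ᶠ[𝓝 x₀]
      fun x => dChart (F x₀) (F x) (v x) := by
    filter_upwards [hev] with x hx
    have h1 := TangentBundle.continuousLinearMapAt_trivializationAt (I := 𝓘(ℂ, Fin n → ℂ)) hx
    have h2 := congrArg (fun L : (Fin n → ℂ) →L[ℂ] (Fin n → ℂ) => L (v x)) h1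
    refine Eq.trans ?_ h2
    refine (Bundle.Trivialization.continuousLinearMapAt_apply_of_mem ℂ _ ?_ (v x)).symm
    exact hx
  rw [continuousAt_congr e]
  constructor
  · intro hc h hh
    have hd := (contDiffAt_symSum_comp_symm hD hh).fderiv_right (m := 0) (by simp)
    have h1 : ContinuousAt (fun x => fderiv ℂ (symSum h ∘ Ψ.symm) (Ψ (F x))) x₀ :=
      hd.continuousAt.comp (f := fun x => Ψ (F x)) ((Ψ.continuousAt hD).comp hF)
    refine (h1.clm_apply hc).congr ?_
    filter_upwards [hev, hF.eventually hh.eventually] with x hx hx'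
    exact (dSum_eq_fderiv hx hx' _).symm
  · intro hc
    obtain ⟨k, q, hq, hk, -, hd⟩ := exists_dChart_eq (F x₀)
    have h1 : ContinuousAt (fun x => fun j => symSum (k j) (F x)) x₀ :=
      continuousAt_pi.2 fun j =>
        (mdifferentiableAt_symSum (hk _ hD j)).continuousAt.comp (f := F) hF
    have h2 : ContinuousAt (fun x => fderiv ℂ q fun j => symSum (k j) (F x)) x₀ :=
      (hq.continuous_fderiv (by simp)).continuousAt.comp
        (f := fun x => fun j => symSum (k j) (F x)) h1
    have h3 : ContinuousAt (fun x => fun j => dSum (k j) (F x) (v x)) x₀ :=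
      continuousAt_pi.2 fun j => hc _ (hk _ hD j)
    refine (h2.clm_apply h3).congr ?_
    filter_upwards [hev] with x hx
    exact (hd _ hx _).symm

/-- Continuity of sections of the tangent bundle in terms of a chart. -/
theorem continuousAt_section_iff_dChart {X : Type*} [TopologicalSpace X] {F : X → Sym S n}
    {v : ∀ x, DoubleCover.SymTangent S n (F x)} {x₀ : X} {D₀ : Sym S n}
    (hD : F x₀ ∈ (chartAt (Fin n → ℂ) D₀).source) :
    ContinuousAt (fun x => (⟨F x, v x⟩ : TangentBundle 𝓘(ℂ, Fin n → ℂ) (Sym S n))) x₀ ↔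
      ContinuousAt F x₀ ∧ ContinuousAt (fun x => dChart D₀ (F x) (v x)) x₀ := by
  rw [continuousAt_section_iff]
  refine and_congr_right fun hF => ?_
  let Ψ := chartAt (Fin n → ℂ) D₀
  have hev : ∀ᶠ x in 𝓝 x₀, F x ∈ Ψ.source := hF.eventually (Ψ.open_source.mem_nhds hD)
  constructor
  · intro hc
    obtain ⟨k, q, hq, hk, -, hd⟩ := exists_dChart_eq D₀
    have h1 : ContinuousAt (fun x => fun j => symSum (k j) (F x)) x₀ :=
      continuousAt_pi.2 fun j =>
        (mdifferentiableAt_symSum (hk _ hD j)).continuousAt.comp (f := F) hF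
    have h2 : ContinuousAt (fun x => fderiv ℂ q fun j => symSum (k j) (F x)) x₀ :=
      (hq.continuous_fderiv (by simp)).continuousAt.comp
        (f := fun x => fun j => symSum (k j) (F x)) h1
    have h3 : ContinuousAt (fun x => fun j => dSum (k j) (F x) (v x)) x₀ :=
      continuousAt_pi.2 fun j => hc _ (hk _ hD j)
    refine (h2.clm_apply h3).congr ?_
    filter_upwards [hev] with x hx
    exact (hd _ hx _).symm
  · intro hc h hh
    have hd := (contDiffAt_symSum_comp_symm hD hh).fderiv_right (m := 0) (by simp)
    have h1 : ContinuousAt (fun x => fderiv ℂ (symSum h ∘ Ψ.symm) (Ψ (F x))) x₀ :=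
      hd.continuousAt.comp (f := fun x => Ψ (F x)) ((Ψ.continuousAt hD).comp hF)
    refine (h1.clm_apply hc).congr ?_
    filter_upwards [hev, hF.eventually hh.eventually] with x hx hx'
    exact (dSum_eq_fderiv hx hx' _).symm

/-- Differentiability of parametrized families of unordered tuples. -/
theorem mdifferentiableAt_real_of_symSum {E : Type*} [NormedAddCommGroup E] [NormedSpace ℝ E]
    {F : E → Sym S n} {t : E} (hc : ContinuousAt F t)
    (h2 : ∀ h : S → ℂ, HolNear h (F t) → DifferentiableAt ℝ (fun x => symSum h (F x)) t) :
    MDifferentiableAt 𝓘(ℝ, E) 𝓘(ℝ, Fin n → ℂ) F t := by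
  obtain ⟨k, q, O, hq, hO, hs, hk, e⟩ := exists_chart_eq_symSum (F t)
  rw [mdifferentiableAt_iff]
  refine ⟨hc, ?_⟩
  have hD := ChartedSpace.mem_chart_source (H := Fin n → ℂ) (F t)
  have h4 : DifferentiableAt ℝ (fun x => chartAt (Fin n → ℂ) (F t) (F x)) t := by
    simp only [e]
    exact ((hq.differentiable (by simp) _).restrictScalars ℝ).comp t
      (f := fun x => fun j => symSum (k j) (F x)) (differentiableAt_pi.2 fun j => h2 _ (hk _ hD j))
  exact h4.differentiableWithinAt

/-- The chain rule for families with real parameters, such as tori: the derivative over `ℝ` is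
paired with the complex differential of the sum, both being computed in the same chart. -/
theorem dSum_mfderiv_real {E : Type*} [NormedAddCommGroup E] [NormedSpace ℝ E]
    {F : E → Sym S n} {t : E} (hF : MDifferentiableAt 𝓘(ℝ, E) 𝓘(ℝ, Fin n → ℂ) F t) {h : S → ℂ}
    (hh : HolNear h (F t)) (u : E) :
    dSum h (F t) (mfderiv 𝓘(ℝ, E) 𝓘(ℝ, Fin n → ℂ) F t u) =
      fderiv ℝ (fun x => symSum h (F x)) t u := by
  let Ψ := chartAt (Fin n → ℂ) (F t)
  have hD : F t ∈ Ψ.source := ChartedSpace.mem_chart_source (F t)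
  have hd : DifferentiableAt ℂ (symSum h ∘ Ψ.symm) (Ψ (F t)) :=
    (contDiffAt_symSum_comp_symm hD hh).differentiableAt (by simp)
  have hΨ : DifferentiableAt ℝ (fun x => Ψ (F x)) t := by
    have := ((mdifferentiableAt_iff _ _).1 hF).2
    simp only [modelWithCornersSelf_coe, Set.range_id] at this
    exact differentiableWithinAt_univ.1 this
  have e1 : (fun x => symSum h (F x)) =ᶠ[𝓝 t] (symSum h ∘ Ψ.symm) ∘ fun x => Ψ (F x) := by
    filter_upwards [hF.continuousAt.eventually (Ψ.open_source.mem_nhds hD)] with x hx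
    simp [Ψ.left_inv hx]
  have e2 : (mfderiv 𝓘(ℝ, E) 𝓘(ℝ, Fin n → ℂ) F t : E →L[ℝ] (Fin n → ℂ)) =
      fderiv ℝ (fun x => Ψ (F x)) t := by
    refine (MDifferentiableAt.mfderiv hF).trans ?_
    simp only [modelWithCornersSelf_coe, Set.range_id, fderivWithin_univ]
    rfl
  have e3 : dSum h (F t) = fderiv ℂ (symSum h ∘ Ψ.symm) (Ψ (F t)) := by
    refine (MDifferentiableAt.mfderiv (mdifferentiableAt_symSum hh)).trans ?_
    simp only [modelWithCornersSelf_coe, Set.range_id, fderivWithin_univ]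
    rfl
  rw [e1.fderiv_eq, fderiv_comp t (hd.restrictScalars ℝ) hΨ, hd.fderiv_restrictScalars ℝ]
  rw [e3]
  exact congrArg _ (congrArg (fun L : E →L[ℝ] (Fin n → ℂ) => L u) e2)

end Criteria

end SymProd

/-! ### Multiplication by locally constant functions on tangent spaces -/

namespace SymProd

open Topology

theorem sum_map_filter {S : Type*} (m : Multiset S) (h : S → ℂ) (U : Set S) [DecidablePred (· ∈ U)] :
    ((m.filter (· ∈ U)).map h).sum = (m.map (U.indicator h)).sum := by
  induction m using Multiset.induction_on with
  | empty => simp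
  | cons a m ih =>
    by_cases ha : a ∈ U
    · simp [ha, ih]
    · simp [ha, ih]

section Multipliers

variable {S : Type*} {n : ℕ} [TopologicalSpace S] [ChartedSpace ℂ S]

theorem HolAt.indicator {h : S → ℂ} {a : S} {U U' : Set S} (hU : IsOpen U) (hU' : IsOpen U')
    (hd : Disjoint U U') (ha : a ∈ U ∪ U') (hh : HolAt h a) : HolAt (U.indicator h) a := by
  rcases ha with ha | ha
  · refine hh.congr ?_
    filter_upwards [hU.mem_nhds ha] with b hb
    exact Set.indicator_of_mem hb h
  · refine (holAt_const 0 a).congr ?_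
    filter_upwards [hU'.mem_nhds ha] with b hb
    exact Set.indicator_of_notMem (Set.disjoint_right.1 hd hb) h

variable [T2Space S] [IsManifold 𝓘(ℂ) ω S]

/-- The projection of the tangent space to the part of the tuple in one of two disjoint open sets
that cover it. -/
theorem exists_localization {D : Sym S n} {U U' : Set S} (hU : IsOpen U) (hU' : IsOpen U')
    (hd : Disjoint U U') (hD : ∀ a ∈ D, a ∈ U ∪ U') : ∃ E : (Fin n → ℂ) →L[ℂ] (Fin n → ℂ),
      ∀ h : S → ℂ, HolNear h D → ∀ v, dSum h D (E v) = dSum (U.indicator h) D v := by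
  classical
  -- The projection is the derivative at `D` of the map that keeps the points of `E` in `U` and
  -- replaces the others by the points of `D` outside `U`. The result may have the wrong number of
  -- points, in which case `G` takes the value `D`; this does not happen near `D`.
  let part (E : Sym S n) : Multiset S := E.1.filter (· ∈ U) + D.1.filter (· ∉ U)
  let G (E : Sym S n) : Sym S n :=
    if hE : Multiset.card (part E) = n then ⟨part E, hE⟩ else D
  have hpD : part D = D.1 := Multiset.filter_add_not _ _
  have hGD : G D = D := by
    have : Multiset.card (part D) = n := by rw [hpD]; exact D.2
    exact (dif_pos this).trans (Subtype.ext hpD)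
  -- The number of points in `U` is the sum of the indicator of `U`. It is continuous at `D` and
  -- integer-valued, hence constant near `D`.
  have hcard : ∀ E : Sym S n, symSum (U.indicator fun _ => 1) E =
      Multiset.card (E.1.filter (· ∈ U)) := by
    intro E
    rw [symSum, ← sum_map_filter]
    simp
  have hev : ∀ᶠ E in 𝓝 D, (G E).1 = part E := by
    have h1 : ContinuousAt (symSum (n := n) (U.indicator fun _ => (1 : ℂ))) D :=
      (mdifferentiableAt_symSum fun a ha =>
        (holAt_const 1 a).indicator hU hU' hd (hD a ha)).continuousAt
    filter_upwards [h1.eventually (Metric.ball_mem_nhds _ one_pos)] with E hE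
    rw [hcard, hcard, Complex.dist_eq] at hE
    have h2 : Multiset.card (E.1.filter (· ∈ U)) = Multiset.card (D.1.filter (· ∈ U)) := by
      have h3 : ‖(((Multiset.card (E.1.filter (· ∈ U)) : ℤ) -
          (Multiset.card (D.1.filter (· ∈ U)) : ℤ) : ℤ) : ℂ)‖ < 1 := by
        push_cast
        exact hE
      rw [Complex.norm_intCast] at h3
      have h4 : |(Multiset.card (E.1.filter (· ∈ U)) : ℤ) -
          (Multiset.card (D.1.filter (· ∈ U)) : ℤ)| < 1 := by exact_mod_cast h3
      rw [Int.abs_lt_one_iff] at h4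
      omega
    have h5 : Multiset.card (part E) = n := by
      rw [Multiset.card_add, h2, ← Multiset.card_add, Multiset.filter_add_not]
      exact D.2
    exact congrArg Subtype.val (dif_pos h5 : G E = ⟨part E, h5⟩)
  have hsum : ∀ h : S → ℂ, (fun E => symSum h (G E)) =ᶠ[𝓝 D]
      fun E => symSum (U.indicator h) E + ((D.1.filter (· ∉ U)).map h).sum := by
    intro h
    filter_upwards [hev] with E hE
    rw [symSum, hE, Multiset.map_add, Multiset.sum_add, sum_map_filter]
    rfl
  have hind : ∀ h : S → ℂ, HolNear h D → HolNear (U.indicator h) D := fun h hh a ha =>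
    (hh a ha).indicator hU hU' hd (hD a ha)
  have hc : ContinuousAt G D := by
    refine continuousAt_of_symSum ?_ fun h hh => ?_
    · rw [hGD]
      intro O hO hDO
      filter_upwards [hev, (isOpen_forall_mem hO).mem_nhds hDO] with E hE hEO a ha
      have ha' : a ∈ part E := hE ▸ ha
      rcases Multiset.mem_add.1 ha' with h | h
      · exact hEO a (Multiset.mem_filter.1 h).1
      · exact hDO a (Multiset.mem_filter.1 h).1
    · rw [hGD] at hh
      rw [continuousAt_congr (hsum h)]
      exact (mdifferentiableAt_symSum (hind h hh)).continuousAt.add continuousAt_const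
  have hmd : MDifferentiableAt 𝓘(ℂ, Fin n → ℂ) 𝓘(ℂ, Fin n → ℂ) G D := by
    refine mdifferentiableAt_of_symSum hc fun h hh => ?_
    rw [hGD] at hh
    exact MDifferentiableAt.congr_of_eventuallyEq
      ((mdifferentiableAt_symSum (hind h hh)).add mdifferentiableAt_const) (hsum h)
  refine ⟨mfderiv 𝓘(ℂ, Fin n → ℂ) 𝓘(ℂ, Fin n → ℂ) G D, fun h hh v => ?_⟩
  have := dSum_mfderiv hmd (by rw [hGD]; exact hh) _ (hsum h) v
  rw [hGD] at this
  exact this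

/-- Multiplication by a function that is locally constant near the points of a tuple acts on the
tangent space of the symmetric product at this tuple. -/
theorem exists_multiplier {D : Sym S n} {W : S → ℂ} (hW : ∀ a ∈ D, ∀ᶠ b in 𝓝 a, W b = W a) :
    ∃ M : (Fin n → ℂ) →L[ℂ] (Fin n → ℂ), ∀ h : S → ℂ, HolNear h D → ∀ v,
      dSum h D (M v) = dSum (fun b => W b * h b) D v := by
  classical
  -- Disjoint neighbourhoods of the points of `D` split the tangent space by `exists_localization`;
  -- on the summand at `y` the multiplier is the scalar `W y`.
  obtain ⟨U, hU, hUd⟩ := D.1.toFinset.finite_toSet.t2_separation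
  have hmem : ∀ a, a ∈ D ↔ a ∈ D.1.toFinset := fun a => Multiset.mem_toFinset.symm
  let U' (y : S) : Set S := ⋃ x ∈ D.1.toFinset.erase y, U x
  have hU' : ∀ y, IsOpen (U' y) := fun y => isOpen_biUnion fun x _ => (hU x).2
  have hd : ∀ y ∈ D.1.toFinset, Disjoint (U y) (U' y) := by
    intro y hy
    simp only [U', Set.disjoint_iUnion_right]
    intro x hx
    exact hUd hy (Finset.mem_of_mem_erase hx) (Finset.ne_of_mem_erase hx).symm
  have hc : ∀ y, ∀ a ∈ D, a ∈ U y ∪ U' y := by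
    intro y a ha
    by_cases h : a = y
    · exact Or.inl (h ▸ (hU a).1)
    · exact Or.inr (Set.mem_biUnion (Finset.mem_erase.2 ⟨h, (hmem a).1 ha⟩) (hU a).1)
  choose! E hE using fun y (hy : y ∈ D.1.toFinset) =>
    exists_localization (hU y).2 (hU' y) (hd y hy) (hc y)
  refine ⟨∑ y ∈ D.1.toFinset, W y • E y, fun h hh v => ?_⟩
  have hind : ∀ y ∈ D.1.toFinset, HolNear ((U y).indicator h) D := fun y hy a ha =>
    (hh a ha).indicator (hU y).2 (hU' y) (hd y hy) (hc y a ha)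
  have e1 : dSum (fun b => W b * h b) D =
      ∑ y ∈ D.1.toFinset, W y • dSum ((U y).indicator h) D := by
    rw [← Finset.sum_congr rfl fun y hy => dSum_const_mul (W y) (hind y hy), ← dSum_sum
      fun y hy a ha => (holAt_const (W y) a).mul (hind y hy a ha)]
    refine dSum_congr fun a ha => ?_
    filter_upwards [(hU a).2.mem_nhds (hU a).1, hW a ha] with b hb hWb
    rw [Finset.sum_eq_single_of_mem a ((hmem a).1 ha), Set.indicator_of_mem hb, hWb]
    intro y hy hya
    rw [Set.indicator_of_notMem, mul_zero]
    exact Set.disjoint_left.1 (hUd ((hmem a).1 ha) hy hya.symm) hb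
  rw [e1]
  simp only [sum_apply, smul_apply, map_sum, map_smul]
  exact Finset.sum_congr rfl fun y hy => by rw [hE y hy h hh v]

end Multipliers

end SymProd

/-! ### Two-to-one maps: deck transformation, preimages and traces -/

namespace DoubleCover

open Topology SymProd

section Deck

variable {A B : Type*} {π : A → B}

theorem deck_spec (hπ : ∀ x, (π ⁻¹' {x}).ncard = 2) (a : A) :
    π (deck π a) = π a ∧ deck π a ≠ a := by
  have h : ∃ a', π a' = π a ∧ a' ≠ a := by
    obtain ⟨x, y, hxy, e⟩ := Set.ncard_eq_two.1 (hπ (π a))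
    have hx : π x = π a := by
      have : x ∈ π ⁻¹' {π a} := by rw [e]; simp
      exact this
    have hy : π y = π a := by
      have : y ∈ π ⁻¹' {π a} := by rw [e]; simp
      exact this
    by_cases hxa : x = a
    · exact ⟨y, hy, fun h => hxy (hxa.trans h.symm)⟩
    · exact ⟨x, hx, hxa⟩
  rw [deck, dif_pos h]
  exact h.choose_spec

theorem eq_deck (hπ : ∀ x, (π ⁻¹' {x}).ncard = 2) {a b : A} (h : π b = π a) (hne : b ≠ a) :
    b = deck π a := by
  obtain ⟨h1, h2⟩ := deck_spec hπ a
  obtain ⟨x, y, hxy, e⟩ := Set.ncard_eq_two.1 (hπ (π a))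
  have key : ∀ c, π c = π a → c = x ∨ c = y := fun c hc => by
    have : c ∈ π ⁻¹' {π a} := hc
    rw [e] at this
    simpa using this
  rcases key b h with rfl | rfl <;> rcases key a rfl with h3 | h3 <;>
    rcases key _ h1 with h4 | h4 <;> grind

theorem deck_deck (hπ : ∀ x, (π ⁻¹' {x}).ncard = 2) (a : A) : deck π (deck π a) = a :=
  (eq_deck hπ (deck_spec hπ a).1.symm (deck_spec hπ a).2.symm).symm

theorem eq_or_eq_deck (hπ : ∀ x, (π ⁻¹' {x}).ncard = 2) {a b : A} (h : π b = π a) :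
    b = a ∨ b = deck π a := by
  by_cases hb : b = a
  · exact Or.inl hb
  · exact Or.inr (eq_deck hπ h hb)

theorem mem_pullbackSym (hπ : ∀ x, (π ⁻¹' {x}).ncard = 2) {g : ℕ} {D : Sym B g} {a : A} :
    a ∈ pullbackSym π hπ g D ↔ π a ∈ D := by
  change a ∈ D.1.bind _ ↔ _
  rw [Multiset.mem_bind]
  constructor
  · rintro ⟨x, hx, ha⟩
    have : π a = x := by simpa using ha
    exact this ▸ hx
  · intro h
    exact ⟨π a, h, by simp⟩

theorem symDeck_pullbackSym (hπ : ∀ x, (π ⁻¹' {x}).ncard = 2) {g : ℕ} (D : Sym B g) :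
    symDeck π (2 * g) (pullbackSym π hπ g D) = pullbackSym π hπ g D := by
  apply Sym.coe_injective
  change (D.1.bind _).map (deck π) = D.1.bind _
  rw [Multiset.map_bind]
  refine Multiset.bind_congr fun x _ => ?_
  have hinj : Function.Injective (deck π) :=
    Function.LeftInverse.injective (g := deck π) (deck_deck hπ)
  have := congrArg Finset.val (Finset.map_eq_of_subset (s := (finite_fibre hπ x).toFinset)
    (f := ⟨deck π, hinj⟩) (fun b hb => by
      obtain ⟨a, ha, rfl⟩ := Finset.mem_map.1 hb
      have ha : π a = x := by simpa using ha
      simpa using (deck_spec hπ a).1.trans ha))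
  exact this

/-- The sum of the values of a function over the fibres of a two-to-one map. -/
noncomputable def trace (π : A → B) (hπ : ∀ x, (π ⁻¹' {x}).ncard = 2) (h : A → ℂ) (x : B) : ℂ :=
  ∑ a ∈ (finite_fibre hπ x).toFinset, h a

theorem trace_eq (hπ : ∀ x, (π ⁻¹' {x}).ncard = 2) (h : A → ℂ) {x : B} {a b : A} (ha : π a = x)
    (hb : π b = x) (hab : a ≠ b) : trace π hπ h x = h a + h b := by
  classical
  have : (finite_fibre hπ x).toFinset = {a, b} := by
    ext c
    simp only [Set.Finite.mem_toFinset, Set.mem_preimage, Set.mem_singleton_iff,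
      Finset.mem_insert, Finset.mem_singleton]
    constructor
    · intro hc
      have h1 := eq_deck hπ (hb.trans ha.symm) hab.symm
      rw [h1]
      exact eq_or_eq_deck hπ (hc.trans ha.symm)
    · rintro (rfl | rfl) <;> assumption
  rw [trace, this, Finset.sum_pair hab]

/-- Pulling back tuples is dual to taking traces of functions, so questions about `pullbackSym`
become questions about `trace`. -/
theorem symSum_pullbackSym (hπ : ∀ x, (π ⁻¹' {x}).ncard = 2) {g : ℕ} (h : A → ℂ) (D : Sym B g) :
    symSum h (pullbackSym π hπ g D) = symSum (trace π hπ h) D := by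
  change ((D.1.bind _).map h).sum = (D.1.map _).sum
  rw [Multiset.map_bind, Multiset.sum_bind]
  rfl

end Deck

/-! ### Holomorphic double covers and the eigenspaces of the involution -/

section Cover

variable {A B : Type*} [TopologicalSpace A] [T2Space A] [ChartedSpace ℂ A] [TopologicalSpace B]
  [ChartedSpace ℂ B] {π : A → B} {g : ℕ}

/-- A holomorphic unbranched double cover of Riemann surfaces. -/
structure IsHolDoubleCover (π : A → B) : Prop where
  ncard : ∀ x, (π ⁻¹' {x}).ncard = 2
  mdifferentiable : ∀ a, MDifferentiableAt 𝓘(ℂ) 𝓘(ℂ) π a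
  exists_section : ∀ a, ∃ σ : B → A,
    (∀ᶠ x in 𝓝 (π a), MDifferentiableAt 𝓘(ℂ) 𝓘(ℂ) σ x ∧ π (σ x) = x) ∧
      ∀ᶠ b in 𝓝 a, σ (π b) = b

namespace IsHolDoubleCover

/-- Two local sections pass through the two points of a fibre, and the Hausdorff property keeps them
apart nearby; since fibres have two points, they exhaust the fibres there. This is the local form of
the cover on which the holomorphy of `deck` and of traces rests. -/
theorem exists_sections (hπ : IsHolDoubleCover π) (a : A) : ∃ σ₁ σ₂ : B → A,
    σ₁ (π a) = a ∧ σ₂ (π a) = deck π a ∧ (∀ᶠ b in 𝓝 a, σ₁ (π b) = b) ∧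
    ∀ᶠ x in 𝓝 (π a), MDifferentiableAt 𝓘(ℂ) 𝓘(ℂ) σ₁ x ∧ MDifferentiableAt 𝓘(ℂ) 𝓘(ℂ) σ₂ x ∧
      π (σ₁ x) = x ∧ π (σ₂ x) = x ∧ σ₁ x ≠ σ₂ x := by
  obtain ⟨σ₁, h1, h1'⟩ := hπ.exists_section a
  obtain ⟨σ₂, h2, h2'⟩ := hπ.exists_section (deck π a)
  obtain ⟨ha, hne⟩ := deck_spec hπ.ncard a
  rw [ha] at h2
  have e1 : σ₁ (π a) = a := h1'.self_of_nhds
  have e2 : σ₂ (π a) = deck π a := by rw [← ha]; exact h2'.self_of_nhds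
  refine ⟨σ₁, σ₂, e1, e2, h1', ?_⟩
  have hev : ∀ᶠ x in 𝓝 (π a), σ₁ x ≠ σ₂ x :=
    (h1.self_of_nhds.1.continuousAt.prodMk h2.self_of_nhds.1.continuousAt).eventually
      (isClosed_diagonal.isOpen_compl.mem_nhds (by
        change σ₁ (π a) ≠ σ₂ (π a)
        rw [e1, e2]
        exact hne.symm))
  filter_upwards [h1, h2, hev] with x hx hx' hx''
  exact ⟨hx.1, hx'.1, hx.2, hx'.2, hx''⟩

theorem mdifferentiableAt_deck (hπ : IsHolDoubleCover π) (a : A) :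
    MDifferentiableAt 𝓘(ℂ) 𝓘(ℂ) (deck π) a := by
  obtain ⟨σ₁, σ₂, e1, e2, h1, h2⟩ := hπ.exists_sections a
  have hm : MDifferentiableAt 𝓘(ℂ) 𝓘(ℂ) (σ₂ ∘ π) a :=
    MDifferentiableAt.comp a h2.self_of_nhds.2.1 (hπ.mdifferentiable a)
  refine hm.congr_of_eventuallyEq ?_
  filter_upwards [h1, (hπ.mdifferentiable a).continuousAt.eventually h2] with b hb hb'
  refine (eq_deck hπ.ncard hb'.2.2.2.1 fun h => hb'.2.2.2.2 ?_).symm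
  rw [hb, h]

theorem holAt_comp_deck (hπ : IsHolDoubleCover π) {h : A → ℂ} {a : A} (hh : HolAt h (deck π a)) :
    HolAt (fun b => h (deck π b)) a :=
  hh.comp (Filter.Eventually.of_forall hπ.mdifferentiableAt_deck)

theorem eventually_fibre (hπ : IsHolDoubleCover π) {x : B} {p : A → Prop}
    (hp : ∀ a, π a = x → ∀ᶠ b in 𝓝 a, p b) : ∀ᶠ y in 𝓝 x, ∀ b, π b = y → p b := by
  obtain ⟨a, ha⟩ : (π ⁻¹' {x}).Nonempty := Set.nonempty_of_ncard_ne_zero (by simp [hπ.ncard])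
  obtain rfl : π a = x := ha
  obtain ⟨σ₁, σ₂, e1, e2, -, h2⟩ := hπ.exists_sections a
  have h3 := h2.self_of_nhds
  have p1 := h3.1.continuousAt.eventually (by rw [e1]; exact hp a rfl)
  have p2 := h3.2.1.continuousAt.eventually
    (by rw [e2]; exact hp _ (deck_spec hπ.ncard a).1)
  filter_upwards [h2, p1, p2] with y hy hy1 hy2 b hb
  obtain ⟨-, -, q1, q2, hne⟩ := hy
  have := eq_deck hπ.ncard (q2.trans q1.symm) hne.symm
  rcases eq_or_eq_deck hπ.ncard (hb.trans q1.symm) with rfl | rfl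
  · exact hy1
  · rw [← this]; exact hy2

theorem holAt_trace (hπ : IsHolDoubleCover π) {h : A → ℂ} {x : B}
    (hh : ∀ a, π a = x → HolAt h a) : HolAt (trace π hπ.ncard h) x := by
  obtain ⟨a, ha⟩ : (π ⁻¹' {x}).Nonempty := Set.nonempty_of_ncard_ne_zero (by simp [hπ.ncard])
  obtain rfl : π a = x := ha
  obtain ⟨σ₁, σ₂, e1, e2, -, h2⟩ := hπ.exists_sections a
  have h3 : HolAt (fun y => h (σ₁ y) + h (σ₂ y)) (π a) := by
    refine HolAt.add (HolAt.comp ?_ ?_) (HolAt.comp ?_ ?_)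
    · rw [e1]; exact hh a rfl
    · exact h2.mono fun y hy => hy.1
    · rw [e2]; exact hh _ (deck_spec hπ.ncard a).1
    · exact h2.mono fun y hy => hy.2.1
  refine h3.congr ?_
  filter_upwards [h2] with y hy
  exact trace_eq hπ.ncard h hy.2.2.1 hy.2.2.2.1 hy.2.2.2.2

theorem holNear_trace (hπ : IsHolDoubleCover π) {h : A → ℂ} {D : Sym B g}
    (hh : HolNear h (pullbackSym π hπ.ncard g D)) : HolNear (trace π hπ.ncard h) D :=
  fun _ hx => hπ.holAt_trace fun a ha => hh a ((mem_pullbackSym hπ.ncard).2 (ha ▸ hx))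

theorem continuous_symDeck (hπ : IsHolDoubleCover π) (n : ℕ) : Continuous (symDeck π n) := by
  have hc : Continuous (deck π) :=
    continuous_iff_continuousAt.2 fun a => (hπ.mdifferentiableAt_deck a).continuousAt
  have := continuousOn_map (n := n) isOpen_univ hc.continuousOn
  simpa [symDeck, ← continuousOn_univ] using this

variable [IsManifold 𝓘(ℂ) ω A]

theorem mdifferentiableAt_symDeck (hπ : IsHolDoubleCover π) {n : ℕ} (E : Sym A n) :
    MDifferentiableAt 𝓘(ℂ, Fin n → ℂ) 𝓘(ℂ, Fin n → ℂ) (symDeck π n) E := by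
  refine mdifferentiableAt_of_symSum (hπ.continuous_symDeck n).continuousAt fun h hh => ?_
  simp only [symDeck, symSum_map]
  exact mdifferentiableAt_symSum fun a ha =>
    hπ.holAt_comp_deck (hh _ (Sym.mem_map.2 ⟨a, ha, rfl⟩))

theorem dSum_symDeck (hπ : IsHolDoubleCover π) {n : ℕ} {E : Sym A n} {h : A → ℂ}
    (hh : HolNear h (symDeck π n E)) (v : Fin n → ℂ) :
    dSum h (symDeck π n E) (mfderiv 𝓘(ℂ, Fin n → ℂ) 𝓘(ℂ, Fin n → ℂ) (symDeck π n) E v) =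
      dSum (fun a => h (deck π a)) E v :=
  dSum_mfderiv (hπ.mdifferentiableAt_symDeck E) hh 0
    (Filter.Eventually.of_forall fun E => by simp [symDeck, symSum_map, Function.comp_def]) v

/-- The `-1`-eigenspace of the involution in terms of sums of holomorphic functions. -/
theorem mem_antiInvariant_iff (hπ : IsHolDoubleCover π) {n : ℕ} {E : Sym A n}
    (hE : symDeck π n E = E) (v : Fin n → ℂ) : v ∈ antiInvariant π n E ↔
      ∀ h : A → ℂ, HolNear h E → dSum (fun a => h (deck π a)) E v = -dSum h E v := by
  let ι' : (Fin n → ℂ) →L[ℂ] (Fin n → ℂ) :=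
    mfderiv 𝓘(ℂ, Fin n → ℂ) 𝓘(ℂ, Fin n → ℂ) (symDeck π n) E
  have hι : ∀ h : A → ℂ, HolNear h E → ∀ w, dSum h E (ι' w) = dSum (fun a => h (deck π a)) E w := by
    intro h hh w
    have := hπ.dSum_symDeck (hE.symm ▸ hh) w
    rw [hE] at this
    exact this
  -- The definition compares points of the total space. As `E` is fixed, the base points agree and
  -- only the vectors are left to compare.
  have h1 : ∀ w : Fin n → ℂ, tangentMap 𝓘(ℂ, Fin n → ℂ) 𝓘(ℂ, Fin n → ℂ) (symDeck π n)
      (⟨E, w⟩ : TangentBundle 𝓘(ℂ, Fin n → ℂ) (Sym A n)) =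
      (⟨E, (-w : Fin n → ℂ)⟩ : TangentBundle 𝓘(ℂ, Fin n → ℂ) (Sym A n)) ↔ ι' w = -w := by
    intro w
    change (⟨symDeck π n E, ι' w⟩ : TangentBundle 𝓘(ℂ, Fin n → ℂ) (Sym A n)) = _ ↔ _
    constructor
    · intro h
      exact eq_of_heq (Bundle.TotalSpace.mk.inj h).2
    · intro h
      rw [h]
      generalize (-w : Fin n → ℂ) = w'
      generalize symDeck π n E = E' at hE
      subst hE
      rfl
  -- The span in the definition adds nothing: the eigenvectors are the kernel of `ι' + 1`, already a
  -- subspace.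
  have h2 : v ∈ antiInvariant π n E ↔ ι' v = -v := by
    have e : antiInvariant π n E = Submodule.span ℝ
        (((LinearMap.ker (ι'.toLinearMap + LinearMap.id)).restrictScalars ℝ : Submodule ℝ _) :
          Set (Fin n → ℂ)) := by
      rw [antiInvariant]
      congr 1
      ext w
      exact (h1 w).trans eq_neg_iff_add_eq_zero
    rw [e, Submodule.span_eq]
    exact eq_neg_iff_add_eq_zero.symm
  rw [h2]
  constructor
  · intro h k hk
    rw [← hι k hk, h, map_neg]
  · intro h
    refine ext_dSum (S := A) (D := E) fun k hk => ?_
    rw [hι k hk, h k hk, map_neg]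

variable [T2Space B] [IsManifold 𝓘(ℂ) ω B]

theorem continuous_pullbackSym (hπ : IsHolDoubleCover π) :
    Continuous (pullbackSym π hπ.ncard g) := by
  rw [continuous_iff_continuousAt]
  intro D
  refine continuousAt_of_symSum ?_ fun h hh => ?_
  · intro O hO hD
    have : ∀ᶠ E in 𝓝 D, ∀ x ∈ E, ∀ b, π b = x → b ∈ O :=
      eventually_forall_mem fun x hx => hπ.eventually_fibre fun a ha =>
        hO.mem_nhds (hD a ((mem_pullbackSym hπ.ncard).2 (ha ▸ hx)))
    filter_upwards [this] with E hE b hb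
    exact hE _ ((mem_pullbackSym hπ.ncard).1 hb) b rfl
  · simp only [symSum_pullbackSym]
    exact (mdifferentiableAt_symSum (hπ.holNear_trace hh)).continuousAt

theorem mdifferentiableAt_pullbackSym (hπ : IsHolDoubleCover π) (D : Sym B g) :
    MDifferentiableAt 𝓘(ℂ, Fin g → ℂ) 𝓘(ℂ, Fin (2 * g) → ℂ) (pullbackSym π hπ.ncard g) D := by
  refine mdifferentiableAt_of_symSum hπ.continuous_pullbackSym.continuousAt fun h hh => ?_
  simp only [symSum_pullbackSym]
  exact mdifferentiableAt_symSum (hπ.holNear_trace hh)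

/-- The differential of `D ↦ π⁻¹ D` on the model spaces. -/
noncomputable def dPull (hπ : IsHolDoubleCover π) (D : Sym B g) :
    (Fin g → ℂ) →L[ℂ] (Fin (2 * g) → ℂ) :=
  mfderiv 𝓘(ℂ, Fin g → ℂ) 𝓘(ℂ, Fin (2 * g) → ℂ) (pullbackSym π hπ.ncard g) D

theorem dSum_dPull (hπ : IsHolDoubleCover π) {D : Sym B g} {h : A → ℂ}
    (hh : HolNear h (pullbackSym π hπ.ncard g D)) (v : Fin g → ℂ) :
    dSum h (pullbackSym π hπ.ncard g D) (hπ.dPull D v) = dSum (trace π hπ.ncard h) D v :=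
  dSum_mfderiv (hπ.mdifferentiableAt_pullbackSym D) hh 0
    (Filter.Eventually.of_forall fun E => by simp [symSum_pullbackSym]) v

/-- It suffices to test on functions `h ∘ π`, whose trace is `2 h`. -/
theorem dPull_injective (hπ : IsHolDoubleCover π) (D : Sym B g) :
    Function.Injective (hπ.dPull D) := by
  rw [injective_iff_map_eq_zero]
  intro v hv
  refine eq_zero_of_dSum (S := B) (D := D) fun h hh => ?_
  have h1 : HolNear (fun a => h (π a)) (pullbackSym π hπ.ncard g D) := fun a ha =>
    (hh _ ((mem_pullbackSym hπ.ncard).1 ha)).comp (Filter.Eventually.of_forall hπ.mdifferentiable)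
  have h2 := hπ.dSum_dPull h1 v
  have h3 : trace π hπ.ncard (fun a => h (π a)) = fun x => 2 * h x := by
    ext x
    obtain ⟨a, ha⟩ : (π ⁻¹' {x}).Nonempty := Set.nonempty_of_ncard_ne_zero (by simp [hπ.ncard])
    obtain rfl : π a = x := ha
    obtain ⟨q1, q2⟩ := deck_spec hπ.ncard a
    rw [trace_eq hπ.ncard _ rfl q1 q2.symm, q1, two_mul]
  rw [hv, map_zero, h3, dSum_const_mul 2 hh] at h2
  simpa using h2.symm

/-- A locally constant odd function near the points of a symmetric tuple identifies the tangent
space of `Symᵍ B` with the `-1`-eigenspace of the involution. -/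
theorem exists_twist (hπ : IsHolDoubleCover π) (D : Sym B g) {V : A → ℂ}
    (hV : ∀ a, π a ∈ D → ∀ᶠ b in 𝓝 a, V b = V a) (hodd : ∀ a, π a ∈ D → V (deck π a) = -V a)
    (h0 : ∀ a, π a ∈ D → V a ≠ 0) : ∃ Θ : (Fin g → ℂ) →L[ℂ] (Fin (2 * g) → ℂ),
      Function.Injective Θ ∧
      (∀ w : Fin (2 * g) → ℂ,
        w ∈ antiInvariant π (2 * g) (pullbackSym π hπ.ncard g D) ↔ ∃ v, Θ v = w) ∧
      ∀ h : A → ℂ, HolNear h (pullbackSym π hπ.ncard g D) → ∀ v,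
        dSum h (pullbackSym π hπ.ncard g D) (Θ v) =
          dSum (fun a => V a * h a) (pullbackSym π hπ.ncard g D) (hπ.dPull D v) := by
  set E := pullbackSym π hπ.ncard g D with hEdef
  have hmem : ∀ a, a ∈ E ↔ π a ∈ D := fun a => mem_pullbackSym hπ.ncard
  have hEE : symDeck π (2 * g) E = E := symDeck_pullbackSym hπ.ncard D
  have hdeckE : ∀ a, a ∈ E → deck π a ∈ E := fun a ha => by
    rw [hmem, (deck_spec hπ.ncard a).1, ← hmem]; exact ha
  -- `Θ` will be the differential of `D ↦ π⁻¹ D` followed by the multiplication `M` by `V`.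
  obtain ⟨M, hM⟩ := exists_multiplier (D := E) fun a ha => hV a ((hmem a).1 ha)
  have hVhol : ∀ a ∈ E, HolAt V a := fun a ha =>
    (holAt_const (V a) a).congr (hV a ((hmem a).1 ha))
  have hVinv : ∀ a ∈ E, HolAt (fun b => (V b)⁻¹) a := fun a ha =>
    (holAt_const ((V a)⁻¹) a).congr (by
      filter_upwards [hV a ((hmem a).1 ha)] with b hb
      rw [hb])
  -- Testing against `V⁻¹ h` in place of `h` undoes the multiplication by `V`.
  have hMinj : ∀ w, M w = 0 → w = 0 := by
    intro w hw
    refine eq_zero_of_dSum (S := A) (D := E) fun h hh => ?_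
    have h1 := hM (fun b => (V b)⁻¹ * h b) (fun a ha => (hVinv a ha).mul (hh a ha)) w
    rw [hw, map_zero] at h1
    rw [h1]
    refine congrArg (fun L : (Fin (2 * g) → ℂ) →L[ℂ] ℂ => L w) (dSum_congr fun a ha => ?_)
    filter_upwards [hV a ((hmem a).1 ha)] with b hb
    rw [mul_inv_cancel_left₀ (by rw [hb]; exact h0 a ((hmem a).1 ha))]
  -- The image of `dPull` is in the `+1`-eigenspace, because `h` and `h ∘ deck π` have the same
  -- trace.
  have hinv : ∀ v (h : A → ℂ), HolNear h E →
      dSum (fun a => h (deck π a)) E (hπ.dPull D v) = dSum h E (hπ.dPull D v) := by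
    intro v h hh
    rw [hπ.dSum_dPull hh, hπ.dSum_dPull fun a ha => hπ.holAt_comp_deck (hh _ (hdeckE a ha))]
    congr 1
    refine dSum_congr fun x _ => Filter.Eventually.of_forall fun y => ?_
    obtain ⟨a, ha⟩ : (π ⁻¹' {y}).Nonempty := Set.nonempty_of_ncard_ne_zero (by simp [hπ.ncard])
    obtain rfl : π a = y := ha
    obtain ⟨q1, q2⟩ := deck_spec hπ.ncard a
    rw [trace_eq hπ.ncard _ rfl q1 q2.symm, trace_eq hπ.ncard _ rfl q1 q2.symm,
      deck_deck hπ.ncard, add_comm]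
  -- Multiplication by an odd function sends `+1`-eigenvectors to `-1`-eigenvectors.
  have hodd' : ∀ v (h : A → ℂ), HolNear h E →
      dSum (fun a => h (deck π a)) E (M (hπ.dPull D v)) = -dSum h E (M (hπ.dPull D v)) := by
    intro v h hh
    have hh' : HolNear (fun a => h (deck π a)) E := fun a ha =>
      hπ.holAt_comp_deck (hh _ (hdeckE a ha))
    rw [hM h hh, hM _ hh', ← hinv v (fun a => V a * h a) fun a ha => (hVhol a ha).mul (hh a ha)]
    have : dSum (fun a => V (deck π a) * h (deck π a)) E =
        (-1 : ℂ) • dSum (fun a => V a * h (deck π a)) E := by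
      rw [← dSum_const_mul (-1) fun a ha => (hVhol a ha).mul (hh' a ha)]
      refine dSum_congr fun a ha => ?_
      have ha' := (hmem a).1 ha
      have h1 := (hπ.mdifferentiableAt_deck a).continuousAt.eventually
        (hV _ ((hmem _).1 (hdeckE a ha)))
      filter_upwards [h1, hV a ha'] with b hb hb'
      rw [hb, hb', hodd a ha']
      ring
    rw [this, smul_apply, smul_eq_mul]
    ring
  let Θ : (Fin g → ℂ) →L[ℂ] (Fin (2 * g) → ℂ) := M.comp (hπ.dPull D)
  have hΘinj : Function.Injective Θ := by
    rw [injective_iff_map_eq_zero]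
    intro v hv
    exact (injective_iff_map_eq_zero _).1 (hπ.dPull_injective D) v (hMinj _ hv)
  have hanti : ∀ w : Fin (2 * g) → ℂ, (w ∈ antiInvariant π (2 * g) E ↔ _) := fun w =>
    hπ.mem_antiInvariant_iff hEE w
  refine ⟨Θ, hΘinj, fun w => ⟨fun hw => ?_, ?_⟩, fun h hh v => hM h hh _⟩
  · have hzero : ∀ v : Fin g → ℂ, (∀ h : A → ℂ, HolNear h E →
        dSum (fun a => h (deck π a)) E (hπ.dPull D v) = -dSum h E (hπ.dPull D v)) → v = 0 := by
      intro v hv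
      refine (injective_iff_map_eq_zero _).1 (hπ.dPull_injective D) v
        (eq_zero_of_dSum (S := A) (D := E) fun h hh => ?_)
      have := hv h hh
      rw [hinv v h hh] at this
      exact self_eq_neg.1 this
    -- Surjectivity onto the `-1`-eigenspace by counting dimensions. The `+1`-vectors `dPull a` and
    -- the `-1`-vectors `Θ b` are independent, and `g + g = 2g`, so together they fill the tangent
    -- space; an anti-invariant vector then has `a = 0`, by `hzero`.
    let T : ((Fin g → ℂ) × (Fin g → ℂ)) →ₗ[ℂ] (Fin (2 * g) → ℂ) :=
      (hπ.dPull D).toLinearMap.coprod Θ.toLinearMap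
    have hT : Function.Injective T := by
      rw [injective_iff_map_eq_zero]
      rintro ⟨a, b⟩ hab
      have hab' : hπ.dPull D a + M (hπ.dPull D b) = 0 := hab
      have ha : a = 0 := by
        refine hzero a fun h hh => ?_
        rw [eq_neg_of_add_eq_zero_left hab', map_neg, map_neg, hodd' b h hh]
      subst ha
      rw [map_zero, zero_add] at hab'
      have hb := hΘinj (a₁ := b) (a₂ := 0) (by rw [map_zero]; exact hab')
      rw [hb]
      rfl
    have hTs : Function.Surjective T :=
      (LinearMap.injective_iff_surjective_of_finrank_eq_finrank (by simp [two_mul])).1 hT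
    obtain ⟨⟨a, b⟩, hab⟩ := hTs w
    have hab' : hπ.dPull D a + M (hπ.dPull D b) = w := hab
    have ha : a = 0 := by
      refine hzero a fun h hh => ?_
      rw [eq_sub_of_add_eq hab', map_sub, map_sub, (hanti w).1 hw h hh, hodd' b h hh]
      ring
    refine ⟨b, ?_⟩
    rw [← hab', ha, map_zero, zero_add]
    rfl
  · rintro ⟨v, rfl⟩
    exact (hanti _).2 fun h hh => hodd' v h hh

end IsHolDoubleCover

end Cover

end DoubleCover

/-! ### Polar decomposition relative to two hermitian matrices -/

namespace DoubleCover

section PolarMatrix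

open Matrix
open scoped Matrix.Norms.L2Operator MatrixOrder ComplexOrder

variable {n : Type*} [Fintype n] [DecidableEq n]

theorem sqrt_posDef {A : Matrix n n ℂ} (hA : A.PosDef) :
    (CFC.sqrt A).PosDef ∧ CFC.sqrt A * CFC.sqrt A = A := by
  have h2 : CFC.sqrt A * CFC.sqrt A = A := CFC.sqrt_mul_sqrt_self A hA.posSemidef.nonneg
  refine ⟨?_, h2⟩
  have h1 : (CFC.sqrt A).PosSemidef := (CFC.sqrt_nonneg A).posSemidef
  rw [h1.posDef_iff_isUnit]
  have := hA.isUnit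
  rw [← h2] at this
  exact isUnit_of_mul_isUnit_left this

theorem continuousAt_sqrt {X : Type*} [TopologicalSpace X] {G : X → Matrix n n ℂ} {x₀ : X}
    (hG : ContinuousAt G x₀) (hp : ∀ᶠ x in nhds x₀, (G x).PosDef) :
    ContinuousAt (fun x => CFC.sqrt (G x)) x₀ := by
  have h : ContinuousOn (fun A : Matrix n n ℂ => CFC.sqrt A) {A | 0 ≤ A} :=
    ContinuousOn.cfcₙ_nnreal_of_mem_nhdsSet (s := Set.univ) (fun x => NNReal.sqrt x)
      Filter.univ_mem continuousOn_id (fun _ hx => hx) (by fun_prop) (by simp)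
  have h1 := (h (G x₀) hp.self_of_nhds.posSemidef.nonneg).tendsto
  refine h1.comp (tendsto_nhdsWithin_iff.2 ⟨hG, ?_⟩)
  filter_upwards [hp] with x hx
  exact hx.posSemidef.nonneg

/-- For positive definite hermitian matrices `G₁`, `G₂`, the unique `G₂`-selfadjoint `G₂`-positive
matrix that transforms the form `G₂` to `G₁`. -/
noncomputable def polar (G₁ G₂ : Matrix n n ℂ) : Matrix n n ℂ :=
  (CFC.sqrt G₂)⁻¹ * CFC.sqrt ((CFC.sqrt G₂)⁻¹ * G₁ * (CFC.sqrt G₂)⁻¹) * CFC.sqrt G₂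

section

variable {G₁ G₂ : Matrix n n ℂ}

theorem posDef_conj {G R : Matrix n n ℂ} (hG : G.PosDef) (hR : R.PosDef) :
    (R⁻¹ * G * R⁻¹).PosDef := by
  have h1 : (R⁻¹)ᴴ = R⁻¹ := hR.inv.isHermitian
  have := hG.conjTranspose_mul_mul_same (B := R⁻¹)
    (Matrix.mulVec_injective_of_isUnit hR.inv.isUnit)
  rwa [h1] at this

/-- With `R = √G₂` and `Q = √(R⁻¹ G₁ R⁻¹)` the polar matrix is `R⁻¹ Q R`. So `G₂` times it is `R Q
R`, which is positive, and the transformed form is `R Q² R = G₁`. -/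
theorem polar_spec (h1 : G₁.PosDef) (h2 : G₂.PosDef) :
    (polar G₁ G₂)ᴴ * G₂ * polar G₁ G₂ = G₁ ∧ (G₂ * polar G₁ G₂).PosDef := by
  obtain ⟨hR, hRR⟩ := sqrt_posDef h2
  obtain ⟨hQ, hQQ⟩ := sqrt_posDef (posDef_conj h1 hR)
  unfold polar
  set R := CFC.sqrt G₂
  set Q := CFC.sqrt (R⁻¹ * G₁ * R⁻¹)
  have hRdet : IsUnit R.det := (Matrix.isUnit_iff_isUnit_det R).1 hR.isUnit
  have hRH : Rᴴ = R := hR.isHermitian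
  have hQH : Qᴴ = Q := hQ.isHermitian
  have e : G₂ * (R⁻¹ * Q * R) = R * Q * R := by
    rw [← hRR]
    simp only [Matrix.mul_assoc, Matrix.mul_nonsing_inv_cancel_left _ _ hRdet]
  constructor
  · rw [Matrix.mul_assoc, e]
    simp only [Matrix.conjTranspose_mul, Matrix.conjTranspose_nonsing_inv, hRH, hQH,
      Matrix.mul_assoc, Matrix.nonsing_inv_mul_cancel_left _ _ hRdet]
    rw [← Matrix.mul_assoc Q Q, hQQ]
    simp only [Matrix.mul_assoc, Matrix.mul_nonsing_inv_cancel_left _ _ hRdet,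
      Matrix.nonsing_inv_mul _ hRdet, Matrix.mul_one]
  · rw [e]
    have := hQ.conjTranspose_mul_mul_same (B := R) (Matrix.mulVec_injective_of_isUnit hR.isUnit)
    rwa [hRH] at this

/-- Conjugation by `R = √G₂` turns `A` into a positive matrix with square `R⁻¹ G₁ R⁻¹`, and positive
square roots are unique. The behaviour under change of basis and complex conjugation follows from
this characterization. -/
theorem polar_unique (h2 : G₂.PosDef) {A : Matrix n n ℂ}
    (hA : Aᴴ * G₂ * A = G₁) (hp : (G₂ * A).PosSemidef) : polar G₁ G₂ = A := by
  obtain ⟨hR, hRR⟩ := sqrt_posDef h2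
  unfold polar
  set R := CFC.sqrt G₂
  have hRdet : IsUnit R.det := (Matrix.isUnit_iff_isUnit_det R).1 hR.isUnit
  have hRH : Rᴴ = R := hR.isHermitian
  have hRiH : (R⁻¹)ᴴ = R⁻¹ := hR.inv.isHermitian
  have hpos : (R * A * R⁻¹).PosSemidef := by
    have := hp.conjTranspose_mul_mul_same R⁻¹
    rw [hRiH, ← hRR] at this
    simpa only [Matrix.mul_assoc, Matrix.nonsing_inv_mul_cancel_left _ _ hRdet] using this
  have hsq : R * A * R⁻¹ * (R * A * R⁻¹) = R⁻¹ * G₁ * R⁻¹ := by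
    have h3 := hpos.isHermitian.eq
    nth_rewrite 1 [← h3]
    simp only [Matrix.conjTranspose_mul, hRiH, hRH, ← hA, ← hRR, Matrix.mul_assoc]
  rw [CFC.sqrt_unique hsq hpos.nonneg]
  simp only [Matrix.mul_assoc, Matrix.nonsing_inv_mul_cancel_left _ _ hRdet,
    Matrix.nonsing_inv_mul _ hRdet, Matrix.mul_one]

/-- The conjugated matrix satisfies the characterization in `polar_unique`. Hence the endomorphism
represented by the polar matrix does not depend on the basis. -/
theorem polar_conj (h1 : G₁.PosDef) (h2 : G₂.PosDef) {P : Matrix n n ℂ} (hP : IsUnit P) :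
    polar (Pᴴ * G₁ * P) (Pᴴ * G₂ * P) = P⁻¹ * polar G₁ G₂ * P := by
  obtain ⟨e1, e2⟩ := polar_spec h1 h2
  have hdet : IsUnit P.det := (Matrix.isUnit_iff_isUnit_det P).1 hP
  refine polar_unique (h2.conjTranspose_mul_mul_same (Matrix.mulVec_injective_of_isUnit hP)) ?_ ?_
  · have hdet' : IsUnit Pᴴ.det := by
      rw [Matrix.det_conjTranspose]
      exact hdet.star
    simp only [Matrix.conjTranspose_mul, Matrix.conjTranspose_nonsing_inv, Matrix.mul_assoc,
      Matrix.mul_nonsing_inv_cancel_left _ _ hdet, Matrix.nonsing_inv_mul_cancel_left _ _ hdet']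
    rw [← Matrix.mul_assoc G₂, ← Matrix.mul_assoc (polar G₁ G₂)ᴴ, ← Matrix.mul_assoc _ G₂, e1]
  · have := e2.posSemidef.conjTranspose_mul_mul_same P
    simpa only [Matrix.mul_assoc, Matrix.mul_nonsing_inv_cancel_left _ _ hdet] using this

theorem isUnit_polar (h1 : G₁.PosDef) (h2 : G₂.PosDef) : IsUnit (polar G₁ G₂) := by
  obtain ⟨-, e2⟩ := polar_spec h1 h2
  exact isUnit_of_mul_isUnit_right e2.isUnit

/-- For real `G₁` and `G₂` the complex conjugate of the polar matrix satisfies the same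
characterization. A real polar matrix does not change the real span of a frame. -/
theorem polar_real (h1 : G₁.PosDef) (h2 : G₂.PosDef) (r1 : G₁.map (starRingEnd ℂ) = G₁)
    (r2 : G₂.map (starRingEnd ℂ) = G₂) :
    (polar G₁ G₂).map (starRingEnd ℂ) = polar G₁ G₂ := by
  obtain ⟨e1, e2⟩ := polar_spec h1 h2
  symm
  refine polar_unique h2 ?_ ?_
  · have := congrArg (fun M : Matrix n n ℂ => M.map (starRingEnd ℂ)) e1
    simp only [Matrix.map_mul, r1, r2] at this
    exact this
  · have := e2.posSemidef.transpose
    have e3 : (G₂ * polar G₁ G₂)ᵀ = (G₂ * polar G₁ G₂).map (starRingEnd ℂ) := by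
      conv_rhs => rw [← e2.isHermitian.eq]
      ext i j
      rw [Matrix.map_apply, Matrix.conjTranspose_apply, Matrix.transpose_apply, ← starRingEnd_apply,
        starRingEnd_self_apply]
    rw [e3, Matrix.map_mul, r2] at this
    exact this

end

theorem continuousAt_polar {X : Type*} [TopologicalSpace X] {G₁ G₂ : X → Matrix n n ℂ} {x₀ : X}
    (h1 : ContinuousAt G₁ x₀) (h2 : ContinuousAt G₂ x₀) (p1 : ∀ᶠ x in nhds x₀, (G₁ x).PosDef)
    (p2 : ∀ᶠ x in nhds x₀, (G₂ x).PosDef) : ContinuousAt (fun x => polar (G₁ x) (G₂ x)) x₀ := by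
  have hR := continuousAt_sqrt h2 p2
  have hRi : ContinuousAt (fun x => (CFC.sqrt (G₂ x))⁻¹) x₀ := by
    have hd : (CFC.sqrt (G₂ x₀)).det ≠ 0 :=
      ((Matrix.isUnit_iff_isUnit_det _).1 (sqrt_posDef p2.self_of_nhds).1.isUnit).ne_zero
    have h3 : ContinuousAt Ring.inverse (CFC.sqrt (G₂ x₀)).det :=
      NormedRing.inverse_continuousAt (Units.mk0 _ hd)
    exact ContinuousAt.comp (f := fun x => CFC.sqrt (G₂ x)) (continuousAt_matrix_inv _ h3) hR
  exact (hRi.mul (continuousAt_sqrt ((hRi.mul h1).mul hRi) (by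
    filter_upwards [p1, p2] with x hx hx'
    exact posDef_conj hx (sqrt_posDef hx').1))).mul hR

end PolarMatrix

end DoubleCover

/-! ### Compatible forms, Gram matrices and Lagrangian subspaces -/

namespace DoubleCover

open Topology SymProd

section Hermitian

open Matrix
open scoped ComplexOrder ComplexConjugate

variable {V : Type*} [AddCommGroup V] [Module ℂ V]

/-- An alternating real bilinear form compatible with the complex structure. -/
structure IsCompatible (Ω : V →ₗ[ℝ] V →ₗ[ℝ] ℝ) : Prop where
  alternating : ∀ v, Ω v v = 0
  invariant : ∀ v w, Ω (Complex.I • v) (Complex.I • w) = Ω v w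
  positive : ∀ v, v ≠ 0 → 0 < Ω v (Complex.I • v)

/-- The hermitian form with imaginary part `Ω`, conjugate linear in the first variable. -/
noncomputable def herm (Ω : V →ₗ[ℝ] V →ₗ[ℝ] ℝ) (v w : V) : ℂ := ⟨Ω v (Complex.I • w), Ω v w⟩

theorem complex_smul_eq (c : ℂ) (v : V) : c • v = c.re • v + c.im • (Complex.I • v) := by
  have h : ∀ (r : ℝ) (w : V), r • w = (r : ℂ) • w := fun r w => (Complex.coe_smul r w).symm
  rw [h, h, smul_smul, ← add_smul, Complex.re_add_im]

namespace IsCompatible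

variable {Ω : V →ₗ[ℝ] V →ₗ[ℝ] ℝ}

theorem neg (hΩ : IsCompatible Ω) (v w : V) : Ω w v = -Ω v w := by
  have := hΩ.alternating (v + w)
  simp only [map_add, LinearMap.add_apply, hΩ.alternating] at this
  linarith

theorem herm_symm (hΩ : IsCompatible Ω) (v w : V) : herm Ω w v = conj (herm Ω v w) := by
  apply Complex.ext
  · simp only [herm, Complex.conj_re]
    have h := hΩ.invariant w (Complex.I • v)
    rw [smul_smul, Complex.I_mul_I, neg_one_smul, map_neg, hΩ.neg v] at h
    linarith
  · simp only [herm, Complex.conj_im]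
    exact hΩ.neg v w

theorem herm_self_pos (hΩ : IsCompatible Ω) {v : V} (hv : v ≠ 0) : 0 < herm Ω v v := by
  rw [Complex.pos_iff]
  exact ⟨hΩ.positive v hv, (hΩ.alternating v).symm⟩

end IsCompatible

theorem herm_add_right (Ω : V →ₗ[ℝ] V →ₗ[ℝ] ℝ) (v w w' : V) :
    herm Ω v (w + w') = herm Ω v w + herm Ω v w' := by
  apply Complex.ext <;> simp [herm]

theorem herm_smul_right (Ω : V →ₗ[ℝ] V →ₗ[ℝ] ℝ) (c : ℂ) (v w : V) :
    herm Ω v (c • w) = c * herm Ω v w := by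
  have h1 : Complex.I • c • w = c.re • (Complex.I • w) + (-c.im) • w := by
    rw [smul_comm, complex_smul_eq, smul_smul Complex.I, Complex.I_mul_I, neg_one_smul]
    simp
  have h2 := complex_smul_eq c w
  apply Complex.ext
  · simp only [herm, Complex.mul_re]
    rw [h1, map_add, (Ω v).map_smul c.re, (Ω v).map_smul (-c.im), smul_eq_mul, smul_eq_mul]
    ring
  · simp only [herm, Complex.mul_im]
    rw [h2, map_add, (Ω v).map_smul c.re, (Ω v).map_smul c.im, smul_eq_mul, smul_eq_mul]

theorem herm_sum_right {ι : Type*} (s : Finset ι) (Ω : V →ₗ[ℝ] V →ₗ[ℝ] ℝ) (v : V) (w : ι → V) :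
    herm Ω v (∑ i ∈ s, w i) = ∑ i ∈ s, herm Ω v (w i) := by
  classical
  induction s using Finset.induction_on with
  | empty => apply Complex.ext <;> simp [herm]
  | insert i s hi ih => rw [Finset.sum_insert hi, Finset.sum_insert hi, herm_add_right, ih]

variable {ι : Type*} [Fintype ι] {Ω : V →ₗ[ℝ] V →ₗ[ℝ] ℝ}

theorem IsCompatible.herm_sum_smul (hΩ : IsCompatible Ω) (X Y : ι → V) (a b : ι → ℂ) :
    herm Ω (∑ i, a i • X i) (∑ j, b j • Y j) = ∑ i, ∑ j, conj (a i) * b j * herm Ω (X i) (Y j) := by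
  rw [herm_sum_right, Finset.sum_comm]
  refine Finset.sum_congr rfl fun j _ => ?_
  rw [herm_smul_right, hΩ.herm_symm, herm_sum_right, map_sum, Finset.mul_sum]
  refine Finset.sum_congr rfl fun i _ => ?_
  rw [herm_smul_right, map_mul, ← hΩ.herm_symm]
  ring

/-- The Gram matrix of a family of vectors. -/
noncomputable def gram (Ω : V →ₗ[ℝ] V →ₗ[ℝ] ℝ) (X : ι → V) : Matrix ι ι ℂ :=
  Matrix.of fun i j => herm Ω (X i) (X j)

theorem IsCompatible.gram_posDef (hΩ : IsCompatible Ω) {X : ι → V}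
    (hX : LinearIndependent ℂ X) : (gram Ω X).PosDef := by
  refine Matrix.PosDef.of_dotProduct_mulVec_pos ?_ fun a ha => ?_
  · ext i j
    exact (hΩ.herm_symm _ _).symm
  · have h1 : ∑ i, a i • X i ≠ 0 := by
      intro h
      exact ha (funext (Fintype.linearIndependent_iff.1 hX a h))
    have h2 := hΩ.herm_self_pos h1
    rw [hΩ.herm_sum_smul] at h2
    refine h2.trans_eq ?_
    simp only [dotProduct, mulVec, gram, Pi.star_apply, Finset.mul_sum, Matrix.of_apply]
    refine Finset.sum_congr rfl fun i _ => Finset.sum_congr rfl fun j _ => ?_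
    rw [starRingEnd_apply]
    ring

theorem IsCompatible.gram_conj (hΩ : IsCompatible Ω) (X : ι → V) (P : Matrix ι ι ℂ) :
    gram Ω (fun j => ∑ i, P i j • X i) = Pᴴ * gram Ω X * P := by
  ext i j
  simp only [gram, Matrix.of_apply, hΩ.herm_sum_smul, Matrix.mul_apply, Finset.sum_mul,
    Matrix.conjTranspose_apply]
  rw [Finset.sum_comm]
  refine Finset.sum_congr rfl fun k _ => Finset.sum_congr rfl fun l _ => ?_
  rw [starRingEnd_apply]
  ring

/-- The imaginary part of the hermitian form is `Ω`. Isotropy of a frame is thereby a property of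
its Gram matrix alone, which polar decomposition can prescribe. -/
theorem gram_real_iff {ι : Type*} {Ω : V →ₗ[ℝ] V →ₗ[ℝ] ℝ} {X : ι → V} :
    (gram Ω X).map (starRingEnd ℂ) = gram Ω X ↔ ∀ i j, Ω (X i) (X j) = 0 := by
  constructor
  · intro h i j
    have := congrFun (congrFun h i) j
    exact Complex.conj_eq_iff_im.1 this
  · intro h
    ext i j
    exact Complex.conj_eq_iff_im.2 (h i j)

/-- The real span of a complex basis consisting of pairwise orthogonal vectors is Lagrangian. -/
theorem IsCompatible.isLagrangian (hΩ : IsCompatible Ω) {X : ι → V} {E : Submodule ℝ V}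
    (hE : ∀ v, v ∈ E ↔ v ∈ Submodule.span ℂ (Set.range X)) (h0 : ∀ i j, Ω (X i) (X j) = 0) :
    IsLagrangian E Ω (Submodule.span ℝ (Set.range X)) := by
  have hW : ∀ v ∈ Submodule.span ℝ (Set.range X), ∀ w ∈ Submodule.span ℝ (Set.range X),
      Ω v w = 0 := by
    intro v hv w hw
    induction hv, hw using Submodule.span_induction₂ with
    | mem_mem x y hx hy =>
      obtain ⟨i, rfl⟩ := hx
      obtain ⟨j, rfl⟩ := hy
      exact h0 i j
    | zero_left y hy => simp
    | zero_right x hx => simp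
    | add_left x y z _ _ _ h1 h2 => simp [h1, h2]
    | add_right x y z _ _ _ h1 h2 => simp [h1, h2]
    | smul_left r x y _ _ h => simp [h]
    | smul_right r x y _ _ h => simp [h]
  intro v
  constructor
  · intro hv
    exact ⟨(hE v).2 (Submodule.span_le_restrictScalars ℝ ℂ _ hv), hW v hv⟩
  · rintro ⟨hv, hvW⟩
    obtain ⟨c, rfl⟩ := (Submodule.mem_span_range_iff_exists_fun ℂ).1 ((hE v).1 hv)
    have hmem : ∀ r : ι → ℝ, ∑ i, r i • X i ∈ Submodule.span ℝ (Set.range X) := fun r =>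
      Submodule.sum_mem _ fun i _ => Submodule.smul_mem _ _ (Submodule.subset_span ⟨i, rfl⟩)
    set a := ∑ i, (c i).re • X i with ha
    set b := ∑ i, (c i).im • X i with hb
    have e : ∑ i, c i • X i = a + Complex.I • b := by
      rw [ha, hb, Finset.smul_sum, ← Finset.sum_add_distrib]
      refine Finset.sum_congr rfl fun i _ => ?_
      rw [complex_smul_eq (c i), smul_comm Complex.I]
    -- For `v = a + i b` with `a`, `b` in the real span, pairing with `b` leaves `-Ω (b, i b)`,
    -- which vanishes only for `b = 0`.
    have h1 := hvW b (hmem _)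
    rw [e, map_add, LinearMap.add_apply, hW a (hmem _) b (hmem _), zero_add, hΩ.neg] at h1
    have h2 : b = 0 := by
      by_contra hb0
      have := hΩ.positive b hb0
      linarith
    rw [e, h2, smul_zero, add_zero]
    exact hmem _

end Hermitian

end DoubleCover

/-! ### Continuous sections along maps into the symmetric product -/

namespace DoubleCover

open Topology SymProd

section Sections

open scoped ComplexConjugate Pointwise

variable {S : Type*} [TopologicalSpace S] [T2Space S] [ChartedSpace ℂ S] [IsManifold 𝓘(ℂ) ω S]
  {n : ℕ} {X : Type*} [TopologicalSpace X] {F : X → Sym S n} {x₀ : X}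

/-- Continuity at a point of a section along `F` of the tangent bundle of the symmetric product. -/
def ContSec (F : X → Sym S n) (v : X → Fin n → ℂ) (x₀ : X) : Prop :=
  ContinuousAt (fun x => (⟨F x, v x⟩ : TangentBundle 𝓘(ℂ, Fin n → ℂ) (Sym S n))) x₀

theorem contSec_iff {v : X → Fin n → ℂ} : ContSec F v x₀ ↔
    ContinuousAt F x₀ ∧ ∀ h : S → ℂ, HolNear h (F x₀) →
      ContinuousAt (fun x => dSum h (F x) (v x)) x₀ :=
  continuousAt_section_iff

theorem contSec_iff_dChart {v : X → Fin n → ℂ} {D₀ : Sym S n}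
    (hD : F x₀ ∈ (chartAt (Fin n → ℂ) D₀).source) : ContSec F v x₀ ↔
      ContinuousAt F x₀ ∧ ContinuousAt (fun x => dChart D₀ (F x) (v x)) x₀ :=
  continuousAt_section_iff_dChart hD

theorem ContSec.continuousAt {v : X → Fin n → ℂ} (h : ContSec F v x₀) : ContinuousAt F x₀ :=
  (contSec_iff.1 h).1

theorem ContSec.congr {v w : X → Fin n → ℂ} (h : ContSec F v x₀) (e : v =ᶠ[𝓝 x₀] w) :
    ContSec F w x₀ :=
  ContinuousAt.congr h (by filter_upwards [e] with x hx; rw [hx])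

theorem ContSec.sum_smul {ι : Type*} [Fintype ι] {Y : ι → X → Fin n → ℂ} {a : ι → X → ℂ}
    (hF : ContinuousAt F x₀) (hY : ∀ i, ContSec F (Y i) x₀) (ha : ∀ i, ContinuousAt (a i) x₀) :
    ContSec F (fun x => ∑ i, a i x • Y i x) x₀ := by
  refine contSec_iff.2 ⟨hF, fun h hh => ?_⟩
  simp only [map_sum, map_smul, smul_eq_mul]
  exact tendsto_finsetSum _ fun i _ => (ha i).mul ((contSec_iff.1 (hY i)).2 h hh)

theorem ContSec.smul {v : X → Fin n → ℂ} {a : X → ℂ} (hv : ContSec F v x₀)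
    (ha : ContinuousAt a x₀) : ContSec F (fun x => a x • v x) x₀ := by
  have := ContSec.sum_smul (ι := Unit) hv.continuousAt (fun _ => hv) fun _ => ha
  simpa using this

theorem ContSec.comp {Z : Type*} [TopologicalSpace Z] {v : X → Fin n → ℂ} {f : Z → X} {z₀ : Z}
    (hv : ContSec F v (f z₀)) (hf : ContinuousAt f z₀) :
    ContSec (fun z => F (f z)) (fun z => v (f z)) z₀ :=
  ContinuousAt.comp (f := f) hv hf

/-- The coefficients of a continuous section with respect to a continuous frame are continuous. -/
theorem ContSec.coeff {ι : Type*} [Fintype ι] {Y : ι → X → Fin n → ℂ} {a : ι → X → ℂ}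
    (hY : ∀ i, ContSec F (Y i) x₀) (hli : LinearIndependent ℂ fun i => Y i x₀)
    (hs : ContSec F (fun x => ∑ i, a i x • Y i x) x₀) (i : ι) : ContinuousAt (a i) x₀ := by
  classical
  have hD := ChartedSpace.mem_chart_source (H := Fin n → ℂ) (F x₀)
  have hY' : ∀ i, ContinuousAt (fun x => dChart (F x₀) (F x) (Y i x)) x₀ := fun i =>
    ((contSec_iff_dChart hD).1 (hY i)).2
  have hs' := ((contSec_iff_dChart hD).1 hs).2
  have hli' : LinearIndependent ℂ fun i => dChart (F x₀) (F x₀) (Y i x₀) :=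
    hli.map' (dChart (F x₀) (F x₀)).toLinearMap
      (LinearMap.ker_eq_bot.2 (dChart_injective hD))
  -- The frame may have fewer than `n` vectors, so a left inverse `L` of the frame at `x₀` is used.
  -- The matrix `N x` of the frame at `x` followed by `L` is `1` at `x₀`, hence invertible nearby,
  -- and its inverse recovers the coefficients.
  obtain ⟨L, hL⟩ := LinearMap.exists_leftInverse_of_injective
    (Fintype.linearCombination ℂ fun i => dChart (F x₀) (F x₀) (Y i x₀))
    (LinearMap.ker_eq_bot.2 (linearIndependent_iff_injective_fintypeLinearCombination.1 hli'))
  have hLc : Continuous L := L.continuous_of_finiteDimensional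
  let N (x : X) : Matrix ι ι ℂ := Matrix.of fun i j => L (dChart (F x₀) (F x) (Y j x)) i
  have hN : ContinuousAt N x₀ := continuousAt_pi.2 fun i => continuousAt_pi.2 fun j =>
    (continuous_apply i).continuousAt.comp (hLc.continuousAt.comp (hY' j))
  have hN0 : N x₀ = 1 := by
    ext i j
    have := congrFun (LinearMap.congr_fun hL (Pi.single j 1)) i
    simp only [LinearMap.comp_apply, Fintype.linearCombination_apply_single, one_smul,
      LinearMap.id_apply] at this
    rw [Matrix.one_apply]
    simpa [N, Pi.single_apply] using this
  have hNa : ∀ x, (N x).mulVec (fun j => a j x) =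
      L (dChart (F x₀) (F x) (∑ i, a i x • Y i x)) := by
    intro x
    ext i
    simp only [map_sum, map_smul, Finset.sum_apply, Pi.smul_apply, smul_eq_mul, Matrix.mulVec,
      dotProduct, N, Matrix.of_apply]
    exact Finset.sum_congr rfl fun j _ => mul_comm _ _
  have hdet : ContinuousAt (fun x => (N x).det) x₀ :=
    (Continuous.matrix_det continuous_id).continuousAt.comp hN
  have hev : ∀ᶠ x in 𝓝 x₀, IsUnit (N x).det := by
    filter_upwards [hdet.eventually_ne (show (N x₀).det ≠ 0 by simp [hN0])] with x hx
    exact isUnit_iff_ne_zero.2 hx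
  have hinv : ContinuousAt (fun x => (N x)⁻¹) x₀ := by
    have hd : (N x₀).det ≠ 0 := by simp [hN0]
    have h3 : ContinuousAt Ring.inverse ((Units.mk0 _ hd : ℂˣ) : ℂ) :=
      NormedRing.inverse_continuousAt (Units.mk0 _ hd)
    exact ContinuousAt.comp (f := N) (continuousAt_matrix_inv _ h3) hN
  have hfin : ContinuousAt (fun x => ((N x)⁻¹).mulVec
      (L (dChart (F x₀) (F x) (∑ i, a i x • Y i x))) i) x₀ := by
    simp only [Matrix.mulVec, dotProduct]
    refine tendsto_finsetSum _ fun j _ => ContinuousAt.mul ?_ ?_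
    · exact continuousAt_pi.1 (continuousAt_pi.1 hinv i) j
    · exact (continuous_apply j).continuousAt.comp (hLc.continuousAt.comp hs')
  refine hfin.congr ?_
  filter_upwards [hev] with x hx
  rw [← hNa, Matrix.mulVec_mulVec, Matrix.nonsing_inv_mul _ hx, Matrix.one_mulVec]

/-- Local frames of the tangent bundle of the symmetric product. -/
theorem exists_frame (D₀ : Sym S n) : ∃ e : Fin n → Sym S n → Fin n → ℂ,
    ∀ D ∈ (chartAt (Fin n → ℂ) D₀).source, (∀ i, ContSec id (e i) D) ∧
      (LinearIndependent ℂ fun i => e i D) ∧ ∀ v, v = ∑ i, dChart D₀ D v i • e i D := by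
  have h1 : ∀ i : Fin n, ∀ D ∈ (chartAt (Fin n → ℂ) D₀).source,
      ∃ w : Fin n → ℂ, dChart D₀ D w = Pi.single i 1 := fun i D hD =>
    LinearMap.surjective_of_injective (f := (dChart D₀ D).toLinearMap) (dChart_injective hD) _
  choose! e he using h1
  refine ⟨e, fun D hD => ⟨fun i => (contSec_iff_dChart hD).2 ⟨continuousAt_id, ?_⟩, ?_, ?_⟩⟩
  · refine (continuousAt_const (y := (Pi.single i 1 : Fin n → ℂ))).congr ?_
    filter_upwards [(chartAt (Fin n → ℂ) D₀).open_source.mem_nhds hD] with E hE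
    exact (he i E hE).symm
  · refine LinearIndependent.of_comp (dChart D₀ D).toLinearMap ?_
    have : ((dChart D₀ D).toLinearMap ∘ fun i => e i D) = fun i => Pi.single i (1 : ℂ) :=
      funext fun i => he i D hD
    rw [this]
    exact Pi.linearIndependent_single_one (Fin n) ℂ
  · intro v
    refine dChart_injective hD ?_
    simp only [map_sum, map_smul, he _ D hD]
    ext i
    simp [Pi.single_apply]

section Forms

variable {form : ∀ D : Sym S n, SymTangent S n D →ₗ[ℝ] SymTangent S n D →ₗ[ℝ] ℝ}

theorem IsCompatibleForm.isCompatible (hform : IsCompatibleForm form) (D : Sym S n) :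
    IsCompatible (form D) :=
  ⟨hform.alternating D, hform.invariant D, hform.positive D⟩

theorem continuousAt_complex_mk {f g : X → ℝ} (hf : ContinuousAt f x₀) (hg : ContinuousAt g x₀) :
    ContinuousAt (fun x => (⟨f x, g x⟩ : ℂ)) x₀ :=
  Complex.equivRealProdCLM.symm.continuous.continuousAt.comp (hf.prodMk hg)

/-- A compatible form is continuous on continuous sections along maps. -/
theorem IsCompatibleForm.continuousAt_herm (hform : IsCompatibleForm form) {v w : X → Fin n → ℂ}
    (hv : ContSec F v x₀) (hw : ContSec F w x₀) :
    ContinuousAt (fun x => herm (form (F x)) (v x) (w x)) x₀ := by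
  have hD := ChartedSpace.mem_chart_source (H := Fin n → ℂ) (F x₀)
  -- Continuity of the form is given for sections over `Sym` itself. Sections along `F` are reduced
  -- to these by expanding them in a local frame, with the chart components as coefficients.
  obtain ⟨e, he⟩ := exists_frame (F x₀)
  have hc : ∀ i j, ContinuousAt (fun D => herm (form D) (e i D) (e j D)) (F x₀) := by
    intro i j
    refine continuousAt_complex_mk ?_ ?_
    · exact hform.continuous (e i) (fun D => Complex.I • e j D) (F x₀) ((he _ hD).1 i)
        (((he _ hD).1 j).smul continuousAt_const)
    · exact hform.continuous (e i) (e j) (F x₀) ((he _ hD).1 i) ((he _ hD).1 j)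
  have hv' := continuousAt_pi.1 ((contSec_iff_dChart hD).1 hv).2
  have hw' := continuousAt_pi.1 ((contSec_iff_dChart hD).1 hw).2
  have hsum : ContinuousAt (fun x => ∑ i, ∑ j, conj (dChart (F x₀) (F x) (v x) i) *
      dChart (F x₀) (F x) (w x) j * herm (form (F x)) (e i (F x)) (e j (F x))) x₀ := by
    refine tendsto_finsetSum _ fun i _ => tendsto_finsetSum _ fun j _ => ?_
    refine ContinuousAt.mul (ContinuousAt.mul ?_ (hw' j)) ?_
    · exact Complex.continuous_conj.continuousAt.comp (hv' i)
    · exact ContinuousAt.comp (f := F) (hc i j) hv.continuousAt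
  refine hsum.congr ?_
  filter_upwards [hv.continuousAt.eventually
    ((chartAt (Fin n → ℂ) (F x₀)).open_source.mem_nhds hD)] with x hx
  have h1 := (hform.isCompatible (F x)).herm_sum_smul (fun i => e i (F x)) (fun i => e i (F x))
    (dChart (F x₀) (F x) (v x)) (dChart (F x₀) (F x) (w x))
  rw [← h1]
  congr 1
  · exact ((he _ hx).2.2 (v x)).symm
  · exact ((he _ hx).2.2 (w x)).symm

end Forms

/-- The real basis `X₁, …, X_g, i X₁, …, i X_g` underlying a complex basis. -/
noncomputable def realFrame {g : ℕ} {V : Type*} [AddCommGroup V] [Module ℂ V] (s : Fin g → V)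
    (i : Fin (2 * g)) : V :=
  Complex.basisOneI (finProdFinEquiv.symm i).1 • s (finProdFinEquiv.symm i).2

theorem linearIndependent_realFrame {g : ℕ} {V : Type*} [AddCommGroup V] [Module ℂ V]
    {s : Fin g → V} (hs : LinearIndependent ℂ s) : LinearIndependent ℝ (realFrame s) :=
  (linearIndependent_smul Complex.basisOneI.linearIndependent hs).comp
    (finProdFinEquiv.symm : Fin (2 * g) ≃ Fin 2 × Fin g) (Equiv.injective _)

theorem span_realFrame {g : ℕ} {V : Type*} [AddCommGroup V] [Module ℂ V] (s : Fin g → V) :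
    Submodule.span ℝ (Set.range (realFrame s)) =
      (Submodule.span ℂ (Set.range s)).restrictScalars ℝ := by
  rw [← Submodule.span_smul_of_span_eq_top Complex.basisOneI.span_eq]
  congr 1
  ext v
  rw [Set.mem_smul]
  constructor
  · rintro ⟨i, rfl⟩
    exact ⟨_, ⟨_, rfl⟩, _, ⟨_, rfl⟩, rfl⟩
  · rintro ⟨_, ⟨i, rfl⟩, _, ⟨j, rfl⟩, rfl⟩
    exact ⟨finProdFinEquiv (i, j), by simp [realFrame]⟩

/-- A family of complex subspaces with local continuous complex frames is a real subbundle. -/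
theorem isSubbundle_of_complex {g : ℕ} {W : ∀ x, Submodule ℝ (SymTangent S n (F x))}
    (h : ∀ x₀, ∃ U ∈ 𝓝 x₀, ∃ s : Fin g → X → Fin n → ℂ, ∀ x ∈ U, (∀ i, ContSec F (s i) x) ∧
      (LinearIndependent ℂ fun i => s i x) ∧
      ∀ v : Fin n → ℂ, v ∈ W x ↔ v ∈ Submodule.span ℂ (Set.range fun i => s i x)) :
    IsSubbundle (Fin n → ℂ) (2 * g) W := by
  intro x₀
  obtain ⟨U, hU, s, hs⟩ := h x₀
  refine ⟨U, hU, fun i x => realFrame (fun j => s j x) i, fun i x hx => ?_, fun x hx => ⟨?_, ?_⟩⟩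
  · exact ContinuousAt.continuousWithinAt
      (ContSec.smul ((hs x hx).1 _) continuousAt_const)
  · exact linearIndependent_realFrame (V := Fin n → ℂ) (hs x hx).2.1
  · refine Submodule.ext fun v => Iff.trans ?_ ((hs x hx).2.2 v).symm
    have := span_realFrame (V := Fin n → ℂ) fun j => s j x
    exact (congrArg (fun W : Submodule ℝ (Fin n → ℂ) => v ∈ W) this).to_iff

end Sections

end DoubleCover

/-! ### Odd locally constant approximations of a circle-valued function -/

namespace DoubleCover

open Topology SymProd

section

variable {A B : Type*} [TopologicalSpace A] {π : A → B}

/-- The function `v` is near `a` constant, odd, and close to `u`. -/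
def GoodAt (π : A → B) (u v : A → ℂ) (a : A) : Prop :=
  ∀ᶠ b in 𝓝 a, v b = v a ∧ v (deck π b) = -v b ∧ ‖v b - u b‖ < 1 / 2

theorem GoodAt.eventually {u v : A → ℂ} {a : A} (h : GoodAt π u v a) :
    ∀ᶠ b in 𝓝 a, GoodAt π u v b := by
  filter_upwards [eventually_eventually_nhds.2 h, h] with b hb hb'
  filter_upwards [hb] with c hc
  exact ⟨hc.1.trans hb'.1.symm, hc.2⟩

end

namespace IsHolDoubleCover

variable {A B : Type*} [TopologicalSpace A] [T2Space A] [ChartedSpace ℂ A] [TopologicalSpace B]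
  [ChartedSpace ℂ B] {π : A → B} {g : ℕ}

/-- Being good at `a` is a condition on a neighbourhood of `a`, so it persists at nearby tuples.
These open sets form the cover to which the partition of unity is subordinate. -/
theorem isOpen_goodAt (hπ : IsHolDoubleCover π) (u v : A → ℂ) :
    IsOpen {D : Sym B g | ∀ a, π a ∈ D → GoodAt π u v a} := by
  rw [isOpen_iff_mem_nhds]
  intro D hD
  have : ∀ᶠ E in 𝓝 D, ∀ x ∈ E, ∀ a, π a = x → GoodAt π u v a :=
    eventually_forall_mem fun x hx => hπ.eventually_fibre fun a ha => (hD a (ha ▸ hx)).eventually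
  filter_upwards [this] with E hE a ha
  exact hE _ ha a rfl

/-- On disjoint neighbourhoods of the finitely many points of `π⁻¹ D` the function is frozen at the
value of `u` at the centre. Oddness is inherited from `u`, and closeness to `u` from continuity. -/
theorem exists_goodAt (hπ : IsHolDoubleCover π) {u : A → ℂ} (hu : Continuous u)
    (hodd : ∀ a, u (deck π a) = -u a) (D : Sym B g) :
    ∃ v : A → ℂ, ∀ a, π a ∈ D → GoodAt π u v a := by
  classical
  have hfin := (pullbackSym π hπ.ncard g D).1.toFinset.finite_toSet
  have hmem : ∀ a, a ∈ (pullbackSym π hπ.ncard g D).1.toFinset ↔ π a ∈ D := fun a =>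
    Multiset.mem_toFinset.trans (mem_pullbackSym hπ.ncard)
  obtain ⟨U, hU, hUd⟩ := hfin.t2_separation
  let v (b : A) : ℂ :=
    ∑ a ∈ (pullbackSym π hπ.ncard g D).1.toFinset, (U a).indicator (fun _ => u a) b
  have hv : ∀ a, π a ∈ D → ∀ᶠ b in 𝓝 a, v b = u a := by
    intro a ha
    filter_upwards [(hU a).2.mem_nhds (hU a).1] with b hb
    refine (Finset.sum_eq_single a (fun a' ha' hne => ?_) fun h => absurd ((hmem a).2 ha) h).trans
      (Set.indicator_of_mem hb _)
    refine Set.indicator_of_notMem (fun hb' => ?_) _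
    exact Set.disjoint_left.1 (hUd ha' ((hmem a).2 ha) hne) hb' hb
  refine ⟨v, fun a ha => ?_⟩
  have h1 : ∀ᶠ b in 𝓝 a, v (deck π b) = u (deck π a) :=
    (hπ.mdifferentiableAt_deck a).continuousAt.eventually
      (hv _ (by rw [(deck_spec hπ.ncard a).1]; exact ha))
  have h2 : ∀ᶠ b in 𝓝 a, ‖u a - u b‖ < 1 / 2 := by
    refine ((continuous_const.sub hu).norm.tendsto a).eventually (gt_mem_nhds ?_)
    simp
  filter_upwards [hv a ha, h1, h2] with b hb1 hb2 hb3
  rw [hb1, (hv a ha).self_of_nhds, hb2, hodd]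
  exact ⟨rfl, rfl, hb3⟩

/-- Averaging odd locally constant functions close to `u` by a partition of unity. -/
theorem exists_twisting_functions [T2Space B] [LocallyCompactSpace (Sym B g)] [T2Space (Sym B g)]
    [SigmaCompactSpace (Sym B g)] (hπ : IsHolDoubleCover π) {u : A → ℂ}
    (hu : Continuous u) (hodd : ∀ a, u (deck π a) = -u a) : ∃ V : Sym B g → A → ℂ,
      (∀ D a, π a ∈ D → GoodAt π u (V D) a) ∧
      ∀ D₀, ∃ (J : Finset (Sym B g)) (c : Sym B g → Sym B g → ℝ) (v : Sym B g → A → ℂ),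
        (∀ j, Continuous (c j)) ∧ (∀ j ∈ J, ∀ a, π a ∈ D₀ → ∀ᶠ b in 𝓝 a, v j b = v j a) ∧
        ∀ᶠ D in 𝓝 D₀, V D = fun b => ∑ j ∈ J, (c j D : ℂ) * v j b := by
  choose v hv using fun D : Sym B g => hπ.exists_goodAt hu hodd D
  -- Being locally constant, odd and within `1/2` of `u` are convex conditions, so convex
  -- combinations of good functions are good.
  obtain ⟨ρ, hρ⟩ := PartitionOfUnity.exists_isSubordinate (isClosed_univ (X := Sym B g))
    (fun D₀ => {D : Sym B g | ∀ a, π a ∈ D → GoodAt π u (v D₀) a})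
    (fun D₀ => hπ.isOpen_goodAt u (v D₀)) fun D _ => Set.mem_iUnion.2 ⟨D, hv D⟩
  have hgood : ∀ D, ∀ i ∈ ρ.fintsupport D, ∀ a, π a ∈ D → GoodAt π u (v i) a := fun D i hi =>
    hρ i ((ρ.mem_fintsupport_iff D i).1 hi)
  refine ⟨fun D b => ∑ i ∈ ρ.finsupport D, (ρ i D : ℂ) * v i b, ?_, ?_⟩
  · intro D a ha
    have h1 : ∀ᶠ b in 𝓝 a, ∀ i ∈ ρ.finsupport D,
        v i b = v i a ∧ v i (deck π b) = -v i b ∧ ‖v i b - u b‖ < 1 / 2 := by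
      rw [Filter.eventually_all_finset]
      exact fun i hi => hgood D i (ρ.finsupport_subset_fintsupport D hi) a ha
    have hsum : ∑ i ∈ ρ.finsupport D, ρ i D = 1 := ρ.sum_finsupport (Set.mem_univ D)
    filter_upwards [h1] with b hb
    refine ⟨Finset.sum_congr rfl fun i hi => by rw [(hb i hi).1], ?_, ?_⟩
    · rw [← Finset.sum_neg_distrib]
      exact Finset.sum_congr rfl fun i hi => by rw [(hb i hi).2.1, mul_neg]
    · have e : ∑ i ∈ ρ.finsupport D, (ρ i D : ℂ) * v i b - u b =
          ∑ i ∈ ρ.finsupport D, (ρ i D : ℂ) * (v i b - u b) := by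
        simp only [mul_sub, Finset.sum_sub_distrib, ← Finset.sum_mul]
        rw [← Complex.ofReal_sum, hsum, Complex.ofReal_one, one_mul]
      rw [e]
      refine (norm_sum_le _ _).trans_lt ?_
      have hlt : ∑ i ∈ ρ.finsupport D, ‖(ρ i D : ℂ) * (v i b - u b)‖ <
          ∑ i ∈ ρ.finsupport D, ρ i D * (1 / 2) := by
        refine Finset.sum_lt_sum_of_nonempty ?_ fun i hi => ?_
        · by_contra hne
          rw [Finset.not_nonempty_iff_eq_empty.1 hne] at hsum
          simp at hsum
        · rw [norm_mul, Complex.norm_real, Real.norm_of_nonneg (ρ.nonneg i D)]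
          refine mul_lt_mul_of_pos_left (hb i hi).2.2 ?_
          exact lt_of_le_of_ne (ρ.nonneg i D) (Ne.symm ((ρ.mem_finsupport D).1 hi))
      rwa [← Finset.sum_mul, hsum, one_mul] at hlt
  · intro D₀
    -- Near `D₀` only the finitely many indices whose support closes up at `D₀` contribute. So `V D`
    -- is there a combination of fixed functions, and only the coefficients vary with `D`.
    refine ⟨ρ.fintsupport D₀, fun j D => ρ j D, v, fun j => (ρ j).continuous, fun j hj a ha => ?_,
      ?_⟩
    · filter_upwards [hgood D₀ j hj a ha] with b hb
      exact hb.1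
    · filter_upwards [ρ.eventually_finsupport_subset D₀] with D hD
      ext b
      refine Finset.sum_subset hD fun i _ hi => ?_
      have : ρ i D = 0 := by
        by_contra h
        exact hi ((ρ.mem_finsupport D).2 h)
      rw [this]
      simp

end IsHolDoubleCover

end DoubleCover

/-! ### The polar map between compatible forms -/

namespace DoubleCover

open Topology SymProd

section PolarMap

open Matrix

variable {V : Type*} [AddCommGroup V] [Module ℂ V] {ι : Type*} [Fintype ι] [DecidableEq ι]

/-- The positive endomorphism that transforms the compatible form `Ω₂` to `Ω₁`. -/
noncomputable def polarMap (b : Module.Basis ι ℂ V) (Ω₁ Ω₂ : V →ₗ[ℝ] V →ₗ[ℝ] ℝ) : V →ₗ[ℂ] V :=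
  Matrix.toLin b b (polar (gram Ω₁ b) (gram Ω₂ b))

variable {b : Module.Basis ι ℂ V} {Ω₁ Ω₂ : V →ₗ[ℝ] V →ₗ[ℝ] ℝ}

/-- The matrix of the polar map with respect to an arbitrary frame. -/
theorem polarMap_apply (h1 : IsCompatible Ω₁) (h2 : IsCompatible Ω₂) {X : ι → V}
    (hX : LinearIndependent ℂ X) (j : ι) :
    polarMap b Ω₁ Ω₂ (X j) = ∑ i, polar (gram Ω₁ X) (gram Ω₂ X) i j • X i := by
  let P : Matrix ι ι ℂ := b.toMatrix X
  have hXP : X = fun j => ∑ i, P i j • b i := funext fun j => (b.sum_toMatrix_smul_self X j).symm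
  have hP : IsUnit P := by
    have : FiniteDimensional ℂ V := b.finiteDimensional_of_finite
    let c : Module.Basis ι ℂ V := basisOfLinearIndependentOfCardEqFinrank' X hX
      (Module.finrank_eq_card_basis b).symm
    have hc : (c : ι → V) = X := coe_basisOfLinearIndependentOfCardEqFinrank' _ _ _
    have := b.invertibleToMatrix c
    rw [hc] at this
    exact isUnit_of_invertible P
  have hdet : IsUnit P.det := (Matrix.isUnit_iff_isUnit_det P).1 hP
  have hg : ∀ Ω : V →ₗ[ℝ] V →ₗ[ℝ] ℝ, IsCompatible Ω →
      gram Ω X = Pᴴ * gram Ω b * P := by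
    intro Ω hΩ
    rw [← hΩ.gram_conj, ← hXP]
  -- Both Gram matrices change by the same congruence with `P`, so the polar matrix changes by
  -- conjugation, as the matrix of an endomorphism does.
  have hp := polar_conj (h1.gram_posDef b.linearIndependent) (h2.gram_posDef b.linearIndependent) hP
  rw [← hg Ω₁ h1, ← hg Ω₂ h2] at hp
  set Q := polar (gram Ω₁ b) (gram Ω₂ b) with hQ
  set R := polar (gram Ω₁ X) (gram Ω₂ X)
  have hPR : P * R = Q * P := by
    rw [hp, Matrix.mul_assoc, Matrix.mul_nonsing_inv_cancel_left _ _ hdet]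
  have hl : polarMap b Ω₁ Ω₂ (X j) = ∑ k, (Q * P) k j • b k := by
    have e : X j = ∑ i, P i j • b i := congrFun hXP j
    rw [e, map_sum]
    simp only [map_smul, polarMap, Matrix.toLin_self, ← hQ, Matrix.mul_apply, Finset.smul_sum,
      Finset.sum_smul, smul_smul]
    rw [Finset.sum_comm]
    exact Finset.sum_congr rfl fun k _ => Finset.sum_congr rfl fun i _ => by rw [mul_comm]
  have hr : ∑ i, R i j • X i = ∑ k, (P * R) k j • b k := by
    rw [hXP]
    simp only [Matrix.mul_apply, Finset.smul_sum, Finset.sum_smul, smul_smul]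
    rw [Finset.sum_comm]
    exact Finset.sum_congr rfl fun k _ => Finset.sum_congr rfl fun i _ => by rw [mul_comm]
  rw [hl, hr, hPR]

theorem polarMap_injective (h1 : IsCompatible Ω₁) (h2 : IsCompatible Ω₂) :
    Function.Injective (polarMap b Ω₁ Ω₂) := by
  have hu := isUnit_polar (h1.gram_posDef b.linearIndependent) (h2.gram_posDef b.linearIndependent)
  have hdet := (Matrix.isUnit_iff_isUnit_det _).1 hu
  refine Function.LeftInverse.injective
    (g := Matrix.toLin b b (polar (gram Ω₁ b) (gram Ω₂ b))⁻¹) fun v => ?_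
  rw [polarMap, ← LinearMap.comp_apply, ← Matrix.toLin_mul, Matrix.nonsing_inv_mul _ hdet,
    Matrix.toLin_one, LinearMap.id_apply]

/-- The polar map carries the basis to a frame whose Gram matrix for `Ω₂` is that of the basis for
`Ω₁`. It is complex linear, so the hermitian forms correspond, and the claim is the equality of
their imaginary parts. -/
theorem polarMap_form (h1 : IsCompatible Ω₁) (h2 : IsCompatible Ω₂) (v w : V) :
    Ω₂ (polarMap b Ω₁ Ω₂ v) (polarMap b Ω₁ Ω₂ w) = Ω₁ v w := by
  have hs := polar_spec (h1.gram_posDef b.linearIndependent) (h2.gram_posDef b.linearIndependent)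
  set Q := polar (gram Ω₁ b) (gram Ω₂ b) with hQ
  have hb : (fun j => polarMap b Ω₁ Ω₂ (b j)) = fun j => ∑ i, Q i j • b i :=
    funext fun j => polarMap_apply h1 h2 b.linearIndependent j
  have hg : gram Ω₂ (fun j => polarMap b Ω₁ Ω₂ (b j)) = gram Ω₁ b := by
    rw [hb, h2.gram_conj, hs.1]
  have hh : herm Ω₂ (polarMap b Ω₁ Ω₂ v) (polarMap b Ω₁ Ω₂ w) = herm Ω₁ v w := by
    rw [← b.sum_repr v, ← b.sum_repr w]
    simp only [map_sum, map_smul]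
    rw [h2.herm_sum_smul, h1.herm_sum_smul]
    refine Finset.sum_congr rfl fun i _ => Finset.sum_congr rfl fun j _ => ?_
    have := congrFun (congrFun hg i) j
    simp only [gram, Matrix.of_apply] at this
    rw [this]
  exact congrArg Complex.im hh

/-- The pullback of a compatible form by an injective complex linear map. -/
theorem IsCompatible.comp {W : Type*} [AddCommGroup W] [Module ℂ W] {Ω : V →ₗ[ℝ] V →ₗ[ℝ] ℝ}
    (hΩ : IsCompatible Ω) {f : W →ₗ[ℂ] V} (hf : Function.Injective f) :
    IsCompatible (Ω.compl₁₂ (f.restrictScalars ℝ) (f.restrictScalars ℝ)) where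
  alternating v := hΩ.alternating (f v)
  invariant v w := by
    simp only [LinearMap.compl₁₂_apply, LinearMap.coe_restrictScalars, map_smul]
    exact hΩ.invariant _ _
  positive v hv := by
    simp only [LinearMap.compl₁₂_apply, LinearMap.coe_restrictScalars, map_smul]
    exact hΩ.positive _ fun h => hv (hf (by rw [h, map_zero]))

end PolarMap

/-! ### The twist from the tangent bundle to the normal bundle -/

section Twist

variable {A B : Type*} [TopologicalSpace A] [T2Space A] [ChartedSpace ℂ A] [TopologicalSpace B]
  [ChartedSpace ℂ B] [IsManifold 𝓘(ℂ) ω A] [T2Space B] [IsManifold 𝓘(ℂ) ω B]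
  {π : A → B} {g : ℕ} {X : Type*} [TopologicalSpace X]

theorem contSec_iff_coeff {S : Type*} [TopologicalSpace S] [T2Space S] [ChartedSpace ℂ S]
    [IsManifold 𝓘(ℂ) ω S] {n : ℕ} {F : X → Sym S n} {x₀ : X} {ι : Type*} [Fintype ι]
    {Y : ι → X → Fin n → ℂ} {a : ι → X → ℂ} (hY : ∀ i, ContSec F (Y i) x₀)
    (hF : ContinuousAt F x₀) (hli : LinearIndependent ℂ fun i => Y i x₀) :
    ContSec F (fun x => ∑ i, a i x • Y i x) x₀ ↔ ∀ i, ContinuousAt (a i) x₀ :=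
  ⟨fun h => ContSec.coeff hY hli h, fun h => ContSec.sum_smul hF hY h⟩

theorem IsHolDoubleCover.contSec_dPull (hπ : IsHolDoubleCover π) {G : X → Sym B g}
    {v : X → Fin g → ℂ} {x₀ : X} (hv : ContSec G v x₀) :
    ContSec (fun x => pullbackSym π hπ.ncard g (G x)) (fun x => hπ.dPull (G x) (v x)) x₀ := by
  have hc : ContinuousAt (fun x => pullbackSym π hπ.ncard g (G x)) x₀ :=
    hπ.continuous_pullbackSym.continuousAt.comp hv.continuousAt
  refine contSec_iff.2 ⟨hc, fun h hh => ?_⟩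
  refine ((contSec_iff.1 hv).2 _ (hπ.holNear_trace hh)).congr ?_
  filter_upwards [hc.eventually hh.eventually] with x hx
  exact (hπ.dSum_dPull hx (v x)).symm

/-- A continuous family of complex linear isomorphisms `Θ` of the tangent spaces of `Symᵍ B` with the
`-1`-eigenspaces of the involution of `Sym²ᵍ A`, given by multiplication by the odd locally constant
functions `V D`, which are close to `u`. -/
structure IsTwist (hπ : IsHolDoubleCover π) (u : A → ℂ) (V : Sym B g → A → ℂ)
    (Θ : Sym B g → (Fin g → ℂ) →L[ℂ] (Fin (2 * g) → ℂ)) : Prop where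
  good : ∀ D a, π a ∈ D → GoodAt π u (V D) a
  injective : ∀ D, Function.Injective (Θ D)
  mem_iff : ∀ D (w : Fin (2 * g) → ℂ),
    w ∈ antiInvariant π (2 * g) (pullbackSym π hπ.ncard g D) ↔ ∃ v, Θ D v = w
  dSum_eq : ∀ D (h : A → ℂ), HolNear h (pullbackSym π hπ.ncard g D) → ∀ v,
    dSum h (pullbackSym π hπ.ncard g D) (Θ D v) =
      dSum (fun a => V D a * h a) (pullbackSym π hπ.ncard g D) (hπ.dPull D v)
  locally_sum : ∀ D₀, ∃ (J : Finset (Sym B g)) (c : Sym B g → Sym B g → ℝ)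
    (v : Sym B g → A → ℂ), (∀ j, Continuous (c j)) ∧
      (∀ j ∈ J, ∀ a, π a ∈ D₀ → ∀ᶠ b in 𝓝 a, v j b = v j a) ∧
      ∀ᶠ D in 𝓝 D₀, V D = fun b => ∑ j ∈ J, (c j D : ℂ) * v j b

/-- `Θ D` may be chosen separately for each `D`: by `dSum_eq` it is determined by `V D`, and its
continuity comes from that of the averaged functions. -/
theorem IsHolDoubleCover.exists_isTwist [LocallyCompactSpace (Sym B g)] [T2Space (Sym B g)]
    [SigmaCompactSpace (Sym B g)] (hπ : IsHolDoubleCover π) {u : A → ℂ} (hu : Continuous u)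
    (hodd : ∀ a, u (deck π a) = -u a) (h1 : ∀ a, ‖u a‖ = 1) :
    ∃ (V : Sym B g → A → ℂ) (Θ : Sym B g → (Fin g → ℂ) →L[ℂ] (Fin (2 * g) → ℂ)),
      IsTwist hπ u V Θ := by
  obtain ⟨V, hV, hloc⟩ := hπ.exists_twisting_functions (g := g) hu hodd
  -- A value within `1/2` of a number of modulus `1` is not zero.
  have hne : ∀ D a, π a ∈ D → V D a ≠ 0 := by
    intro D a ha h
    have := (hV D a ha).self_of_nhds.2.2
    rw [h, zero_sub, norm_neg, h1] at this
    norm_num at this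
  choose Θ hΘ using fun D => hπ.exists_twist D
    (fun a ha => (hV D a ha).mono fun b hb => hb.1)
    (fun a ha => (hV D a ha).self_of_nhds.2.1) (hne D)
  exact ⟨V, Θ, hV, fun D => (hΘ D).1, fun D => (hΘ D).2.1, fun D => (hΘ D).2.2, hloc⟩

namespace IsTwist

variable {hπ : IsHolDoubleCover π} {u : A → ℂ} {V : Sym B g → A → ℂ}
  {Θ : Sym B g → (Fin g → ℂ) →L[ℂ] (Fin (2 * g) → ℂ)}

/-- Tested on `h`, the twisted section is locally a finite sum of continuous coefficients times
differentials of the fixed sums of `w j * h`. These products are holomorphic near the relevant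
points, since `w j` is locally constant there. -/
theorem contSec (hΘ : IsTwist hπ u V Θ) {G : X → Sym B g} {v : X → Fin g → ℂ} {x₀ : X}
    (hv : ContSec G v x₀) :
    ContSec (fun x => pullbackSym π hπ.ncard g (G x)) (fun x => Θ (G x) (v x)) x₀ := by
  have hc : ContinuousAt (fun x => pullbackSym π hπ.ncard g (G x)) x₀ :=
    hπ.continuous_pullbackSym.continuousAt.comp hv.continuousAt
  obtain ⟨J, c, w, hcc, hw, hV⟩ := hΘ.locally_sum (G x₀)
  refine contSec_iff.2 ⟨hc, fun h hh => ?_⟩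
  have hwh : ∀ j ∈ J, HolNear (fun a => w j a * h a) (pullbackSym π hπ.ncard g (G x₀)) :=
    fun j hj a ha => ((holAt_const (w j a) a).congr
      (hw j hj a ((mem_pullbackSym hπ.ncard).1 ha))).mul (hh a ha)
  have hd : ∀ j ∈ J, ContinuousAt (fun x => dSum (fun a => w j a * h a)
      (pullbackSym π hπ.ncard g (G x)) (hπ.dPull (G x) (v x))) x₀ := fun j hj =>
    (contSec_iff.1 (hπ.contSec_dPull hv)).2 _ (hwh j hj)
  have hs : ContinuousAt (fun x => ∑ j ∈ J, (c j (G x) : ℂ) * dSum (fun a => w j a * h a)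
      (pullbackSym π hπ.ncard g (G x)) (hπ.dPull (G x) (v x))) x₀ :=
    tendsto_finsetSum _ fun j hj => ContinuousAt.mul
      (Complex.continuous_ofReal.continuousAt.comp
        ((hcc j).continuousAt.comp hv.continuousAt)) (hd j hj)
  have hev : ∀ᶠ x in 𝓝 x₀, ∀ j ∈ J,
      HolNear (fun a => w j a * h a) (pullbackSym π hπ.ncard g (G x)) := by
    rw [Filter.eventually_all_finset]
    exact fun j hj => hc.eventually (hwh j hj).eventually
  refine hs.congr ?_
  filter_upwards [hev, hc.eventually hh.eventually, hv.continuousAt.eventually hV] with x hx hx' hx''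
  rw [hΘ.dSum_eq _ _ hx', hx'']
  have e : (fun a => (∑ j ∈ J, (c j (G x) : ℂ) * w j a) * h a) =
      fun a => ∑ j ∈ J, (c j (G x) : ℂ) * (w j a * h a) := by
    ext a
    rw [Finset.sum_mul]
    exact Finset.sum_congr rfl fun j _ => mul_assoc _ _ _
  rw [e, dSum_sum fun j hj a ha => (holAt_const _ a).mul (hx j hj a ha), sum_apply]
  refine Finset.sum_congr rfl fun j hj => ?_
  rw [dSum_const_mul _ (hx j hj)]
  rfl

end IsTwist

end Twist

end DoubleCover

/-! ### Subbundles from frames, polar frames and homotopies of Lagrangians -/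

namespace DoubleCover

open Topology SymProd
open scoped ComplexOrder

theorem exists_linearEquiv_of_injective {V W : Type*} [AddCommGroup V] [Module ℂ V]
    [FiniteDimensional ℂ V] [AddCommGroup W] [Module ℂ W] {f : V →ₗ[ℂ] W}
    (hf : Function.Injective f) {E : Submodule ℝ W} (hE : ∀ w, w ∈ E ↔ ∃ v, f v = w)
    {T : V →ₗ[ℂ] V} (hT : Function.Injective T) :
    ∃ φ : E ≃ₗ[ℝ] (⊤ : Submodule ℝ V), ∀ v (h : f v ∈ E), (φ ⟨f v, h⟩ : V) = T v := by
  let f' : V →ₗ[ℝ] E := (f.restrictScalars ℝ).codRestrict E fun v => (hE _).2 ⟨v, rfl⟩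
  have hf' : Function.Bijective f' := by
    refine ⟨fun a b h => hf (congrArg Subtype.val h), fun w => ?_⟩
    obtain ⟨v, hv⟩ := (hE w).1 w.2
    exact ⟨v, Subtype.ext hv⟩
  let e1 := LinearEquiv.ofBijective f' hf'
  have hTb : Function.Bijective (T.restrictScalars ℝ) :=
    ⟨hT, LinearMap.surjective_of_injective hT⟩
  refine ⟨e1.symm.trans ((LinearEquiv.ofBijective _ hTb).trans Submodule.topEquiv.symm),
    fun v h => ?_⟩
  have : e1.symm ⟨f v, h⟩ = v := by
    rw [LinearEquiv.symm_apply_eq]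
    rfl
  change T (e1.symm ⟨f v, h⟩) = T v
  rw [this]

section Subbundles

variable {S : Type*} [TopologicalSpace S] [T2Space S] [ChartedSpace ℂ S] [IsManifold 𝓘(ℂ) ω S]
  {n : ℕ} {X : Type*} [TopologicalSpace X] {F : X → Sym S n}

theorem linearIndependent_real {ι V : Type*} [AddCommGroup V] [Module ℂ V] {v : ι → V}
    (h : LinearIndependent ℂ v) : LinearIndependent ℝ v :=
  h.restrict_scalars' ℝ

theorem span_eq_top_of_linearIndependent {X : Fin n → Fin n → ℂ} (hX : LinearIndependent ℂ X) :
    Submodule.span ℂ (Set.range X) = ⊤ :=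
  hX.span_eq_top_of_card_eq_finrank' (by simp)

theorem mem_span_of_linearIndependent {X : Fin n → Fin n → ℂ} (hX : LinearIndependent ℂ X)
    (v : Fin n → ℂ) : v ∈ Submodule.span ℂ (Set.range X) := by
  rw [span_eq_top_of_linearIndependent hX]
  trivial

/-- A family of real subspaces spanned by a continuous frame is a subbundle. -/
theorem isSubbundle_of_frame {k : ℕ} {W : ∀ x, Submodule ℝ (SymTangent S n (F x))}
    {s : Fin k → X → Fin n → ℂ} (h1 : ∀ i x, ContSec F (s i) x)
    (h2 : ∀ x, LinearIndependent ℂ fun i => s i x)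
    (h3 : ∀ x, W x = Submodule.span ℝ (Set.range fun i => (s i x : SymTangent S n (F x)))) :
    IsSubbundle (Fin n → ℂ) k W := fun _ =>
  ⟨Set.univ, Filter.univ_mem, s, fun i x _ => (h1 i x).continuousWithinAt, fun x _ =>
    ⟨linearIndependent_real (V := SymTangent S n (F x)) (h2 x), (h3 x).symm⟩⟩

end Subbundles

theorem linearIndependent_mulMatrix {K V ι : Type*} [Field K] [AddCommGroup V]
    [Module K V] [Fintype ι] [DecidableEq ι] {P : Matrix ι ι K} {X : ι → V}
    (hP : IsUnit P) (hX : LinearIndependent K X) :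
    LinearIndependent K fun j => ∑ i, P i j • X i := by
  rw [Fintype.linearIndependent_iff] at hX ⊢
  intro a ha
  have h1 : ∑ i, (P.mulVec a) i • X i = 0 := by
    rw [← ha]
    simp only [Matrix.mulVec, dotProduct, Finset.sum_smul, Finset.smul_sum, smul_smul]
    rw [Finset.sum_comm]
    exact Finset.sum_congr rfl fun _ _ => Finset.sum_congr rfl fun _ _ => by rw [mul_comm]
  have h2 : P.mulVec a = 0 := funext (hX _ h1)
  have h3 := Matrix.mulVec_injective_of_isUnit hP
  exact fun i => congrFun (h3 (h2.trans (Matrix.mulVec_zero P).symm)) i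

section Homotopy

variable {V : Type*} [AddCommGroup V] [Module ℂ V] {ι : Type*} [Fintype ι] [DecidableEq ι]

/-- The frame obtained from `X` by applying the positive matrix that transforms the Gram matrix of
`X` to `Γ`. -/
noncomputable def polarFrame (Ω : V →ₗ[ℝ] V →ₗ[ℝ] ℝ) (Γ : Matrix ι ι ℂ) (X : ι → V) (j : ι) : V :=
  ∑ i, polar Γ (gram Ω X) i j • X i

variable {Ω : V →ₗ[ℝ] V →ₗ[ℝ] ℝ} {Γ : Matrix ι ι ℂ} {X : ι → V}

theorem IsCompatible.gram_polarFrame (hΩ : IsCompatible Ω) (hΓ : Γ.PosDef)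
    (hX : LinearIndependent ℂ X) : gram Ω (polarFrame Ω Γ X) = Γ := by
  have := hΩ.gram_conj X (polar Γ (gram Ω X))
  rw [(polar_spec hΓ (hΩ.gram_posDef hX)).1] at this
  exact this

theorem IsCompatible.linearIndependent_polarFrame (hΩ : IsCompatible Ω) (hΓ : Γ.PosDef)
    (hX : LinearIndependent ℂ X) : LinearIndependent ℂ (polarFrame Ω Γ X) :=
  linearIndependent_mulMatrix (isUnit_polar hΓ (hΩ.gram_posDef hX)) hX

/-- If the Gram matrices are real then the polar frame spans the same real subspace. -/
theorem IsCompatible.span_polarFrame (hΩ : IsCompatible Ω) (hΓ : Γ.PosDef)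
    (hX : LinearIndependent ℂ X) (r1 : Γ.map (starRingEnd ℂ) = Γ)
    (r2 : (gram Ω X).map (starRingEnd ℂ) = gram Ω X) :
    Submodule.span ℝ (Set.range (polarFrame Ω Γ X)) = Submodule.span ℝ (Set.range X) := by
  have hG := hΩ.gram_posDef hX
  have hr := polar_real hΓ hG r1 r2
  -- The polar matrix is real, which gives one inclusion; both spans have the same real dimension.
  have hle : Submodule.span ℝ (Set.range (polarFrame Ω Γ X)) ≤ Submodule.span ℝ (Set.range X) := by
    rw [Submodule.span_le]
    rintro _ ⟨j, rfl⟩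
    refine Submodule.sum_mem _ fun i _ => ?_
    have h1 := Complex.conj_eq_iff_re.1 (congrFun (congrFun hr i) j)
    rw [← h1, Complex.coe_smul]
    exact Submodule.smul_mem _ _ (Submodule.subset_span ⟨i, rfl⟩)
  have hfin : FiniteDimensional ℝ (Submodule.span ℝ (Set.range X)) :=
    FiniteDimensional.span_of_finite ℝ (Set.finite_range X)
  refine Submodule.eq_of_le_of_finrank_eq hle ?_
  rw [finrank_span_eq_card (linearIndependent_real (hΩ.linearIndependent_polarFrame hΓ hX)),
    finrank_span_eq_card (linearIndependent_real hX)]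

end Homotopy

section Homotopy

variable {S : Type*} [TopologicalSpace S] [T2Space S] [ChartedSpace ℂ S] [IsManifold 𝓘(ℂ) ω S]
  {n : ℕ} {X : Type*} [TopologicalSpace X] {F : X → Sym S n}

theorem contSec_polarFrame {ι : Type*} [Fintype ι] [DecidableEq ι] {x₀ : X}
    {Ω : ∀ x, SymTangent S n (F x) →ₗ[ℝ] SymTangent S n (F x) →ₗ[ℝ] ℝ}
    (hΩ : ∀ x, IsCompatible (Ω x)) {Γ : X → Matrix ι ι ℂ} (hΓ : ∀ᶠ x in 𝓝 x₀, (Γ x).PosDef)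
    (hΓc : ContinuousAt Γ x₀) {Y : ι → X → Fin n → ℂ} (hY : ∀ i, ContSec F (Y i) x₀)
    (hF : ContinuousAt F x₀)
    (hli : ∀ᶠ x in 𝓝 x₀, LinearIndependent ℂ fun i => (Y i x : SymTangent S n (F x)))
    (hg : ∀ i j, ContinuousAt (fun x => herm (Ω x) (Y i x) (Y j x)) x₀) (j : ι) :
    ContSec F (fun x => polarFrame (V := SymTangent S n (F x)) (Ω x) (Γ x) (fun i => Y i x) j) x₀ := by
  have hG : ContinuousAt (fun x => gram (Ω x) fun i => (Y i x : SymTangent S n (F x))) x₀ :=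
    continuousAt_pi.2 fun i => continuousAt_pi.2 fun j => hg i j
  have hp := continuousAt_polar hΓc hG hΓ (hli.mono fun x hx => (hΩ x).gram_posDef hx)
  exact ContSec.sum_smul hF hY fun i => continuousAt_pi.1 (continuousAt_pi.1 hp i) j

/-- The homotopy of Lagrangian subbundles that rotates the vectors `exp (-λ k) X k` to `X k`. -/
theorem lagrangianHomotopic_of_frame {L : Set (Sym S n)}
    {Ω : ∀ D, SymTangent S n D →ₗ[ℝ] SymTangent S n D →ₗ[ℝ] ℝ} (hΩ : ∀ D, IsCompatible (Ω D))
    (hΩc : ∀ (v w : unitInterval × L → Fin n → ℂ) q₀, ContSec (fun q => (q.2 : Sym S n)) v q₀ →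
      ContSec (fun q => (q.2 : Sym S n)) w q₀ →
      ContinuousAt (fun q => herm (Ω q.2) (v q) (w q)) q₀)
    {Γ : L → Matrix (Fin n) (Fin n) ℂ} (hΓ : ∀ x, (Γ x).PosDef) (hΓc : Continuous Γ)
    (hΓr : ∀ x, (Γ x).map (starRingEnd ℂ) = Γ x)
    {Y : Fin n → L → Fin n → ℂ} (hY : ∀ i x, ContSec (Subtype.val : L → Sym S n) (Y i) x)
    (hli : ∀ x : L, LinearIndependent ℂ fun i => (Y i x : SymTangent S n x))
    (hY0 : ∀ (x : L) i j, Ω x (Y i x) (Y j x) = 0)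
    {l : Fin n → L → ℂ} (hl : ∀ i, Continuous (l i))
    {W₀ W₁ : ∀ D, Submodule ℝ (SymTangent S n D)}
    (hW₀ : ∀ x : L, W₀ x = Submodule.span ℝ (Set.range (polarFrame (V := SymTangent S n x)
      (Ω x) (Γ x) fun i => Complex.exp (-l i x) • Y i x)))
    (hW₁ : ∀ x : L, W₁ x = Submodule.span ℝ (Set.range fun i => (Y i x : SymTangent S n x))) :
    PolarizationData.LagrangianHomotopic (M := Sym S n) (f := id) (V := SymTangent S n) (Fin n → ℂ) n
      (fun _ => ⊤) Ω L W₀ W₁ := by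
  -- Scaling the logarithms `l` to zero moves the given frame to `Y`. The frames in between need not
  -- be isotropic, so each is replaced by its polar frame with Gram matrix `Γ`, whose entries are
  -- real.
  let Z (i : Fin n) (q : unitInterval × L) : Fin n → ℂ :=
    Complex.exp (-((1 - (q.1 : ℝ) : ℝ) : ℂ) * l i q.2) • Y i q.2
  have hZ : ∀ i q, ContSec (fun q : unitInterval × L => (q.2 : Sym S n)) (Z i) q := by
    intro i q
    have h1 : ContSec (fun q : unitInterval × L => (q.2 : Sym S n)) (fun q => Y i q.2) q :=
      ContSec.comp (f := Prod.snd) (hY i q.2) continuous_snd.continuousAt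
    refine h1.smul (Continuous.continuousAt ?_)
    have := hl i
    fun_prop
  have hZli : ∀ q, LinearIndependent ℂ fun i => (Z i q : SymTangent S n q.2) := fun q =>
    (hli q.2).units_smul fun i => Units.mk0 _ (Complex.exp_ne_zero _)
  have hF : Continuous fun q : unitInterval × L => (q.2 : Sym S n) :=
    continuous_subtype_val.comp continuous_snd
  have hP : ∀ q, LinearIndependent ℂ (polarFrame (V := SymTangent S n q.2) (Ω q.2) (Γ q.2)
      fun i => Z i q) := fun q => (hΩ q.2).linearIndependent_polarFrame (hΓ q.2) (hZli q)
  have hcard : ∀ q : unitInterval × L, Submodule.span ℂ (Set.range (polarFrame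
      (V := SymTangent S n q.2) (Ω q.2) (Γ q.2) fun i => Z i q)) = ⊤ := fun q =>
    span_eq_top_of_linearIndependent (hP q)
  refine ⟨fun q => Submodule.span ℝ (Set.range (polarFrame (V := SymTangent S n q.2)
    (Ω q.2) (Γ q.2) fun i => Z i q)), ?_, fun q => ?_, fun x => ?_, fun x => ?_⟩
  · refine isSubbundle_of_frame (S := S) (F := fun q : unitInterval × L => (q.2 : Sym S n))
      (s := fun j q => polarFrame (V := SymTangent S n q.2) (Ω q.2) (Γ q.2) (fun i => Z i q) j)
      (fun j q => ?_) hP fun q => rfl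
    exact contSec_polarFrame (F := fun q : unitInterval × L => (q.2 : Sym S n)) (fun q => hΩ q.2)
      (Filter.Eventually.of_forall fun q => hΓ q.2) (hΓc.comp continuous_snd).continuousAt
      (fun i => hZ i q) hF.continuousAt (Filter.Eventually.of_forall hZli) (fun i j => hΩc _ _ q (hZ i q) (hZ j q)) j
  · refine (hΩ q.2).isLagrangian (fun v => ?_) ?_
    · rw [hcard]
      simp
    · rw [← gram_real_iff, (hΩ q.2).gram_polarFrame (hΓ q.2) (hZli q), hΓr]
  · rw [hW₀]
    have : (fun i => Z i (0, x)) = fun i => Complex.exp (-l i x) • Y i x := by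
      funext i
      simp [Z]
    simp only [this]
  · rw [hW₁]
    have : (fun i => Z i (1, x)) = fun i => Y i x := by
      funext i
      simp [Z]
    simp only [this]
    -- At time `1` the frame is `Y`, which is isotropic, so its Gram matrix is real too and the
    -- polar correction does not change the real span.
    exact (hΩ x).span_polarFrame (hΓ x) (hli x) (hΓr x) (gram_real_iff.2 (hY0 x))

end Homotopy

end DoubleCover

/-! ### Pulled back forms and frames along a torus -/

namespace DoubleCover

open Topology SymProd
open scoped ComplexOrder

section

variable {V W : Type*} [AddCommGroup V] [Module ℂ V] [AddCommGroup W] [Module ℂ W]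

/-- The pullback of a real bilinear form under a complex linear map. -/
noncomputable def pullForm (Ω : V →ₗ[ℝ] V →ₗ[ℝ] ℝ) (f : W →ₗ[ℂ] V) : W →ₗ[ℝ] W →ₗ[ℝ] ℝ :=
  Ω.compl₁₂ (f.restrictScalars ℝ) (f.restrictScalars ℝ)

theorem herm_pullForm (Ω : V →ₗ[ℝ] V →ₗ[ℝ] ℝ) (f : W →ₗ[ℂ] V) (v w : W) :
    herm (pullForm Ω f) v w = herm Ω (f v) (f w) := by
  simp only [herm, pullForm, LinearMap.compl₁₂_apply, LinearMap.coe_restrictScalars, map_smul]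

theorem gram_pullForm {ι : Type*} (Ω : V →ₗ[ℝ] V →ₗ[ℝ] ℝ) (f : W →ₗ[ℂ] V) (X : ι → W) :
    gram (pullForm Ω f) X = gram Ω fun i => f (X i) := by
  ext i j
  exact herm_pullForm Ω f _ _

end

section

variable {A B : Type*} [TopologicalSpace A] [T2Space A] [ChartedSpace ℂ A] [TopologicalSpace B]
  [ChartedSpace ℂ B] [IsManifold 𝓘(ℂ) ω A] [T2Space B] [IsManifold 𝓘(ℂ) ω B]
  {π : A → B} {g : ℕ}

/-- The restriction of a form on `Sym²ᵍ A` to `Symᵍ B`. -/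
noncomputable def restrictForm (hπ : IsHolDoubleCover π)
    (form : ∀ D : Sym A (2 * g), SymTangent A (2 * g) D →ₗ[ℝ] SymTangent A (2 * g) D →ₗ[ℝ] ℝ)
    (D : Sym B g) : SymTangent B g D →ₗ[ℝ] SymTangent B g D →ₗ[ℝ] ℝ :=
  pullForm (V := SymTangent A (2 * g) (pullbackSym π hπ.ncard g D))
    (form (pullbackSym π hπ.ncard g D)) (hπ.dPull D).toLinearMap

/-- The form on `Symᵍ B` induced from the normal bundle by a twist. -/
noncomputable def twistForm (hπ : IsHolDoubleCover π)
    (form : ∀ D : Sym A (2 * g), SymTangent A (2 * g) D →ₗ[ℝ] SymTangent A (2 * g) D →ₗ[ℝ] ℝ)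
    (Θ : Sym B g → (Fin g → ℂ) →L[ℂ] (Fin (2 * g) → ℂ))
    (D : Sym B g) : SymTangent B g D →ₗ[ℝ] SymTangent B g D →ₗ[ℝ] ℝ :=
  pullForm (V := SymTangent A (2 * g) (pullbackSym π hπ.ncard g D))
    (form (pullbackSym π hπ.ncard g D)) (Θ D).toLinearMap

variable {hπ : IsHolDoubleCover π} {u : A → ℂ} {V : Sym B g → A → ℂ}
  {Θ : Sym B g → (Fin g → ℂ) →L[ℂ] (Fin (2 * g) → ℂ)}
  {form : ∀ D : Sym A (2 * g), SymTangent A (2 * g) D →ₗ[ℝ] SymTangent A (2 * g) D →ₗ[ℝ] ℝ}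

/-- The polarization data on the two sides along a torus `L`: frames `X` of `T L` and `Y` of the
normal bundle, related by the twist and the scalar functions `exp l`. -/
structure IsTorusFrame (hπ : IsHolDoubleCover π)
    (Θ : Sym B g → (Fin g → ℂ) →L[ℂ] (Fin (2 * g) → ℂ))
    (form : ∀ D : Sym A (2 * g), SymTangent A (2 * g) D →ₗ[ℝ] SymTangent A (2 * g) D →ₗ[ℝ] ℝ)
    (L : Set (Sym B g)) (FN : ∀ D, Submodule ℝ (SymTangent A (2 * g) (pullbackSym π hπ.ncard g D)))
    (FT : ∀ D, Submodule ℝ (SymTangent B g D)) (X : Fin g → L → Fin g → ℂ)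
    (Y : Fin g → L → Fin (2 * g) → ℂ) (l : Fin g → L → ℂ) : Prop where
  contSec : ∀ i x, ContSec (Subtype.val : L → Sym B g) (X i) x
  linearIndependent : ∀ x, LinearIndependent ℂ fun i => X i x
  twist : ∀ i (x : L), Θ x (X i x) = Complex.exp (l i x) • Y i x
  continuous : ∀ i, Continuous (l i)
  tangent_isotropic : ∀ (x : L) i j, restrictForm hπ form x (X i x) (X j x) = 0
  normal_isotropic : ∀ (x : L) i j, form (pullbackSym π hπ.ncard g x) (Y i x) (Y j x) = 0
  span_tangent : ∀ x : L, FT x =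
    Submodule.span ℝ (Set.range fun i => (X i x : SymTangent B g x))
  span_normal : ∀ x : L, FN x = Submodule.span ℝ
    (Set.range fun i => (Y i x : SymTangent A (2 * g) (pullbackSym π hπ.ncard g x)))

theorem restrictForm_isCompatible (hform : IsCompatibleForm form) (D : Sym B g) :
    IsCompatible (restrictForm hπ form D) :=
  (hform.isCompatible _).comp (hπ.dPull_injective D)

theorem continuousAt_herm_restrictForm (hform : IsCompatibleForm form) {Z : Type*}
    [TopologicalSpace Z] {G : Z → Sym B g} {v w : Z → Fin g → ℂ} {z₀ : Z} (hv : ContSec G v z₀)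
    (hw : ContSec G w z₀) :
    ContinuousAt (fun z => herm (restrictForm hπ form (G z)) (v z) (w z)) z₀ := by
  have := hform.continuousAt_herm (hπ.contSec_dPull hv) (hπ.contSec_dPull hw)
  refine this.congr (Filter.Eventually.of_forall fun z => ?_)
  exact (herm_pullForm (V := SymTangent A (2 * g) (pullbackSym π hπ.ncard g (G z)))
    (W := SymTangent B g (G z)) _ _ _ _).symm

namespace IsTwist

theorem twistForm_isCompatible (hΘ : IsTwist hπ u V Θ) (hform : IsCompatibleForm form)
    (D : Sym B g) : IsCompatible (twistForm hπ form Θ D) :=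
  (hform.isCompatible _).comp (hΘ.injective D)

theorem continuousAt_herm_twistForm (hΘ : IsTwist hπ u V Θ) (hform : IsCompatibleForm form)
    {Z : Type*} [TopologicalSpace Z] {G : Z → Sym B g} {v w : Z → Fin g → ℂ} {z₀ : Z}
    (hv : ContSec G v z₀) (hw : ContSec G w z₀) :
    ContinuousAt (fun z => herm (twistForm hπ form Θ (G z)) (v z) (w z)) z₀ := by
  have := hform.continuousAt_herm (hΘ.contSec hv) (hΘ.contSec hw)
  refine this.congr (Filter.Eventually.of_forall fun z => ?_)
  exact (herm_pullForm (V := SymTangent A (2 * g) (pullbackSym π hπ.ncard g (G z)))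
    (W := SymTangent B g (G z)) _ _ _ _).symm

theorem mem_span_iff (hΘ : IsTwist hπ u V Θ) {D : Sym B g} {X : Fin g → Fin g → ℂ}
    (hX : LinearIndependent ℂ X) (w : Fin (2 * g) → ℂ) :
    w ∈ antiInvariant π (2 * g) (pullbackSym π hπ.ncard g D) ↔
      w ∈ Submodule.span ℂ (Set.range fun i => Θ D (X i)) := by
  have h1 : Submodule.span ℂ (Set.range fun i => Θ D (X i)) = (Θ D).toLinearMap.range := by
    have : (Set.range fun i => Θ D (X i)) = (Θ D).toLinearMap '' Set.range X := by
      rw [← Set.range_comp]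
      rfl
    rw [this, Submodule.span_image, span_eq_top_of_linearIndependent hX, Submodule.map_top]
  rw [h1, LinearMap.mem_range]
  exact hΘ.mem_iff D w

end IsTwist

end

end DoubleCover

/-! ### Both triples are polarization data -/

namespace DoubleCover

open Topology SymProd
open scoped ComplexOrder

section

variable {A B : Type*} [TopologicalSpace A] [T2Space A] [ChartedSpace ℂ A] [TopologicalSpace B]
  [ChartedSpace ℂ B] [IsManifold 𝓘(ℂ) ω A] [T2Space B] [IsManifold 𝓘(ℂ) ω B]
  {π : A → B} {g : ℕ} {hπ : IsHolDoubleCover π} {u : A → ℂ} {V : Sym B g → A → ℂ}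
  {Θ : Sym B g → (Fin g → ℂ) →L[ℂ] (Fin (2 * g) → ℂ)}
  {form : ∀ D : Sym A (2 * g), SymTangent A (2 * g) D →ₗ[ℝ] SymTangent A (2 * g) D →ₗ[ℝ] ℝ}

section Frame

variable {L : Set (Sym B g)} {FN : ∀ D, Submodule ℝ (SymTangent A (2 * g) (pullbackSym π hπ.ncard g D))}
  {FT : ∀ D, Submodule ℝ (SymTangent B g D)} {X : Fin g → L → Fin g → ℂ}
  {Y : Fin g → L → Fin (2 * g) → ℂ} {l : Fin g → L → ℂ}

namespace IsTorusFrame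

theorem smul_twist (hL : IsTorusFrame hπ Θ form L FN FT X Y l) (i : Fin g) (x : L) :
    Y i x = Complex.exp (-l i x) • Θ x (X i x) := by
  rw [hL.twist, smul_smul, ← Complex.exp_add, neg_add_cancel, Complex.exp_zero, one_smul]

theorem contSec_normal (hΘ : IsTwist hπ u V Θ) (hL : IsTorusFrame hπ Θ form L FN FT X Y l)
    (i : Fin g) (x : L) : ContSec (fun x : L => pullbackSym π hπ.ncard g x) (Y i) x := by
  have := ContSec.smul (hΘ.contSec (hL.contSec i x))
    (((hL.continuous i).neg.cexp).continuousAt (x := x))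
  refine this.congr (Filter.Eventually.of_forall fun y => ?_)
  exact (hL.smul_twist i y).symm

theorem linearIndependent_normal (hΘ : IsTwist hπ u V Θ)
    (hL : IsTorusFrame hπ Θ form L FN FT X Y l) (x : L) :
    LinearIndependent ℂ fun i => Y i x := by
  have h1 : LinearIndependent ℂ fun i => Θ x (X i x) :=
    (hL.linearIndependent x).map' (Θ x).toLinearMap (LinearMap.ker_eq_bot.2 (hΘ.injective x))
  have h2 := h1.units_smul fun i => Units.mk0 _ (Complex.exp_ne_zero (-l i x))
  have e : (fun i => Y i x) = fun i => Complex.exp (-l i x) • Θ x (X i x) :=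
    funext fun i => hL.smul_twist i x
  rw [e]
  exact h2

theorem mem_span_normal (hΘ : IsTwist hπ u V Θ) (hL : IsTorusFrame hπ Θ form L FN FT X Y l)
    (x : L) (w : Fin (2 * g) → ℂ) :
    w ∈ antiInvariant π (2 * g) (pullbackSym π hπ.ncard g x) ↔
      w ∈ Submodule.span ℂ (Set.range fun i => Y i x) := by
  have h2 := (hL.linearIndependent x).units_smul
    fun i => Units.mk0 _ (Complex.exp_ne_zero (-l i x))
  have e : (fun i => Y i x) = fun i => Θ x (Complex.exp (-l i x) • X i x) :=
    funext fun i => by rw [hL.smul_twist i x, map_smul]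
  rw [e]
  exact hΘ.mem_span_iff h2 w

theorem isSubbundle_tangent (hL : IsTorusFrame hπ Θ form L FN FT X Y l) :
    IsSubbundle (V := SymTangent B g) (f := (Subtype.val : L → Sym B g)) (Fin g → ℂ) g
      fun x : L => FT x :=
  isSubbundle_of_frame hL.contSec hL.linearIndependent hL.span_tangent

theorem isSubbundle_normal (hΘ : IsTwist hπ u V Θ) (hL : IsTorusFrame hπ Θ form L FN FT X Y l) :
    IsSubbundle (V := SymTangent A (2 * g)) (f := fun x : L => pullbackSym π hπ.ncard g x)
      (Fin (2 * g) → ℂ) g fun x : L => FN x :=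
  isSubbundle_of_frame (hL.contSec_normal hΘ) (hL.linearIndependent_normal hΘ) hL.span_normal

theorem isLagrangian_tangent (hform : IsCompatibleForm form)
    (hL : IsTorusFrame hπ Θ form L FN FT X Y l) (x : L) :
    IsLagrangian ⊤ (restrictForm hπ form x) (FT x) := by
  rw [hL.span_tangent]
  refine (restrictForm_isCompatible hform _).isLagrangian (fun v => ?_) (hL.tangent_isotropic x)
  exact iff_of_true trivial (mem_span_of_linearIndependent (hL.linearIndependent x) v)

theorem isLagrangian_normal (hΘ : IsTwist hπ u V Θ) (hform : IsCompatibleForm form)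
    (hL : IsTorusFrame hπ Θ form L FN FT X Y l) (x : L) :
    IsLagrangian (antiInvariant π (2 * g) (pullbackSym π hπ.ncard g x))
      (form (pullbackSym π hπ.ncard g x)) (FN x) := by
  rw [hL.span_normal]
  exact (hform.isCompatible _).isLagrangian (hL.mem_span_normal hΘ x) (hL.normal_isotropic x)

end IsTorusFrame

end Frame

theorem continuousAt_form_of_herm {S : Type*} [TopologicalSpace S] [T2Space S]
    [ChartedSpace ℂ S] [IsManifold 𝓘(ℂ) ω S] {n : ℕ} {X : Type*} [TopologicalSpace X]
    {F : X → Sym S n} {x₀ : X}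
    {Ω : ∀ x, SymTangent S n (F x) →ₗ[ℝ] SymTangent S n (F x) →ₗ[ℝ] ℝ} {v w : X → Fin n → ℂ}
    (h : ContinuousAt (fun x => herm (Ω x) (v x) (w x)) x₀) :
    ContinuousAt (fun x => Ω x (v x) (w x)) x₀ :=
  Complex.continuous_im.continuousAt.comp h

variable {κ κ' : Type*} [Fintype κ] [Fintype κ'] {L₀ L₁ : Set (Sym B g)}
  {hκ : Fintype.card κ = 2 * g} {al bl : κ → ℝ → A} {hκ' : Fintype.card κ' = g} {a b : κ' → ℝ → B}
  {X₀ : Fin g → L₀ → Fin g → ℂ} {Y₀ : Fin g → L₀ → Fin (2 * g) → ℂ} {l₀ : Fin g → L₀ → ℂ}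
  {X₁ : Fin g → L₁ → Fin g → ℂ} {Y₁ : Fin g → L₁ → Fin (2 * g) → ℂ} {l₁ : Fin g → L₁ → ℂ}

theorem isPolarization_tangential (hform : IsCompatibleForm form)
    {FN₀ FN₁ : ∀ D, Submodule ℝ (SymTangent A (2 * g) (pullbackSym π hπ.ncard g D))}
    (h₀ : IsTorusFrame hπ Θ form L₀ FN₀ (torusTangent hκ' a) X₀ Y₀ l₀)
    (h₁ : IsTorusFrame hπ Θ form L₁ FN₁ (torusTangent hκ' b) X₁ Y₁ l₁)
    (ht : ∀ x ∈ L₀ ∩ L₁, torusTangent hκ' a x ⊓ torusTangent hκ' b x = ⊥) :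
    (tangentialPolarization π hπ.ncard form hκ' a b L₀ L₁).IsPolarization where
  continuous_base := continuous_id
  subbundle := by
    refine isSubbundle_of_complex fun D₀ => ?_
    obtain ⟨e, he⟩ := exists_frame D₀
    refine ⟨_, (chartAt (Fin g → ℂ) D₀).open_source.mem_nhds
      (ChartedSpace.mem_chart_source (H := Fin g → ℂ) D₀), e, fun D hD =>
      ⟨(he D hD).1, (he D hD).2.1, fun v => iff_of_true trivial
        (mem_span_of_linearIndependent (he D hD).2.1 v)⟩⟩
  continuous_form s s' x₀ _ _ hs hs' := continuousAt_form_of_herm (F := id)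
    (Ω := restrictForm hπ form) (continuousAt_herm_restrictForm (G := id) hform hs hs')
  alternating x v _ := (restrictForm_isCompatible (hπ := hπ) hform x).alternating v
  nondegenerate x v _ h := by
    by_contra hv
    have := (restrictForm_isCompatible (hπ := hπ) hform x).positive v hv
    exact this.ne' (h _ trivial)
  subbundle₀ := h₀.isSubbundle_tangent
  subbundle₁ := h₁.isSubbundle_tangent
  lagrangian₀ x hx := h₀.isLagrangian_tangent hform ⟨x, hx⟩
  lagrangian₁ x hx := h₁.isLagrangian_tangent hform ⟨x, hx⟩
  transverse := ht

theorem IsTwist.smul_mem (hΘ : IsTwist hπ u V Θ) {D : Sym B g} {w : Fin (2 * g) → ℂ}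
    (hw : w ∈ antiInvariant π (2 * g) (pullbackSym π hπ.ncard g D)) (c : ℂ) :
    c • w ∈ antiInvariant π (2 * g) (pullbackSym π hπ.ncard g D) := by
  obtain ⟨v, rfl⟩ := (hΘ.mem_iff D w).1 hw
  exact (hΘ.mem_iff D _).2 ⟨c • v, map_smul _ _ _⟩

theorem isPolarization_normal (hΘ : IsTwist hπ u V Θ) (hform : IsCompatibleForm form)
    {FT₀ FT₁ : ∀ D, Submodule ℝ (SymTangent B g D)}
    (h₀ : IsTorusFrame hπ Θ form L₀
      (normalPolarization π hπ.ncard form hκ al bl L₀ L₁).F₀ FT₀ X₀ Y₀ l₀)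
    (h₁ : IsTorusFrame hπ Θ form L₁
      (normalPolarization π hπ.ncard form hκ al bl L₀ L₁).F₁ FT₁ X₁ Y₁ l₁)
    (ht : ∀ x ∈ L₀ ∩ L₁, torusTangent hκ al (pullbackSym π hπ.ncard g x) ⊓
      torusTangent hκ bl (pullbackSym π hπ.ncard g x) = ⊥) :
    (normalPolarization π hπ.ncard form hκ al bl L₀ L₁).IsPolarization where
  continuous_base := hπ.continuous_pullbackSym
  subbundle := by
    refine isSubbundle_of_complex fun D₀ => ?_
    obtain ⟨e, he⟩ := exists_frame D₀
    refine ⟨_, (chartAt (Fin g → ℂ) D₀).open_source.mem_nhds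
      (ChartedSpace.mem_chart_source (H := Fin g → ℂ) D₀), fun i D => Θ D (e i D), fun D hD =>
      ⟨fun i => hΘ.contSec ((he D hD).1 i), ?_, hΘ.mem_span_iff (he D hD).2.1⟩⟩
    exact (he D hD).2.1.map' (Θ D).toLinearMap (LinearMap.ker_eq_bot.2 (hΘ.injective D))
  continuous_form s s' x₀ _ _ hs hs' := continuousAt_form_of_herm
    (Ω := fun x => form (pullbackSym π hπ.ncard g x)) (hform.continuousAt_herm hs hs')
  alternating x v _ := hform.alternating _ v
  nondegenerate x v hvE h := by
    by_contra hv
    -- The normal space is complex, so `i v` is an admissible test vector, and the form is positive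
    -- on `(v, i v)`.
    exact (hform.positive _ v hv).ne' (h _ (hΘ.smul_mem hvE Complex.I))
  subbundle₀ := h₀.isSubbundle_normal hΘ
  subbundle₁ := h₁.isSubbundle_normal hΘ
  lagrangian₀ x hx := h₀.isLagrangian_normal hΘ hform ⟨x, hx⟩
  lagrangian₁ x hx := h₁.isLagrangian_normal hΘ hform ⟨x, hx⟩
  transverse x hx := by
    rw [eq_bot_iff, ← ht x hx]
    -- The normal Lagrangians lie in the tangent spaces of the lifted tori, which are already
    -- transverse.
    exact inf_le_inf inf_le_left inf_le_left

end

end DoubleCover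

/-! ### The symplectic isomorphism and the homotopies of Lagrangians -/

namespace DoubleCover

open Topology SymProd
open scoped ComplexOrder

theorem image_span {V V' ι : Type*} [AddCommGroup V] [Module ℝ V] [AddCommGroup V'] [Module ℝ V']
    {E : Submodule ℝ V} {E' : Submodule ℝ V'} (φ : E ≃ₗ[ℝ] E') {Y : ι → V} (hY : ∀ i, Y i ∈ E) :
    PolarizationData.image φ (Submodule.span ℝ (Set.range Y)) =
      Submodule.span ℝ (Set.range fun i => (φ ⟨Y i, hY i⟩ : V')) := by
  have h1 : Submodule.span ℝ (Set.range Y) =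
      (Submodule.span ℝ (Set.range fun i => (⟨Y i, hY i⟩ : E))).map E.subtype := by
    rw [Submodule.map_span, ← Set.range_comp]
    rfl
  rw [PolarizationData.image, h1, Submodule.comap_map_eq_of_injective E.subtype_injective,
    Submodule.map_span, Submodule.map_span, ← Set.range_comp, ← Set.range_comp]
  rfl

section

variable {A B : Type*} [TopologicalSpace A] [T2Space A] [ChartedSpace ℂ A] [TopologicalSpace B]
  [ChartedSpace ℂ B] [IsManifold 𝓘(ℂ) ω A] [T2Space B] [IsManifold 𝓘(ℂ) ω B]
  {π : A → B} {g : ℕ} {hπ : IsHolDoubleCover π} {u : A → ℂ} {V : Sym B g → A → ℂ}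
  {Θ : Sym B g → (Fin g → ℂ) →L[ℂ] (Fin (2 * g) → ℂ)}
  {form : ∀ D : Sym A (2 * g), SymTangent A (2 * g) D →ₗ[ℝ] SymTangent A (2 * g) D →ₗ[ℝ] ℝ}

/-- The unitary isomorphism from the normal bundle to the tangent bundle, read through a twist. -/
noncomputable def unitarization (hπ : IsHolDoubleCover π)
    (form : ∀ D : Sym A (2 * g), SymTangent A (2 * g) D →ₗ[ℝ] SymTangent A (2 * g) D →ₗ[ℝ] ℝ)
    (Θ : Sym B g → (Fin g → ℂ) →L[ℂ] (Fin (2 * g) → ℂ)) (D : Sym B g) :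
    SymTangent B g D →ₗ[ℂ] SymTangent B g D :=
  polarMap (V := SymTangent B g D) (Pi.basisFun ℂ (Fin g)) (twistForm hπ form Θ D)
    (restrictForm hπ form D)

theorem unitarization_apply (hΘ : IsTwist hπ u V Θ) (hform : IsCompatibleForm form) {D : Sym B g}
    {X : Fin g → SymTangent B g D} (hX : LinearIndependent ℂ X) (j : Fin g) :
    unitarization hπ form Θ D (X j) =
      polarFrame (restrictForm hπ form D) (gram (twistForm hπ form Θ D) X) X j :=
  polarMap_apply (hΘ.twistForm_isCompatible hform D) (restrictForm_isCompatible hform D) hX j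

/-- The defining basis is only linear algebra on the model space and need not be a continuous frame.
In a continuous frame the map is given by polar frames, which depend continuously on the point. -/
theorem contSec_unitarization (hΘ : IsTwist hπ u V Θ) (hform : IsCompatibleForm form) {Z : Type*}
    [TopologicalSpace Z] {G : Z → Sym B g} {z₀ : Z} {X : Fin g → Z → Fin g → ℂ}
    (hX : ∀ i, ContSec G (X i) z₀) (hG : ContinuousAt G z₀)
    (hli : ∀ᶠ z in 𝓝 z₀, LinearIndependent ℂ fun i => X i z) (j : Fin g) :
    ContSec G (fun z => unitarization hπ form Θ (G z) (X j z)) z₀ := by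
  have h := contSec_polarFrame (F := G) (Ω := fun z => restrictForm hπ form (G z))
    (Γ := fun z => gram (V := SymTangent B g (G z)) (twistForm hπ form Θ (G z)) fun i => X i z)
    (fun z => restrictForm_isCompatible hform (G z))
    (hli.mono fun z hz => (hΘ.twistForm_isCompatible hform (G z)).gram_posDef hz)
    (continuousAt_pi.2 fun i => continuousAt_pi.2 fun k =>
      hΘ.continuousAt_herm_twistForm hform (hX i) (hX k)) hX hG hli
    (fun i k => continuousAt_herm_restrictForm hform (hX i) (hX k)) j
  refine h.congr ?_
  filter_upwards [hli] with z hz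
  exact (unitarization_apply hΘ hform hz j).symm

theorem unitarization_injective (hΘ : IsTwist hπ u V Θ) (hform : IsCompatibleForm form)
    (D : Sym B g) : Function.Injective (unitarization hπ form Θ D) :=
  polarMap_injective (hΘ.twistForm_isCompatible hform D) (restrictForm_isCompatible hform D)

theorem unitarization_form (hΘ : IsTwist hπ u V Θ) (hform : IsCompatibleForm form) (D : Sym B g)
    (v w : SymTangent B g D) :
    restrictForm hπ form D (unitarization hπ form Θ D v) (unitarization hπ form Θ D w) =
      twistForm hπ form Θ D v w :=
  polarMap_form (hΘ.twistForm_isCompatible hform D) (restrictForm_isCompatible hform D) v w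

/-- A section of the normal bundle is continuous iff its image in the tangent bundle is. -/
theorem contSec_twist_iff (hΘ : IsTwist hπ u V Θ) (hform : IsCompatibleForm form)
    (t : Sym B g → Fin g → ℂ) (D₀ : Sym B g) :
    ContSec (pullbackSym π hπ.ncard g) (fun D => Θ D (t D)) D₀ ↔
      ContSec id (fun D => unitarization hπ form Θ D (t D)) D₀ := by
  obtain ⟨e, he⟩ := exists_frame D₀
  have h₀ := ChartedSpace.mem_chart_source (H := Fin g → ℂ) D₀
  have hU : ∀ᶠ D in 𝓝 D₀, D ∈ (chartAt (Fin g → ℂ) D₀).source :=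
    (chartAt (Fin g → ℂ) D₀).open_source.mem_nhds h₀
  -- Both `Θ` and the unitarization carry a local frame to a continuous, linearly independent
  -- family. Each side therefore says that the components of `t` in that frame are continuous.
  have hN : ContSec (pullbackSym π hπ.ncard g) (fun D => Θ D (t D)) D₀ ↔
      ∀ i, ContinuousAt (fun D => dChart D₀ D (t D) i) D₀ := by
    rw [← contSec_iff_coeff (Y := fun i D => Θ D (e i D)) (F := pullbackSym π hπ.ncard g)
      (fun i => hΘ.contSec ((he D₀ h₀).1 i)) hπ.continuous_pullbackSym.continuousAt
      ((he D₀ h₀).2.1.map' (Θ D₀).toLinearMap (LinearMap.ker_eq_bot.2 (hΘ.injective D₀)))]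
    have hev : (fun D => Θ D (t D)) =ᶠ[𝓝 D₀] fun D => ∑ i, dChart D₀ D (t D) i • Θ D (e i D) := by
      filter_upwards [hU] with D hD
      conv_lhs => rw [(he D hD).2.2 (t D)]
      simp only [map_sum, map_smul]
    exact ⟨fun h => h.congr hev, fun h => h.congr hev.symm⟩
  have hT : ContSec id (fun D => unitarization hπ form Θ D (t D)) D₀ ↔
      ∀ i, ContinuousAt (fun D => dChart D₀ D (t D) i) D₀ := by
    rw [← contSec_iff_coeff (Y := fun i D => unitarization hπ form Θ D (e i D))
      (F := (id : Sym B g → Sym B g))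
      (fun i => contSec_unitarization hΘ hform (he D₀ h₀).1 continuousAt_id
        (hU.mono fun D hD => (he D hD).2.1) i) continuousAt_id
      (LinearIndependent.map' (he D₀ h₀).2.1 (unitarization hπ form Θ D₀)
        (LinearMap.ker_eq_bot.2 (unitarization_injective hΘ hform D₀)))]
    have hev : (fun D => unitarization hπ form Θ D (t D)) =ᶠ[𝓝 D₀]
        fun D => (∑ i, dChart D₀ D (t D) i • unitarization hπ form Θ D (e i D) : Fin g → ℂ) := by
      filter_upwards [hU] with D hD
      conv_lhs => rw [(he D hD).2.2 (t D)]
      exact (map_sum (unitarization hπ form Θ D) _ _).trans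
        (Finset.sum_congr rfl fun i _ => map_smul (unitarization hπ form Θ D) _ _)
    exact ⟨fun h => h.congr hev, fun h => h.congr hev.symm⟩
  rw [hN, hT]

/-- Under the isomorphism, `Y i = Θ (exp (-l i) • X i)` goes to the polar frame of the vectors `exp
(-l i) • X i` whose Gram matrix is that of `Y`. This is the initial frame in
`lagrangianHomotopic_of_frame`. -/
theorem IsTorusFrame.lagrangianHomotopic {L : Set (Sym B g)}
    {FN : ∀ D, Submodule ℝ (SymTangent A (2 * g) (pullbackSym π hπ.ncard g D))}
    {FT : ∀ D, Submodule ℝ (SymTangent B g D)} {X : Fin g → L → Fin g → ℂ}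
    {Y : Fin g → L → Fin (2 * g) → ℂ} {l : Fin g → L → ℂ} (hΘ : IsTwist hπ u V Θ)
    (hform : IsCompatibleForm form) (hL : IsTorusFrame hπ Θ form L FN FT X Y l)
    (φ : ∀ D, antiInvariant π (2 * g) (pullbackSym π hπ.ncard g D) ≃ₗ[ℝ]
      (⊤ : Submodule ℝ (SymTangent B g D)))
    (hφ : ∀ D v h, (φ D ⟨Θ D v, h⟩ : SymTangent B g D) = unitarization hπ form Θ D v) :
    PolarizationData.LagrangianHomotopic (M := Sym B g) (f := id) (V := SymTangent B g)
      (Fin g → ℂ) g (fun _ => ⊤) (restrictForm hπ form) L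
      (fun D => PolarizationData.image (φ D) (FN D)) FT := by
  let Γ (x : L) : Matrix (Fin g) (Fin g) ℂ :=
    gram (V := SymTangent A (2 * g) (pullbackSym π hπ.ncard g x))
      (form (pullbackSym π hπ.ncard g x)) fun i => Y i x
  refine lagrangianHomotopic_of_frame (Γ := Γ) (Y := X) (l := l)
    (restrictForm_isCompatible hform) (fun v w q₀ hv hw => ?_) (fun x => ?_) ?_ (fun x => ?_)
    hL.contSec hL.linearIndependent hL.tangent_isotropic hL.continuous (fun x => ?_)
    hL.span_tangent
  · exact continuousAt_herm_restrictForm hform hv hw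
  · exact (hform.isCompatible _).gram_posDef (hL.linearIndependent_normal hΘ x)
  · refine continuous_iff_continuousAt.2 fun x => continuousAt_pi.2 fun i =>
      continuousAt_pi.2 fun j => ?_
    exact hform.continuousAt_herm (hL.contSec_normal hΘ i x) (hL.contSec_normal hΘ j x)
  · exact gram_real_iff.2 (hL.normal_isotropic x)
  · rw [hL.span_normal]
    have hY : ∀ i, (Y i x : SymTangent A (2 * g) (pullbackSym π hπ.ncard g x)) ∈
        antiInvariant π (2 * g) (pullbackSym π hπ.ncard g x) := fun i =>
      (hL.mem_span_normal hΘ x _).2 (Submodule.subset_span ⟨i, rfl⟩)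
    refine (image_span (V := SymTangent A (2 * g) (pullbackSym π hπ.ncard g x))
      (V' := SymTangent B g x) (φ x) hY).trans ?_
    have hli : LinearIndependent ℂ fun i =>
        (Complex.exp (-l i x) • X i x : SymTangent B g x) :=
      LinearIndependent.units_smul (hL.linearIndependent x)
        fun i => Units.mk0 _ (Complex.exp_ne_zero (-l i x))
    have e : ∀ i, Y i x = Θ x (Complex.exp (-l i x) • X i x) := fun i => by
      rw [hL.smul_twist i x, map_smul]
    -- `twistForm` is the pullback of the form by `Θ`, so the rescaled tangent frame has the same
    -- Gram matrix as `Y`.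
    have hg : gram (V := SymTangent B g x) (twistForm hπ form Θ x)
        (fun i => Complex.exp (-l i x) • X i x) = Γ x := by
      refine (gram_pullForm (V := SymTangent A (2 * g) (pullbackSym π hπ.ncard g x))
        (W := SymTangent B g x) _ _ _).trans ?_
      exact congrArg (gram (V := SymTangent A (2 * g) (pullbackSym π hπ.ncard g x))
        (form (pullbackSym π hπ.ncard g x))) (funext fun i => (e i).symm)
    congr 2
    funext j
    have h1 := unitarization_apply (D := (x : Sym B g)) (hπ := hπ) hΘ hform hli j
    rw [hg] at h1
    refine Eq.trans ?_ h1
    have h2 : (⟨Y j x, hY j⟩ : antiInvariant π (2 * g) (pullbackSym π hπ.ncard g x)) =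
        ⟨Θ x (Complex.exp (-l j x) • X j x), e j ▸ hY j⟩ := Subtype.ext (e j)
    rw [h2]
    exact hφ x _ _

theorem exists_unitarization (hΘ : IsTwist hπ u V Θ) (hform : IsCompatibleForm form)
    (D : Sym B g) : ∃ φ : antiInvariant π (2 * g) (pullbackSym π hπ.ncard g D) ≃ₗ[ℝ]
      (⊤ : Submodule ℝ (SymTangent B g D)),
      ∀ v h, (φ ⟨Θ D v, h⟩ : SymTangent B g D) = unitarization hπ form Θ D v :=
  exists_linearEquiv_of_injective (V := Fin g → ℂ)
    (W := SymTangent A (2 * g) (pullbackSym π hπ.ncard g D)) (f := (Θ D).toLinearMap)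
    (hΘ.injective D) (hΘ.mem_iff D) (unitarization_injective hΘ hform D)

variable {κ κ' : Type*} [Fintype κ] [Fintype κ'] {L₀ L₁ : Set (Sym B g)}
  {hκ : Fintype.card κ = 2 * g} {al bl : κ → ℝ → A} {hκ' : Fintype.card κ' = g} {a b : κ' → ℝ → B}
  {X₀ : Fin g → L₀ → Fin g → ℂ} {Y₀ : Fin g → L₀ → Fin (2 * g) → ℂ} {l₀ : Fin g → L₀ → ℂ}
  {X₁ : Fin g → L₁ → Fin g → ℂ} {Y₁ : Fin g → L₁ → Fin (2 * g) → ℂ} {l₁ : Fin g → L₁ → ℂ}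

theorem isomorphic_normal_tangential (hΘ : IsTwist hπ u V Θ) (hform : IsCompatibleForm form)
    (h₀ : IsTorusFrame hπ Θ form L₀ (normalPolarization π hπ.ncard form hκ al bl L₀ L₁).F₀
      (torusTangent hκ' a) X₀ Y₀ l₀)
    (h₁ : IsTorusFrame hπ Θ form L₁ (normalPolarization π hπ.ncard form hκ al bl L₀ L₁).F₁
      (torusTangent hκ' b) X₁ Y₁ l₁) :
    (normalPolarization π hπ.ncard form hκ al bl L₀ L₁).Isomorphic
      (tangentialPolarization π hπ.ncard form hκ' a b L₀ L₁) := by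
  choose φ hφ using exists_unitarization (hπ := hπ) hΘ hform
  refine ⟨φ, fun s D₀ => ?_, fun D v w => ?_, h₀.lagrangianHomotopic hΘ hform φ hφ,
    h₁.lagrangianHomotopic hΘ hform φ hφ⟩
  -- Every section of the normal bundle is `Θ t` for a section `t` of the tangent bundle, not known
  -- to be continuous; `contSec_twist_iff` compares the two sides for arbitrary `t`.
  · choose t ht using fun D => (hΘ.mem_iff D (s D).1).1 (s D).2
    have hs : ∀ D, s D = ⟨Θ D (t D), (hΘ.mem_iff D _).2 ⟨t D, rfl⟩⟩ := fun D =>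
      Subtype.ext (ht D).symm
    have h1 := contSec_twist_iff (hπ := hπ) hΘ hform t D₀
    have e1 : (fun D => Θ D (t D)) = fun D => (s D).1 := funext ht
    have e2 : (fun D => (unitarization hπ form Θ D (t D) : Fin g → ℂ)) =
        fun D => (φ D (s D)).1 := funext fun D => by
      rw [hs D]
      exact (hφ D _ _).symm
    rw [e1, e2] at h1
    exact h1
  · obtain ⟨t, ht⟩ := (hΘ.mem_iff D v.1).1 v.2
    obtain ⟨t', ht'⟩ := (hΘ.mem_iff D w.1).1 w.2
    have hv : v = ⟨Θ D t, (hΘ.mem_iff D _).2 ⟨t, rfl⟩⟩ := Subtype.ext ht.symm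
    have hw : w = ⟨Θ D t', (hΘ.mem_iff D _).2 ⟨t', rfl⟩⟩ := Subtype.ext ht'.symm
    have h1 := unitarization_form (hπ := hπ) hΘ hform D t t'
    rw [← hφ D t ((hΘ.mem_iff D _).2 ⟨t, rfl⟩), ← hφ D t' ((hΘ.mem_iff D _).2 ⟨t', rfl⟩)] at h1
    rw [hv, hw]
    exact h1

end

end DoubleCover

/-! ### Tangent spaces of tori of curves -/

namespace DoubleCover

open Topology SymProd

section TorusPoint

variable {S : Type*} {κ : Type*} [Fintype κ] {n : ℕ} {hn : Fintype.card κ = n} {c : κ → ℝ → S}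

theorem mem_torusPoint {t : κ → ℝ} {a : S} : a ∈ torusPoint hn c t ↔ ∃ k, c k (t k) = a := by
  change a ∈ Finset.univ.val.map _ ↔ _
  simp

theorem symSum_torusPoint (h : S → ℂ) (t : κ → ℝ) :
    symSum h (torusPoint hn c t) = ∑ k, h (c k (t k)) :=
  congrArg Multiset.sum (Multiset.map_map h (fun k => c k (t k)) Finset.univ.val)

end TorusPoint

section Curves

variable {S : Type*} [TopologicalSpace S] [ChartedSpace ℂ S]

/-- A curve along which holomorphic functions are continuously differentiable. -/
structure IsHolCurve (c : ℝ → S) : Prop where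
  continuous : Continuous c
  contDiffAt : ∀ s (h : S → ℂ), HolAt h (c s) → ContDiffAt ℝ 1 (fun t => h (c t)) s

/-- A system of pairwise disjoint, embedded closed curves. -/
structure IsCurveSystem {κ : Type*} (c : κ → ℝ → S) : Prop where
  isHolCurve : ∀ k, IsHolCurve (c k)
  periodic : ∀ k, Function.Periodic (c k) 1
  eq_of_eq : ∀ k k' s s', c k s = c k' s' → k = k' ∧ ∃ m : ℤ, s' = s + m
  immersed : ∀ k s, ∃ h : S → ℂ, HolAt h (c k s) ∧ deriv (fun t => h (c k t)) s ≠ 0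

theorem IsHolCurve.differentiableAt {c : ℝ → S} (hc : IsHolCurve c) {s : ℝ} {h : S → ℂ}
    (hh : HolAt h (c s)) : DifferentiableAt ℝ (fun t => h (c t)) s :=
  (hc.contDiffAt s h hh).differentiableAt (by simp)

theorem IsHolCurve.continuousAt_deriv {c : ℝ → S} (hc : IsHolCurve c) {s : ℝ} {h : S → ℂ}
    (hh : HolAt h (c s)) : ContinuousAt (fun s => deriv (fun t => h (c t)) s) s :=
  (((hc.contDiffAt s h hh).continuousAt_fderiv (by simp)).clm_apply
    (continuousAt_const (y := (1 : ℝ))) : _)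

/-- A holomorphic function near a point of a tuple extends by zero to the other points. -/
theorem exists_holNear_of_holAt [T2Space S] {n : ℕ} (D : Sym S n) (a : S) {h : S → ℂ}
    (hh : HolAt h a) : ∃ h' : S → ℂ, HolNear h' D ∧ h' =ᶠ[𝓝 a] h ∧
      ∀ b ∈ D, b ≠ a → h' =ᶠ[𝓝 b] fun _ => 0 := by
  classical
  obtain ⟨U, hU, hUd⟩ := (insert a D.1.toFinset).finite_toSet.t2_separation
  have hmem : ∀ b, b ∈ D → b ∈ (↑(insert a D.1.toFinset) : Set S) := fun b hb =>
    Finset.mem_insert_of_mem (Multiset.mem_toFinset.2 hb)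
  have h1 : (U a).indicator h =ᶠ[𝓝 a] h := by
    filter_upwards [(hU a).2.mem_nhds (hU a).1] with b hb
    exact Set.indicator_of_mem hb h
  have h2 : ∀ b ∈ D, b ≠ a → (U a).indicator h =ᶠ[𝓝 b] fun _ => 0 := by
    intro b hb hne
    filter_upwards [(hU b).2.mem_nhds (hU b).1] with x hx
    exact Set.indicator_of_notMem
      (Set.disjoint_left.1 (hUd (hmem b hb) (Finset.mem_insert_self _ _) hne) hx) h
  refine ⟨(U a).indicator h, fun b hb => ?_, h1, h2⟩
  by_cases hba : b = a
  · rw [hba]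
    exact hh.congr h1
  · exact (holAt_const 0 b).congr (h2 b hb hba)

variable {κ : Type*} [Fintype κ] {n : ℕ} {hn : Fintype.card κ = n} {c : κ → ℝ → S}

theorem hasFDerivAt_symSum_torusPoint (hc : ∀ k, IsHolCurve (c k)) {t : κ → ℝ} {h : S → ℂ}
    (hh : HolNear h (torusPoint hn c t)) :
    HasFDerivAt (fun x => symSum h (torusPoint hn c x)) (∑ k, (ContinuousLinearMap.proj k :
      (κ → ℝ) →L[ℝ] ℝ).smulRight (deriv (fun s => h (c k s)) (t k))) t := by
  simp only [symSum_torusPoint]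
  refine HasFDerivAt.fun_sum fun k _ => ?_
  have h1 := ((hc k).differentiableAt (hh _ (mem_torusPoint.2 ⟨k, rfl⟩))).hasDerivAt
  exact h1.hasFDerivAt.comp (f := fun x : κ → ℝ => x k) t (hasFDerivAt_apply k t)

/-- Disjointness of the curves allows the entry on the `k`-th curve to be recognized in the tuple,
and embeddedness determines its parameter up to the period. -/
theorem IsCurveSystem.exists_int (hc : IsCurveSystem c) {t t' : κ → ℝ} (h : torusPoint hn c t = torusPoint hn c t')
    (k : κ) : ∃ m : ℤ, t' k = t k + m := by
  have h1 : c k (t k) ∈ torusPoint hn c t' := h ▸ mem_torusPoint.2 ⟨k, rfl⟩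
  obtain ⟨j, hj⟩ := mem_torusPoint.1 h1
  obtain ⟨rfl, m, hm⟩ := hc.eq_of_eq _ _ _ _ hj.symm
  exact ⟨m, hm⟩

variable [T2Space S] [IsManifold 𝓘(ℂ) ω S]

theorem continuous_torusPoint (hc : ∀ k, IsHolCurve (c k)) : Continuous (torusPoint hn c) := by
  refine continuous_iff_continuousAt.2 fun t => continuousAt_of_symSum (fun O hO hD => ?_)
    fun h hh => ?_
  · have : ∀ᶠ x in 𝓝 t, ∀ k, c k (x k) ∈ O := by
      rw [Filter.eventually_all]
      exact fun k => ((hc k).continuous.comp (continuous_apply k)).continuousAt.eventually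
        (hO.mem_nhds (hD _ (mem_torusPoint.2 ⟨k, rfl⟩)))
    filter_upwards [this] with x hx a ha
    obtain ⟨k, rfl⟩ := mem_torusPoint.1 ha
    exact hx k
  · simp only [symSum_torusPoint]
    refine tendsto_finsetSum _ fun k _ => ?_
    exact ContinuousAt.comp (f := fun x : κ → ℝ => c k (x k)) (g := h)
      (hh _ (mem_torusPoint.2 ⟨k, rfl⟩)).continuousAt
      ((hc k).continuous.comp (continuous_apply k)).continuousAt

theorem mdifferentiableAt_torusPoint (hc : ∀ k, IsHolCurve (c k)) (t : κ → ℝ) :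
    MDifferentiableAt 𝓘(ℝ, κ → ℝ) 𝓘(ℝ, Fin n → ℂ) (torusPoint hn c) t :=
  mdifferentiableAt_real_of_symSum (continuous_torusPoint hc).continuousAt fun _ hh =>
    (hasFDerivAt_symSum_torusPoint hc hh).differentiableAt

variable [DecidableEq κ]

/-- The derivatives of the parametrization of a torus of curves. -/
noncomputable def torusVec (hn : Fintype.card κ = n) (c : κ → ℝ → S) (t : κ → ℝ) (k : κ) :
    Fin n → ℂ :=
  mfderiv 𝓘(ℝ, κ → ℝ) 𝓘(ℝ, Fin n → ℂ) (torusPoint hn c) t (Pi.single k (1 : ℝ))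

theorem dSum_torusVec (hc : ∀ k, IsHolCurve (c k)) {t : κ → ℝ} {h : S → ℂ}
    (hh : HolNear h (torusPoint hn c t)) (k : κ) :
    dSum h (torusPoint hn c t) (torusVec hn c t k) = deriv (fun s => h (c k s)) (t k) := by
  refine (dSum_mfderiv_real (mdifferentiableAt_torusPoint hc t) hh _).trans ?_
  rw [(hasFDerivAt_symSum_torusPoint hc hh).fderiv]
  simp [sum_apply, Pi.single_apply]

theorem mfderiv_torusPoint (t u : κ → ℝ) :
    (mfderiv 𝓘(ℝ, κ → ℝ) 𝓘(ℝ, Fin n → ℂ) (torusPoint hn c) t u : Fin n → ℂ) =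
      ∑ k, u k • torusVec hn c t k := by
  let L : (κ → ℝ) →L[ℝ] (Fin n → ℂ) :=
    mfderiv 𝓘(ℝ, κ → ℝ) 𝓘(ℝ, Fin n → ℂ) (torusPoint hn c) t
  change L u = ∑ k, u k • L (Pi.single k (1 : ℝ))
  conv_lhs => rw [pi_eq_sum_univ' u]
  simp only [map_sum, map_smul]

theorem contSec_torusVec (hc : ∀ k, IsHolCurve (c k)) (k : κ) (t : κ → ℝ) :
    ContSec (torusPoint hn c) (fun t => torusVec hn c t k) t := by
  have hcont := (continuous_torusPoint (hn := hn) hc).continuousAt (x := t)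
  refine contSec_iff.2 ⟨hcont, fun h hh => ?_⟩
  have h1 : ContinuousAt (fun x : κ → ℝ => deriv (fun s => h (c k s)) (x k)) t :=
    ContinuousAt.comp (f := fun x : κ → ℝ => x k) (g := fun s => deriv (fun s => h (c k s)) s)
      ((hc k).continuousAt_deriv (hh _ (mem_torusPoint.2 ⟨k, rfl⟩)))
      (continuous_apply k).continuousAt
  refine h1.congr ?_
  filter_upwards [hcont.eventually hh.eventually] with x hx
  exact (dSum_torusVec hc hx k).symm

namespace IsCurveSystem

/-- The points of the tuple are distinct, so a test function can be cut off to live near the `k`-th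
one. It then sees only the `k`-th vector, with a nonzero value because the curve is immersed. -/
theorem linearIndependent (hc : IsCurveSystem c) (t : κ → ℝ) :
    LinearIndependent ℂ (torusVec hn c t) := by
  rw [Fintype.linearIndependent_iff]
  intro a ha k
  obtain ⟨h, hh, hne⟩ := hc.immersed k (t k)
  obtain ⟨h', hh', e1, e2⟩ := exists_holNear_of_holAt (torusPoint hn c t) (c k (t k)) hh
  have h1 := congrArg (dSum h' (torusPoint hn c t)) ha
  rw [map_sum, map_zero, Finset.sum_eq_single_of_mem k (Finset.mem_univ k)] at h1
  · rw [map_smul, dSum_torusVec hc.isHolCurve hh'] at h1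
    have h2 : (fun s => h' (c k s)) =ᶠ[𝓝 (t k)] fun s => h (c k s) :=
      (hc.isHolCurve k).continuous.continuousAt.eventually e1
    rw [h2.deriv_eq, smul_eq_mul] at h1
    exact (mul_eq_zero.1 h1).resolve_right hne
  · intro j _ hj
    have h2 : (fun s => h' (c j s)) =ᶠ[𝓝 (t j)] fun _ => 0 :=
      (hc.isHolCurve j).continuous.continuousAt.eventually
        (e2 _ (mem_torusPoint.2 ⟨j, rfl⟩) fun h => hj (hc.eq_of_eq _ _ _ _ h).1)
    rw [map_smul, dSum_torusVec hc.isHolCurve hh', h2.deriv_eq, deriv_const, smul_zero]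

/-- Parameters of the same tuple differ by integers and the curves have period `1`, so the
coordinate fields descend to the torus. -/
theorem torusVec_congr (hc : IsCurveSystem c) {t t' : κ → ℝ}
    (h : torusPoint hn c t = torusPoint hn c t') : torusVec hn c t = torusVec hn c t' := by
  ext1 k
  refine ext_dSum (S := S) (D := torusPoint hn c t) fun f hf => ?_
  rw [dSum_torusVec hc.isHolCurve hf, h, dSum_torusVec hc.isHolCurve (h ▸ hf)]
  obtain ⟨m, hm⟩ := hc.exists_int h k
  rw [hm]
  have hp : ∀ s, c k (s + m) = c k s := fun s => by
    simpa using (hc.periodic k).int_mul m s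
  have := deriv_comp_add_const (fun s => f (c k s)) (m : ℝ) (t k)
  simp only [hp] at this
  exact this

/-- The definition spans over all parameters of the point; by `torusVec_congr` they all give the
same vectors. -/
theorem torusTangent_eq (hc : IsCurveSystem c) (t : κ → ℝ) :
    torusTangent hn c (torusPoint hn c t) = Submodule.span ℝ
      (Set.range fun k => (torusVec hn c t k : SymTangent S n (torusPoint hn c t))) := by
  apply le_antisymm
  · rintro v hv
    refine Submodule.span_induction (p := fun v _ => v ∈ Submodule.span ℝ
      (Set.range fun k => torusVec hn c t k)) ?_ (Submodule.zero_mem _)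
      (fun _ _ _ _ => Submodule.add_mem _) (fun r _ _ => Submodule.smul_mem _ r) hv
    rintro v ⟨t', u, h⟩
    obtain ⟨h1, h2⟩ := Bundle.TotalSpace.mk.inj h
    have h3 : (v : Fin n → ℂ) = ∑ k, u k • torusVec hn c t k := by
      rw [hc.torusVec_congr h1, ← mfderiv_torusPoint]
      exact eq_of_heq h2
    have h4 : (v : Fin n → ℂ) ∈ Submodule.span ℝ (Set.range fun k => torusVec hn c t k) := by
      rw [h3]
      exact Submodule.sum_mem _ fun k _ => Submodule.smul_mem _ _ (Submodule.subset_span ⟨k, rfl⟩)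
    exact h4
  · refine (Submodule.span_le (p := torusTangent hn c (torusPoint hn c t))).2 ?_
    rintro _ ⟨k, rfl⟩
    exact Submodule.subset_span ⟨t, Pi.single k 1, rfl⟩

end IsCurveSystem

end Curves

end DoubleCover

/-! ### Frames over tori, and transversality of tori -/

namespace DoubleCover

open Topology SymProd

section

variable {S : Type*} {κ : Type*} [Fintype κ] {n : ℕ} {hn : Fintype.card κ = n} {c : κ → ℝ → S}

/-- Parameters of a point of a torus. -/
noncomputable def torusParam (x : torus hn c) : κ → ℝ := x.2.choose

theorem torusPoint_torusParam (x : torus hn c) : torusPoint hn c (torusParam x) = x :=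
  x.2.choose_spec

end

section Frames

variable {S : Type*} [TopologicalSpace S] [ChartedSpace ℂ S] {κ : Type*} [Fintype κ] {n : ℕ}
  {hn : Fintype.card κ = n} {c : κ → ℝ → S}

theorem IsCurveSystem.torusPoint_congr (hc : IsCurveSystem c) {t t' : κ → ℝ}
    (h : ∀ k, ∃ m : ℤ, t' k = t k + m) : torusPoint hn c t = torusPoint hn c t' := by
  have : (fun k => c k (t k)) = fun k => c k (t' k) := funext fun k => by
    obtain ⟨m, hm⟩ := h k
    rw [hm]
    simpa using ((hc.periodic k).int_mul m (t k)).symm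
  unfold torusPoint
  congr 1
  exact congrArg (fun f : κ → S => Multiset.map f Finset.univ.val) this

variable [T2Space S] [IsManifold 𝓘(ℂ) ω S]

/-- A function on a torus is continuous if it is continuous in the parameters. -/
theorem IsCurveSystem.continuous_of_comp [T2Space (Sym S n)] (hc : IsCurveSystem c) {Z : Type*}
    [TopologicalSpace Z] {φ : torus hn c → Z}
    (h : Continuous fun t => φ ⟨torusPoint hn c t, t, rfl⟩) : Continuous φ := by
  -- Fractional parts show that the compact cube maps onto the torus. The torus is Hausdorff, so
  -- this surjection is a quotient map.
  let p (t : κ → unitInterval) : torus hn c := ⟨torusPoint hn c fun k => t k, _, rfl⟩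
  have hpar : Continuous fun (t : κ → unitInterval) k => (t k : ℝ) :=
    continuous_pi fun k => continuous_subtype_val.comp (continuous_apply k)
  have hp : Continuous p :=
    Continuous.subtype_mk ((continuous_torusPoint hc.isHolCurve).comp hpar) _
  have hs : Function.Surjective p := by
    rintro ⟨_, t, rfl⟩
    refine ⟨fun k => ⟨Int.fract (t k), Int.fract_nonneg _, (Int.fract_lt_one _).le⟩,
      Subtype.ext (hc.torusPoint_congr (hn := hn) fun k => ⟨⌊t k⌋, (Int.fract_add_floor (t k)).symm⟩)⟩
  rw [(hp.isClosedMap.isQuotientMap hp hs).continuous_iff]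
  exact h.comp hpar

variable [DecidableEq κ]

/-- The frame of a torus given by the derivatives of its parametrization. -/
theorem IsCurveSystem.contSec [T2Space (Sym S n)] (hc : IsCurveSystem c) (k : κ) (x : torus hn c) :
    ContSec (Subtype.val : torus hn c → Sym S n) (fun x => torusVec hn c (torusParam x) k) x := by
  have h : Continuous fun x : torus hn c =>
      (⟨x, torusVec hn c (torusParam x) k⟩ : TangentBundle 𝓘(ℂ, Fin n → ℂ) (Sym S n)) := by
    refine hc.continuous_of_comp (continuous_iff_continuousAt.2 fun t => ?_)
    have h1 := contSec_torusVec (hn := hn) hc.isHolCurve k t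
    have h2 : (fun t => torusVec hn c
        (torusParam (⟨torusPoint hn c t, t, rfl⟩ : torus hn c)) k) = fun t => torusVec hn c t k :=
      funext fun t => congrFun (hc.torusVec_congr (torusPoint_torusParam _)) k
    rw [← h2] at h1
    exact h1
  exact h.continuousAt

theorem IsCurveSystem.mem_torusTangent_iff (hc : IsCurveSystem c) {t : κ → ℝ} {D : Sym S n}
    (hD : torusPoint hn c t = D) (v : Fin n → ℂ) :
    v ∈ torusTangent hn c D ↔ ∃ x : κ → ℝ, v = ∑ k, x k • torusVec hn c t k := by
  subst hD
  rw [hc.torusTangent_eq t]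
  refine (Submodule.mem_span_range_iff_exists_fun (R := ℝ) (v := torusVec hn c t)).trans ?_
  exact exists_congr fun x => eq_comm

/-- The coefficients of a tangent vector of a torus are seen by functions supported near a point. -/
theorem IsCurveSystem.dSum_sum_torusVec (hc : IsCurveSystem c) {t : κ → ℝ} {h h' : S → ℂ} {k : κ}
    (hh' : HolNear h' (torusPoint hn c t)) (e1 : h' =ᶠ[𝓝 (c k (t k))] h)
    (e2 : ∀ b ∈ torusPoint hn c t, b ≠ c k (t k) → h' =ᶠ[𝓝 b] fun _ => 0) (x : κ → ℝ) :
    dSum h' (torusPoint hn c t) (∑ k, x k • torusVec hn c t k) =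
      x k • deriv (fun s => h (c k s)) (t k) := by
  rw [map_sum, Finset.sum_eq_single_of_mem k (Finset.mem_univ k)]
  · have h2 : (fun s => h' (c k s)) =ᶠ[𝓝 (t k)] fun s => h (c k s) :=
      (hc.isHolCurve k).continuous.continuousAt.eventually e1
    rw [← h2.deriv_eq, ← dSum_torusVec hc.isHolCurve hh']
    exact map_smul ((dSum h' (torusPoint hn c t)).restrictScalars ℝ) _ _
  · intro j _ hj
    have h2 : (fun s => h' (c j s)) =ᶠ[𝓝 (t j)] fun _ => 0 :=
      (hc.isHolCurve j).continuous.continuousAt.eventually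
        (e2 _ (mem_torusPoint.2 ⟨j, rfl⟩) fun h => hj (hc.eq_of_eq _ _ _ _ h).1)
    refine (map_smul ((dSum h' (torusPoint hn c t)).restrictScalars ℝ) _ _).trans ?_
    have h3 := dSum_torusVec (hn := hn) hc.isHolCurve hh' j
    rw [h2.deriv_eq, deriv_const] at h3
    exact (congrArg (x j • ·) h3).trans (smul_zero _)

/-- Tori of transverse curves are transverse. -/
theorem torusTangent_inf_eq_bot {κ' : Type*} [Fintype κ'] [DecidableEq κ']
    {hn' : Fintype.card κ' = n} {c' : κ' → ℝ → S} (hc : IsCurveSystem c) (hc' : IsCurveSystem c')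
    (ht : ∀ k k' s s', c k s = c' k' s' → ∃ h : S → ℂ, HolAt h (c k s) ∧
      LinearIndependent ℝ ![deriv (fun t => h (c k t)) s, deriv (fun t => h (c' k' t)) s'])
    {D : Sym S n} (hD : D ∈ torus hn c) (hD' : D ∈ torus hn' c') :
    torusTangent hn c D ⊓ torusTangent hn' c' D = ⊥ := by
  obtain ⟨t, htD⟩ := hD
  obtain ⟨t', htD'⟩ := hD'
  rw [eq_bot_iff]
  rintro v ⟨hv, hv'⟩
  obtain ⟨x, hx⟩ := (hc.mem_torusTangent_iff htD v).1 hv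
  obtain ⟨y, hy⟩ := (hc'.mem_torusTangent_iff htD' v).1 hv'
  have hx0 : ∀ k, x k = 0 := by
    intro k
    have hk : c k (t k) ∈ torusPoint hn' c' t' := by
      rw [htD', ← htD]
      exact mem_torusPoint.2 ⟨k, rfl⟩
    obtain ⟨j, hj⟩ := mem_torusPoint.1 hk
    -- The `k`-th point of one parametrization is the `j`-th point of the other. A test function
    -- living near this point reads off `x k` times one derivative and `y j` times the other, so
    -- independence of the two derivatives forces `x k = 0`.
    obtain ⟨h, hh, hli⟩ := ht k j _ _ hj.symm
    obtain ⟨h', hh', e1, e2⟩ := exists_holNear_of_holAt D (c k (t k)) hh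
    have h1 := hc.dSum_sum_torusVec (t := t) (hn := hn) (htD.symm ▸ hh') e1 (htD.symm ▸ e2) x
    have h2 := hc'.dSum_sum_torusVec (t := t') (hn := hn') (k := j) (htD'.symm ▸ hh')
      (hj.symm ▸ e1) (htD'.symm ▸ hj.symm ▸ e2) y
    rw [← hx, htD] at h1
    rw [← hy, htD', h1] at h2
    have h3 := LinearIndependent.pair_iff.1 hli (x k) (-y j) (by
      rw [h2, neg_smul, add_neg_cancel])
    exact h3.1
  rw [Submodule.mem_bot]
  refine hx.trans ?_
  simp only [hx0, zero_smul, Finset.sum_const_zero]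
  rfl

end Frames

end DoubleCover

/-! ### The lifted curves and the normal frame of a torus -/

namespace DoubleCover

open Topology SymProd

section

variable {A B : Type*} [TopologicalSpace A] {π : A → B} {g : ℕ} {c : Fin g → ℝ → B}
  {cl : Fin g × Fin 2 → ℝ → A}

theorem IsLift.deck_eq (hπ : ∀ x, (π ⁻¹' {x}).ncard = 2) (hcl : IsLift π c cl) (i : Fin g) (t : ℝ) :
    deck π (cl (i, 0) t) = cl (i, 1) t :=
  (eq_deck hπ (by rw [hcl.lift, hcl.lift]) (hcl.distinct i t).symm).symm

theorem IsLift.trace_eq (hπ : ∀ x, (π ⁻¹' {x}).ncard = 2) (hcl : IsLift π c cl) (h : A → ℂ)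
    (i : Fin g) (t : ℝ) : trace π hπ h (c i t) = h (cl (i, 0) t) + h (cl (i, 1) t) :=
  DoubleCover.trace_eq hπ h (hcl.lift (i, 0) t) (hcl.lift (i, 1) t) (hcl.distinct i t)

end

section Lifts

variable {A B : Type*} [TopologicalSpace A] [ChartedSpace ℂ A] [TopologicalSpace B]
  [ChartedSpace ℂ B] {π : A → B} {g : ℕ} {c : Fin g → ℝ → B} {cl : Fin g × Fin 2 → ℝ → A}

/-- A lift is only assumed continuous. Being locally a holomorphic section composed with the curve
below, it inherits the regularity of that curve. -/
theorem IsLift.eventually_eq_section (hπ : IsHolDoubleCover π) (hcl : IsLift π c cl)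
    (k : Fin g × Fin 2) (s : ℝ) : ∃ σ : B → A,
      (∀ᶠ x in 𝓝 (c k.1 s), MDifferentiableAt 𝓘(ℂ) 𝓘(ℂ) σ x) ∧ σ (c k.1 s) = cl k s ∧
      ∀ᶠ t in 𝓝 s, cl k t = σ (c k.1 t) := by
  obtain ⟨σ, h1, h2⟩ := hπ.exists_section (cl k s)
  rw [hcl.lift] at h1
  have h3 : ∀ᶠ t in 𝓝 s, cl k t = σ (c k.1 t) := by
    filter_upwards [(hcl.continuous k).continuousAt.eventually h2] with t ht
    rw [← hcl.lift k t, ht]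
  exact ⟨σ, h1.mono fun x hx => hx.1, h3.self_of_nhds.symm, h3⟩

/-- The lifts of a system of curves. -/
theorem IsLift.isCurveSystem (hπ : IsHolDoubleCover π) (hc : IsCurveSystem c)
    (hcl : IsLift π c cl) : IsCurveSystem cl where
  isHolCurve k := ⟨hcl.continuous k, fun s h hh => by
    obtain ⟨σ, h1, h2, h3⟩ := hcl.eventually_eq_section hπ k s
    rw [← h2] at hh
    refine ((hc.isHolCurve k.1).contDiffAt s (fun x => h (σ x)) (hh.comp h1)).congr_of_eventuallyEq ?_
    filter_upwards [h3] with t ht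
    rw [ht]⟩
  periodic := hcl.periodic
  eq_of_eq k k' s s' h := by
    have h1 : c k.1 s = c k'.1 s' := by rw [← hcl.lift, ← hcl.lift, h]
    obtain ⟨h2, m, hm⟩ := hc.eq_of_eq _ _ _ _ h1
    have h3 : cl k' s' = cl k' s := by
      rw [hm]
      simpa using (hcl.periodic k').int_mul m s
    rw [h3] at h
    refine ⟨?_, m, hm⟩
    obtain ⟨i, j⟩ := k
    obtain ⟨i', j'⟩ := k'
    obtain rfl : i = i' := h2
    have := hcl.distinct i s
    fin_cases j <;> fin_cases j'
    · rfl
    · exact absurd h this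
    · exact absurd h.symm this
    · rfl
  immersed k s := by
    obtain ⟨h, hh, hne⟩ := hc.immersed k.1 s
    refine ⟨fun a => h (π a), ?_, ?_⟩
    · rw [← hcl.lift k s] at hh
      exact hh.comp (Filter.Eventually.of_forall hπ.mdifferentiable)
    · simpa only [hcl.lift] using hne

/-- The preimage of a point of a torus is a point of the torus of the lifted curves. -/
theorem IsLift.pullbackSym_torusPoint (hπ : IsHolDoubleCover π) (hc : IsCurveSystem c)
    (hcl : IsLift π c cl) (t : Fin g → ℝ) :
    pullbackSym π hπ.ncard g (torusPoint (Fintype.card_fin g) c t) =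
      torusPoint (card_lifts g) cl fun k => t k.1 := by
  have hcl' := hcl.isCurveSystem hπ hc
  -- The `2g` points on the lifts are distinct and lie in the preimage, which has `2g` entries in
  -- all.
  have hnodup : (torusPoint (card_lifts g) cl fun k => t k.1).1.Nodup :=
    Multiset.Nodup.map (fun k k' h => (hcl'.eq_of_eq _ _ _ _ h).1) Finset.univ.nodup
  refine Subtype.ext (Multiset.eq_of_le_of_card_le
    ((Multiset.le_iff_subset hnodup).2 fun a ha => ?_) ?_).symm
  · obtain ⟨k, rfl⟩ := mem_torusPoint.1 (show a ∈ torusPoint (card_lifts g) cl _ from ha)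
    refine (mem_pullbackSym hπ.ncard).2 (mem_torusPoint.2 ⟨k.1, ?_⟩)
    rw [hcl.lift]
  · exact ((pullbackSym π hπ.ncard g _).2.trans (torusPoint (card_lifts g) cl _).2.symm).le

variable [T2Space A] [IsManifold 𝓘(ℂ) ω A] [T2Space B] [IsManifold 𝓘(ℂ) ω B]

/-- The frame of the normal bundle of a torus. -/
noncomputable def normalVec (cl : Fin g × Fin 2 → ℝ → A) (t : Fin g → ℝ) (i : Fin g) :
    Fin (2 * g) → ℂ :=
  torusVec (card_lifts g) cl (fun k => t k.1) (i, 0) -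
    torusVec (card_lifts g) cl (fun k => t k.1) (i, 1)

/-- The trace of a function along a curve is the sum of its values along the two lifts;
differentiation gives the claim. -/
theorem IsLift.dPull_torusVec (hπ : IsHolDoubleCover π) (hc : IsCurveSystem c)
    (hcl : IsLift π c cl) (t : Fin g → ℝ) (i : Fin g) :
    hπ.dPull (torusPoint (Fintype.card_fin g) c t) (torusVec (Fintype.card_fin g) c t i) =
      torusVec (card_lifts g) cl (fun k => t k.1) (i, 0) +
        torusVec (card_lifts g) cl (fun k => t k.1) (i, 1) := by
  have hcl' := hcl.isCurveSystem hπ hc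
  have hE := hcl.pullbackSym_torusPoint hπ hc t
  refine ext_dSum (S := A) (D := pullbackSym π hπ.ncard g (torusPoint (Fintype.card_fin g) c t))
    fun h hh => ?_
  rw [hπ.dSum_dPull hh, dSum_torusVec hc.isHolCurve (hπ.holNear_trace hh)]
  rw [hE] at hh
  rw [hE, map_add, dSum_torusVec hcl'.isHolCurve hh, dSum_torusVec hcl'.isHolCurve hh]
  simp only [hcl.trace_eq hπ.ncard]
  exact deriv_fun_add ((hcl'.isHolCurve (i, 0)).differentiableAt (hh _ (mem_torusPoint.2 ⟨(i, 0), rfl⟩)))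
    ((hcl'.isHolCurve (i, 1)).differentiableAt (hh _ (mem_torusPoint.2 ⟨(i, 1), rfl⟩)))

/-- `dPull` yields the sum of the tangent vectors of the two lifts, and multiplication by `V`
weights each with the value of `V` there. These values are opposite because `V` is odd, so the sum
becomes a multiple of the difference. -/
theorem IsTwist.twist_torusVec {hπ : IsHolDoubleCover π} {u : A → ℂ} {V : Sym B g → A → ℂ}
    {Θ : Sym B g → (Fin g → ℂ) →L[ℂ] (Fin (2 * g) → ℂ)} (hΘ : IsTwist hπ u V Θ)
    (hc : IsCurveSystem c) (hcl : IsLift π c cl) (t : Fin g → ℝ) (i : Fin g) :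
    Θ (torusPoint (Fintype.card_fin g) c t) (torusVec (Fintype.card_fin g) c t i) =
      V (torusPoint (Fintype.card_fin g) c t) (cl (i, 0) (t i)) • normalVec cl t i := by
  have hcl' := hcl.isCurveSystem hπ hc
  have hE := hcl.pullbackSym_torusPoint hπ hc t
  set D := torusPoint (Fintype.card_fin g) c t with hD
  have hmem : ∀ j, π (cl (i, j) (t i)) ∈ D := fun j => by
    rw [hcl.lift]
    exact mem_torusPoint.2 ⟨i, rfl⟩
  have hgood := fun j => hΘ.good D _ (hmem j)
  refine ext_dSum (S := A) (D := pullbackSym π hπ.ncard g D) fun h hh => ?_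
  have hVh : HolNear (fun a => V D a * h a) (pullbackSym π hπ.ncard g D) := fun a ha =>
    ((holAt_const (V D a) a).congr ((hΘ.good D a ((mem_pullbackSym hπ.ncard).1 ha)).mono
      fun b hb => hb.1)).mul (hh a ha)
  rw [hΘ.dSum_eq D h hh, hD, hcl.dPull_torusVec hπ hc, ← hD]
  rw [hE] at hh hVh ⊢
  have hd : ∀ j, deriv (fun s => V D (cl (i, j) s) * h (cl (i, j) s)) (t i) =
      V D (cl (i, j) (t i)) * deriv (fun s => h (cl (i, j) s)) (t i) := by
    intro j
    rw [← deriv_const_mul _ ((hcl'.isHolCurve (i, j)).differentiableAt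
      (hh _ (mem_torusPoint.2 ⟨(i, j), rfl⟩)))]
    refine Filter.EventuallyEq.deriv_eq ?_
    filter_upwards [(hcl'.isHolCurve (i, j)).continuous.continuousAt.eventually (hgood j)] with s hs
    rw [hs.1]
  have h1 : V D (cl (i, 1) (t i)) = -V D (cl (i, 0) (t i)) := by
    rw [← hcl.deck_eq hπ.ncard]
    exact (hgood 0).self_of_nhds.2.1
  rw [map_add, dSum_torusVec hcl'.isHolCurve hVh, dSum_torusVec hcl'.isHolCurve hVh, hd, hd, h1,
    map_smul, normalVec, map_sub, dSum_torusVec hcl'.isHolCurve hh,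
    dSum_torusVec hcl'.isHolCurve hh, smul_eq_mul]
  ring

end Lifts

end DoubleCover

namespace DoubleCover

open Topology SymProd

/-- The quotient `v / w` lies within `1/2` of `1`, so its real part is positive and the principal
logarithm is continuous there. -/
theorem mul_exp_mem_slitPlane {v w : ℂ} {r : ℝ} (hv : ‖v - w‖ < 1 / 2)
    (hw : w = Complex.exp (Complex.I * r)) :
    v * Complex.exp (-(Complex.I * r)) ∈ Complex.slitPlane := by
  have e : v * Complex.exp (-(Complex.I * r)) - 1 = (v - w) * Complex.exp (-(Complex.I * r)) := by
    rw [sub_mul, hw, ← Complex.exp_add, add_neg_cancel, Complex.exp_zero]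
  have hn : ‖v * Complex.exp (-(Complex.I * r)) - 1‖ < 1 / 2 := by
    have h1 : ‖Complex.exp (-(Complex.I * r))‖ = 1 := by
      rw [Complex.norm_exp]
      simp
    rw [e, norm_mul, h1, mul_one]
    exact hv
  left
  have h2 := (Complex.abs_re_le_norm (v * Complex.exp (-(Complex.I * r)) - 1)).trans_lt hn
  rw [Complex.sub_re, Complex.one_re] at h2
  linarith [(abs_lt.1 h2).1]

section Lifts

variable {A B : Type*} [TopologicalSpace A] [T2Space A] [ChartedSpace ℂ A] [TopologicalSpace B]
  [ChartedSpace ℂ B] {π : A → B} {g : ℕ} {c : Fin g → ℝ → B} {cl : Fin g × Fin 2 → ℝ → A}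
  [IsManifold 𝓘(ℂ) ω A]

theorem IsLift.normalVec_congr (hπ : IsHolDoubleCover π) (hc : IsCurveSystem c)
    (hcl : IsLift π c cl) {t t' : Fin g → ℝ}
    (h : torusPoint (Fintype.card_fin g) c t = torusPoint (Fintype.card_fin g) c t') :
    normalVec cl t = normalVec cl t' := by
  have hcl' := hcl.isCurveSystem hπ hc
  have h1 := hcl'.torusVec_congr (hcl'.torusPoint_congr (hn := card_lifts g)
    (t := fun k => t k.1) (t' := fun k => t' k.1) fun k => hc.exists_int h k.1)
  ext1 i
  simp only [normalVec, h1]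

theorem contSec_sub {S X : Type*} [TopologicalSpace S] [T2Space S] [ChartedSpace ℂ S]
    [IsManifold 𝓘(ℂ) ω S] {n : ℕ} [TopologicalSpace X] {F : X → Sym S n} {x₀ : X}
    {v w : X → Fin n → ℂ} (hv : ContSec F v x₀) (hw : ContSec F w x₀) :
    ContSec F (fun x => v x - w x) x₀ := by
  refine contSec_iff.2 ⟨hv.continuousAt, fun h hh => ?_⟩
  simp only [map_sub]
  exact ((contSec_iff.1 hv).2 h hh).sub ((contSec_iff.1 hw).2 h hh)

theorem IsLift.linearIndependent_normalVec (hπ : IsHolDoubleCover π) (hc : IsCurveSystem c)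
    (hcl : IsLift π c cl) (t : Fin g → ℝ) : LinearIndependent ℂ (normalVec cl t) := by
  have hli := (hcl.isCurveSystem hπ hc).linearIndependent (hn := card_lifts g) fun k => t k.1
  rw [Fintype.linearIndependent_iff] at hli ⊢
  intro a ha i
  have h1 := hli (fun k => if k.2 = 0 then a k.1 else -a k.1) (by
    rw [← ha, Fintype.sum_prod_type]
    refine Finset.sum_congr rfl fun i _ => ?_
    rw [Fin.sum_univ_two, normalVec, smul_sub]
    simp [sub_eq_add_neg])
  simpa using h1 (i, 0)

variable [T2Space B] [IsManifold 𝓘(ℂ) ω B] [T2Space (Sym B g)]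

theorem IsLift.contSec_normalVec (hπ : IsHolDoubleCover π) (hc : IsCurveSystem c)
    (hcl : IsLift π c cl) (i : Fin g) (x : torus (Fintype.card_fin g) c) :
    ContSec (fun x : torus (Fintype.card_fin g) c => pullbackSym π hπ.ncard g x)
      (fun x => normalVec cl (torusParam x) i) x := by
  have hcl' := hcl.isCurveSystem hπ hc
  have h : Continuous fun x : torus (Fintype.card_fin g) c =>
      (⟨pullbackSym π hπ.ncard g x, normalVec cl (torusParam x) i⟩ :
        TangentBundle 𝓘(ℂ, Fin (2 * g) → ℂ) (Sym A (2 * g))) := by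
    refine hc.continuous_of_comp (continuous_iff_continuousAt.2 fun t => ?_)
    have hpar : Continuous fun (t : Fin g → ℝ) (k : Fin g × Fin 2) => t k.1 :=
      continuous_pi fun k => continuous_apply k.1
    have h1 : ∀ k, ContSec (fun t : Fin g → ℝ => torusPoint (card_lifts g) cl fun k => t k.1)
        (fun t => torusVec (card_lifts g) cl (fun k => t k.1) k) t := fun k =>
      ContSec.comp (f := fun (t : Fin g → ℝ) (k : Fin g × Fin 2) => t k.1)
        (contSec_torusVec (hn := card_lifts g) hcl'.isHolCurve k _) hpar.continuousAt
    have h2 := contSec_sub (h1 (i, 0)) (h1 (i, 1))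
    have h3 : (fun t : Fin g → ℝ => torusPoint (card_lifts g) cl fun k => t k.1) =
        fun t => pullbackSym π hπ.ncard g (torusPoint (Fintype.card_fin g) c t) :=
      funext fun t => (hcl.pullbackSym_torusPoint hπ hc t).symm
    have h4 : (fun t => normalVec cl
        (torusParam (⟨torusPoint (Fintype.card_fin g) c t, t, rfl⟩ :
          torus (Fintype.card_fin g) c)) i) = fun t => normalVec cl t i :=
      funext fun t => congrFun (hcl.normalVec_congr hπ hc (torusPoint_torusParam _)) i
    rw [h3] at h2
    change ContSec _ (fun t => normalVec cl t i) t at h2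
    rw [← h4] at h2
    exact h2
  exact h.continuousAt

/-- The frames of a torus of closed curves `c` and of its normal bundle in the torus of the lifts, if
the function `u` has a continuous logarithm along the lifts. -/
theorem IsLift.isTorusFrame {hπ : IsHolDoubleCover π} {u : A → ℂ} {V : Sym B g → A → ℂ}
    {Θ : Sym B g → (Fin g → ℂ) →L[ℂ] (Fin (2 * g) → ℂ)}
    {form : ∀ D : Sym A (2 * g), SymTangent A (2 * g) D →ₗ[ℝ] SymTangent A (2 * g) D →ₗ[ℝ] ℝ}
    (hΘ : IsTwist hπ u V Θ) (hc : IsCurveSystem c) (hcl : IsLift π c cl)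
    {θ : Fin g → ℝ → ℝ} (hθ : ∀ i, Continuous (θ i)) (hθp : ∀ i, Function.Periodic (θ i) 1)
    (hu : ∀ i t, u (cl (i, 0) t) = Complex.exp (Complex.I * θ i t))
    (hL : ∀ E ∈ torus (card_lifts g) cl, IsLagrangian ⊤ (form E)
      (torusTangent (card_lifts g) cl E)) :
    ∃ (X : Fin g → torus (Fintype.card_fin g) c → Fin g → ℂ)
      (Y : Fin g → torus (Fintype.card_fin g) c → Fin (2 * g) → ℂ)
      (l : Fin g → torus (Fintype.card_fin g) c → ℂ),
      IsTorusFrame hπ Θ form (torus (Fintype.card_fin g) c)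
        (fun D => torusTangent (card_lifts g) cl (pullbackSym π hπ.ncard g D) ⊓
          antiInvariant π (2 * g) (pullbackSym π hπ.ncard g D))
        (torusTangent (Fintype.card_fin g) c) X Y l := by
  have hcl' := hcl.isCurveSystem hπ hc
  let L := torus (Fintype.card_fin g) c
  let X (i : Fin g) (x : L) : Fin g → ℂ := torusVec (Fintype.card_fin g) c (torusParam x) i
  let Y (i : Fin g) (x : L) : Fin (2 * g) → ℂ := normalVec cl (torusParam x) i
  let v (i : Fin g) (x : L) : ℂ := V x (cl (i, 0) (torusParam x i))
  let r (i : Fin g) (x : L) : ℝ := θ i (torusParam x i)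
  have hE : ∀ x : L, torusPoint (card_lifts g) cl (fun k => torusParam x k.1) =
      pullbackSym π hπ.ncard g x := fun x => by
    rw [← hcl.pullbackSym_torusPoint hπ hc, torusPoint_torusParam]
  have hΘX : ∀ i (x : L), Θ x (X i x) = v i x • Y i x := fun i x => by
    have := hΘ.twist_torusVec hc hcl (torusParam x) i
    rw [torusPoint_torusParam] at this
    exact this
  have hXc : ∀ i x, ContSec (Subtype.val : L → Sym B g) (X i) x := fun i x => hc.contSec i x
  have hXli : ∀ x, LinearIndependent ℂ fun i => X i x := fun x => hc.linearIndependent _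
  have hYli : ∀ x, LinearIndependent ℂ fun i => Y i x := fun x =>
    hcl.linearIndependent_normalVec hπ hc _
  have hYc := fun i x => hcl.contSec_normalVec hπ hc i x
  -- `v i` is the coefficient of the continuous section `Θ (X i)` with respect to the continuous
  -- section `Y i`.
  have hvc : ∀ i, Continuous (v i) := by
    intro i
    refine continuous_iff_continuousAt.2 fun x => ?_
    refine ContSec.coeff (ι := Unit) (Y := fun _ => Y i) (a := fun _ => v i) (fun _ => hYc i x)
      ((hYli x).comp (fun _ : Unit => i) fun _ _ _ => rfl) ?_ ()
    refine (hΘ.contSec (hXc i x)).congr (Filter.Eventually.of_forall fun y => ?_)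
    simp only [Finset.univ_unique, Finset.sum_singleton]
    exact hΘX i y
  have hrc : ∀ i, Continuous (r i) := by
    intro i
    refine hc.continuous_of_comp ?_
    -- The chosen parameters may jump by integers, which the periodicity of `θ i` absorbs.
    have : (fun t => r i (⟨torusPoint (Fintype.card_fin g) c t, t, rfl⟩ : L)) =
        fun t => θ i (t i) := by
      ext t
      obtain ⟨m, hm⟩ := hc.exists_int
        (torusPoint_torusParam (⟨torusPoint (Fintype.card_fin g) c t, t, rfl⟩ : L)) i
      rw [hm]
      simpa using ((hθp i).int_mul m _).symm
    rw [this]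
    exact (hθ i).comp (continuous_apply i)
  have hslit : ∀ i x, v i x * Complex.exp (-(Complex.I * r i x)) ∈ Complex.slitPlane := by
    intro i x
    have hmem : π (cl (i, 0) (torusParam x i)) ∈ (x : Sym B g) := by
      rw [hcl.lift, ← torusPoint_torusParam x]
      exact mem_torusPoint.2 ⟨i, rfl⟩
    exact mul_exp_mem_slitPlane (hΘ.good x _ hmem).self_of_nhds.2.2 (hu i _)
  -- The continuous phase of `u` along the lift, plus the principal logarithm of the quotient of `v`
  -- by that value of `u`, which is close to `1`.
  let l (i : Fin g) (x : L) : ℂ :=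
    Complex.I * r i x + Complex.log (v i x * Complex.exp (-(Complex.I * r i x)))
  have hl : ∀ i x, Complex.exp (l i x) = v i x := fun i x => by
    simp only [l]
    rw [Complex.exp_add, Complex.exp_log (Complex.slitPlane_ne_zero (hslit i x)), mul_left_comm,
      ← Complex.exp_add, add_neg_cancel, Complex.exp_zero, mul_one]
  have hvec : ∀ k (x : L), torusVec (card_lifts g) cl (fun k => torusParam x k.1) k ∈
      torusTangent (card_lifts g) cl (pullbackSym π hπ.ncard g x) := fun k x => by
    refine (hcl'.mem_torusTangent_iff (hE x) _).2 ⟨Pi.single k 1, ?_⟩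
    rw [Finset.sum_eq_single_of_mem k (Finset.mem_univ k), Pi.single_eq_same, one_smul]
    intro j _ hj
    rw [Pi.single_eq_of_ne hj, zero_smul]
  have hYmem : ∀ i (x : L), Y i x ∈ torusTangent (card_lifts g) cl (pullbackSym π hπ.ncard g x) :=
    fun i x => Submodule.sub_mem _ (hvec (i, 0) x) (hvec (i, 1) x)
  have hXmem : ∀ i (x : L), hπ.dPull x (X i x) ∈
      torusTangent (card_lifts g) cl (pullbackSym π hπ.ncard g x) := fun i x => by
    have h1 := hcl.dPull_torusVec hπ hc (torusParam x) i
    rw [torusPoint_torusParam] at h1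
    rw [h1]
    exact Submodule.add_mem _ (hvec (i, 0) x) (hvec (i, 1) x)
  -- Both frames take values in the tangent spaces of the torus of the lifts, the tangential one
  -- after `dPull`. Isotropy of both is inherited from that Lagrangian torus.
  have hLx := fun x : L => hL (pullbackSym π hπ.ncard g x) ⟨_, hE x⟩
  refine ⟨X, Y, l, hXc, hXli, fun i x => ?_, fun i => ?_, fun x i j => ?_, fun x i j => ?_,
    fun x => ?_, fun x => ?_⟩
  · rw [hl, hΘX]
  · have h1 := hvc i
    have h2 := hrc i
    refine Continuous.add (by fun_prop) (Continuous.clog (by fun_prop) (hslit i))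
  · exact ((hLx x _).1 (hXmem i x)).2 _ (hXmem j x)
  · exact ((hLx x _).1 (hYmem i x)).2 _ (hYmem j x)
  · refine Submodule.ext fun w =>
      (hc.mem_torusTangent_iff (torusPoint_torusParam x) w).trans ?_
    refine Iff.trans ?_ (Submodule.mem_span_range_iff_exists_fun (R := ℝ) (v := fun i => X i x)).symm
    exact exists_congr fun a => eq_comm
  · refine Submodule.ext fun w => ?_
    refine Iff.trans ?_ (Submodule.mem_span_range_iff_exists_fun (R := ℝ) (v := fun i => Y i x)).symm
    constructor
    · rintro ⟨h1, h2⟩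
      obtain ⟨a, ha⟩ := (hcl'.mem_torusTangent_iff (hE x) w).1 h1
      obtain ⟨y, hy⟩ := (hΘ.mem_iff x w).1 h2
      obtain ⟨b, hb⟩ := (Submodule.mem_span_range_iff_exists_fun ℂ).1
        (mem_span_of_linearIndependent (hXli x) y)
      have hw : w = ∑ i, (b i * v i x) • Y i x := by
        rw [← hy, ← hb, map_sum]
        exact Finset.sum_congr rfl fun i _ => by rw [map_smul, hΘX, smul_smul]
      -- The vector `w` is a real combination of all the tangent vectors of the lifts and also a
      -- complex combination of their differences `Y i`. Comparing coefficients shows that those of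
      -- `Y i` are the real numbers `a (i, 0)`.
      have hli := Fintype.linearIndependent_iff.1 (hcl'.linearIndependent (hn := card_lifts g)
        fun k => torusParam x k.1) (fun k => (a k : ℂ) - if k.2 = 0 then b k.1 * v k.1 x else
          -(b k.1 * v k.1 x)) (by
        simp only [sub_smul, Finset.sum_sub_distrib, Complex.coe_smul]
        rw [← ha, hw, sub_eq_zero, Fintype.sum_prod_type]
        refine Finset.sum_congr rfl fun i _ => ?_
        rw [Fin.sum_univ_two]
        simp only [Y, normalVec, sub_eq_add_neg]
        simp)
      refine ⟨fun i => a (i, 0), ?_⟩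
      rw [hw]
      refine Finset.sum_congr rfl fun i _ => ?_
      have h3 := hli (i, 0)
      simp only [if_true] at h3
      rw [← sub_eq_zero.1 h3, Complex.coe_smul]
    · rintro ⟨a, rfl⟩
      refine ⟨Submodule.sum_mem _ fun i _ => Submodule.smul_mem _ _ (hYmem i x),
        (hΘ.mem_iff x _).2 ⟨∑ i, ((a i : ℂ) * (v i x)⁻¹) • X i x, ?_⟩⟩
      rw [map_sum]
      refine Finset.sum_congr rfl fun i _ => ?_
      have hv0 : v i x ≠ 0 := by
        rw [← hl]
        exact Complex.exp_ne_zero _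
      rw [map_smul, hΘX, smul_smul, mul_assoc, inv_mul_cancel₀ hv0, mul_one, Complex.coe_smul]

end Lifts

end DoubleCover

/-! ### The height function on the `ℤ`-fold cover and its phase -/

namespace DoubleCover

open Topology

section HeightFunction

variable {Y Yt Yh : Type*} [TopologicalSpace Y] [TopologicalSpace Yt] [TopologicalSpace Yh]
  {p : Yt → Y} {r : Yh → Y} {T : Yh ≃ₜ Yh} {q : Yh → Yt}

theorem IsInducedDoubleCover.apply_zpow (hp : IsInducedDoubleCover p r T q) (m : ℤ) (a : Yh) :
    r ((T ^ m) a) = r a := by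
  induction m with
  | zero => simp
  | succ n ih =>
    rw [add_comm, zpow_add, zpow_one, Homeomorph.mul_apply, hp.deck, ih]
  | pred n ih =>
    rw [← hp.deck, ← Homeomorph.mul_apply, ← zpow_one_add, ← ih]
    congr 3
    ring

/-- A local section of the `ℤ`-fold cover trivializes it: the number of deck transformations needed
to reach a point from the section is locally constant. -/
theorem IsInducedDoubleCover.exists_sheetNumber (hp : IsInducedDoubleCover p r T q) (y : Y) :
    ∃ (U : Set Y) (m : Yh → ℤ), IsOpen U ∧ y ∈ U ∧ (∀ a, r a ∈ U → m (T a) = m a + 1) ∧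
      ∀ a, r a ∈ U → ∀ᶠ a' in 𝓝 a, m a' = m a := by
  classical
  obtain ⟨b, rfl⟩ := hp.surjective' y
  have hr := hp.isCoveringMap'.isLocalHomeomorph
  obtain ⟨e, hb, he⟩ := hr b
  have hs : ∀ x ∈ e.target, r (e.symm x) = x := fun x hx => by
    rw [he]; exact e.right_inv hx
  -- `m a` is the power of `T` that leads from the local section to `a`.
  choose! m hm using fun (a : Yh) (ha : r a ∈ e.target) =>
    hp.free_transitive (e.symm (r a)) a (hs _ ha)
  refine ⟨e.target, m, e.open_target, by rw [he]; exact e.map_source hb, fun a ha => ?_,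
    fun a ha => ?_⟩
  · have hTa : r (T a) ∈ e.target := by rwa [hp.deck]
    refine ((hm _ hTa).2 _ ?_).symm
    simp only [hp.deck]
    rw [add_comm, zpow_add, zpow_one, Homeomorph.mul_apply, (hm a ha).1]
  · obtain ⟨e', ha', he'⟩ := hr a
    have hc : ContinuousAt (fun a' => (T ^ m a) (e.symm (r a'))) a :=
      (T ^ m a).continuous.continuousAt.comp <|
        ContinuousAt.comp (g := e.symm) (e.continuousAt_symm ha) hr.continuous.continuousAt
    have h1 : ∀ᶠ a' in 𝓝 a, (T ^ m a) (e.symm (r a')) ∈ e'.source := by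
      refine hc.eventually_mem (e'.open_source.mem_nhds ?_)
      rwa [show (T ^ m a) (e.symm (r a)) = a from (hm a ha).1]
    filter_upwards [h1, e'.open_source.mem_nhds ha',
      hr.continuous.continuousAt.eventually_mem (e.open_target.mem_nhds ha)] with a' h1 h2 h3
    refine ((hm a' h3).2 _ (e'.injOn h1 h2 ?_)).symm
    rw [← he', hp.apply_zpow, hs _ h3]

/-- The generating deck transformation of a `ℤ`-fold cover of a compact Hausdorff space raises a
suitable continuous height function by one. -/
theorem IsInducedDoubleCover.exists_height [T2Space Y] [CompactSpace Y]
    (hp : IsInducedDoubleCover p r T q) :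
    ∃ h : Yh → ℝ, Continuous h ∧ ∀ a, h (T a) = h a + 1 := by
  classical
  choose U m hU hyU hmT hm using hp.exists_sheetNumber
  obtain ⟨F, hF⟩ := isCompact_univ.elim_finite_subcover U hU
    fun y _ => Set.mem_iUnion.2 ⟨y, hyU y⟩
  obtain ⟨ρ, hρ⟩ := PartitionOfUnity.exists_isSubordinate isClosed_univ
    (fun i : F => U i) (fun i => hU i) (by simpa [Set.iUnion_subtype] using hF)
  have hr := hp.isCoveringMap'.continuous
  have h0 : ∀ i a, r a ∉ U i.1 → ρ i (r a) = 0 := fun i a ha =>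
    image_eq_zero_of_notMem_tsupport fun h => ha (hρ i h)
  -- The height averages the local sheet numbers with weights pulled back from `Y`. The generator
  -- `T` raises each relevant sheet number by one and keeps the weights, which add up to one.
  refine ⟨fun a => ∑ i : F, ρ i (r a) * m i a, continuous_finsetSum _ fun i _ => ?_, fun a => ?_⟩
  · refine continuous_iff_continuousAt.2 fun a => ?_
    by_cases ha : r a ∈ U i
    · refine ContinuousAt.mul ((ρ i).continuous.comp hr).continuousAt ?_
      refine continuousAt_const.congr (f := fun _ => (m i a : ℝ)) ?_
      filter_upwards [hm i a ha] with a' h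
      rw [h]
    · refine continuousAt_const.congr (f := fun _ => (0 : ℝ)) ?_
      have : ∀ᶠ a' in 𝓝 a, r a' ∈ (tsupport (ρ i))ᶜ :=
        hr.continuousAt.eventually_mem
          ((isClosed_tsupport _).isOpen_compl.mem_nhds fun h => ha (hρ i h))
      filter_upwards [this] with a' h
      rw [image_eq_zero_of_notMem_tsupport h, zero_mul]
  · have h1 : ∑ i : F, ρ i (r a) = 1 := by
      rw [← ρ.sum_eq_one (Set.mem_univ (r a)), finsum_eq_sum_of_fintype]
    simp only [hp.deck]
    rw [← h1, ← Finset.sum_add_distrib]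
    refine Finset.sum_congr rfl fun i _ => ?_
    by_cases ha : r a ∈ U i
    · rw [hmT i a ha]; push_cast; ring
    · rw [h0 i a ha]; simp

theorem IsInducedDoubleCover.height_zpow {h : Yh → ℝ} (hT : ∀ a, h (T a) = h a + 1) (m : ℤ)
    (a : Yh) : h ((T ^ m) a) = h a + m := by
  induction m with
  | zero => simp
  | succ n ih =>
    rw [add_comm, zpow_add, zpow_one, Homeomorph.mul_apply, hT, ih]
    push_cast; ring
  | pred n ih =>
    have := hT ((T ^ (-(n : ℤ) - 1)) a)
    rw [← Homeomorph.mul_apply, ← zpow_one_add, show 1 + (-(n : ℤ) - 1) = -n by ring, ih] at this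
    push_cast at this ⊢
    linarith

/-- Since `p ∘ q = r` and both `p` and `r` are local homeomorphisms, so is `q`; it is then an open
surjection. -/
theorem IsInducedDoubleCover.isQuotientMap (hp : IsInducedDoubleCover p r T q) :
    IsQuotientMap q := by
  have hq : IsLocalHomeomorph q :=
    IsLocalHomeomorph.of_comp (g := p)
      (by rw [show p ∘ q = r from funext hp.comp]; exact hp.isCoveringMap'.isLocalHomeomorph)
      hp.isCoveringMap.isLocalHomeomorph hp.continuous
  exact hq.isOpenMap.isQuotientMap hp.continuous hp.surjective

/-- The height function descends, modulo two, to a circle-valued function on the double cover, which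
is odd under the deck transformation. -/
theorem IsInducedDoubleCover.exists_phase (hp : IsInducedDoubleCover p r T q) {h : Yh → ℝ}
    (hh : Continuous h) (hT : ∀ a, h (T a) = h a + 1) :
    ∃ u : Yt → ℂ, Continuous u ∧ (∀ a, u (q a) = Complex.exp (Complex.I * (Real.pi * h a : ℝ))) ∧
      ∀ y y', p y = p y' → y ≠ y' → u y' = -u y := by
  have hexp : ∀ (x : ℝ) (m : ℤ), Complex.exp (Complex.I * (Real.pi * (x + 2 * m) : ℝ)) =
      Complex.exp (Complex.I * (Real.pi * x : ℝ)) := fun x m => by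
    rw [← Complex.exp_periodic.int_mul m (Complex.I * (Real.pi * x : ℝ))]
    congr 1; push_cast; ring
  -- Two points over the same point of the double cover differ by an even power of `T`, so their
  -- heights differ by an even integer, which does not change the phase.
  have hq : ∀ a, Complex.exp (Complex.I * (Real.pi * h (Function.surjInv hp.surjective (q a)) : ℝ)) =
      Complex.exp (Complex.I * (Real.pi * h a : ℝ)) := fun a => by
    obtain ⟨m, hm⟩ := (hp.eq_iff a _).1 (Function.surjInv_eq hp.surjective (q a)).symm
    rw [← hm, IsInducedDoubleCover.height_zpow hT, Int.cast_mul, Int.cast_ofNat, hexp]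
  refine ⟨fun y => Complex.exp (Complex.I * (Real.pi * h (Function.surjInv hp.surjective y) : ℝ)),
    ?_, hq, fun y y' hy hne => ?_⟩
  · rw [hp.isQuotientMap.continuous_iff]
    refine Continuous.congr ?_ fun a => (hq a).symm
    fun_prop
  · obtain ⟨a, rfl⟩ := hp.surjective y
    obtain ⟨b, rfl⟩ := hp.surjective y'
    rw [hp.comp, hp.comp] at hy
    obtain ⟨m, hm, -⟩ := hp.free_transitive a b hy
    change Complex.exp _ = -Complex.exp _
    rw [hq, hq, ← hm, IsInducedDoubleCover.height_zpow hT]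
    -- Different points of a fibre differ by an odd power of `T`, and `exp (iπ) = -1`.
    rcases Int.even_or_odd' m with ⟨k, rfl | rfl⟩
    · exact absurd ((hp.eq_iff a b).2 ⟨k, hm⟩) hne
    · push_cast
      have := hexp (h a + 1) k
      push_cast at this
      rw [show (h a : ℂ) + (2 * k + 1) = h a + 1 + 2 * k by ring, this,
        show Complex.I * (Real.pi * (h a + 1)) = Complex.I * (Real.pi * h a) + Real.pi * Complex.I by
          ring, Complex.exp_add, Complex.exp_pi_mul_I]
      ring

/-- A closed curve in the double cover whose image downstairs bounds a disc has a continuous phase: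
it lifts to the `ℤ`-fold cover. -/
theorem IsInducedDoubleCover.exists_phase_along (hp : IsInducedDoubleCover p r T q) {h : Yh → ℝ}
    (hh : Continuous h) {u : Yt → ℂ}
    (hu : ∀ a, u (q a) = Complex.exp (Complex.I * (Real.pi * h a : ℝ)))
    {δ : ℂ → Y} (hδ : ContinuousOn δ (Metric.closedBall 0 1)) {c : ℝ → Yt} (hc : Continuous c)
    (hcδ : ∀ t : ℝ, p (c t) = δ (Complex.exp (2 * Real.pi * t * Complex.I))) :
    ∃ θ : ℝ → ℝ, Continuous θ ∧ Function.Periodic θ 1 ∧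
      ∀ t, u (c t) = Complex.exp (Complex.I * θ t) := by
  have hρ : ∀ z : ℂ, ((max 1 ‖z‖)⁻¹ : ℝ) • z ∈ Metric.closedBall (0 : ℂ) 1 := fun z => by
    have h1 : 0 < max 1 ‖z‖ := lt_max_of_lt_left one_pos
    rw [mem_closedBall_zero_iff, norm_smul, Real.norm_of_nonneg (inv_nonneg.2 h1.le),
      inv_mul_le_one₀ h1]
    exact le_max_right _ _
  -- Radial retraction extends the disc to a map of the whole plane, which is simply connected and
  -- so lifts to the `ℤ`-fold cover.
  have hδ' : Continuous fun z : ℂ => δ (((max 1 ‖z‖)⁻¹ : ℝ) • z) := by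
    refine hδ.comp_continuous (Continuous.smul (Continuous.inv₀
      (continuous_const.max continuous_norm) fun z => ?_) continuous_id) hρ
    exact (lt_max_of_lt_left one_pos).ne'
  have hcirc : ∀ t : ℝ, ‖Complex.exp (2 * Real.pi * t * Complex.I)‖ = 1 := fun t => by
    have := Complex.norm_exp_ofReal_mul_I (2 * Real.pi * t)
    push_cast at this
    exact this
  obtain ⟨a₀, ha₀⟩ := hp.surjective (c 0)
  obtain ⟨Γ, ⟨hΓ0, hΓ⟩, -⟩ := hp.isCoveringMap'.existsUnique_continuousMap_lifts
    (⟨_, hδ'⟩ : C(ℂ, Y)) (a₀ := 1) (e₀ := a₀) (by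
      rw [← hp.comp, ha₀, hcδ]; simp)
  have hΓ' : ∀ z, r (Γ z) = δ (((max 1 ‖z‖)⁻¹ : ℝ) • z) := fun z => congrFun hΓ z
  -- Along the unit circle, `q ∘ Γ` and `c` are lifts of the same path through `p` that agree at `t
  -- = 0`. Hence `c` lifts to the closed curve `Γ` on the circle, where the height is periodic.
  have hcq : (fun t : ℝ => q (Γ (Complex.exp (2 * Real.pi * t * Complex.I)))) = c := by
    refine hp.isCoveringMap.eq_of_comp_eq (hp.continuous.comp (Γ.continuous.comp (by fun_prop))) hc
      ?_ 0 (by simp [hΓ0, ha₀])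
    ext t
    simp only [Function.comp_apply, hp.comp, hΓ', hcδ, hcirc]
    simp
  refine ⟨fun t => Real.pi * h (Γ (Complex.exp (2 * Real.pi * t * Complex.I))), by fun_prop,
    fun t => ?_, fun t => ?_⟩
  · have : Complex.exp (2 * Real.pi * (t + 1 : ℝ) * Complex.I) =
        Complex.exp (2 * Real.pi * t * Complex.I) := by
      rw [← Complex.exp_periodic (2 * Real.pi * t * Complex.I)]
      congr 1; push_cast; ring
    simp only [this]
  · rw [← hu]
    exact congrArg u (congrFun hcq t).symm

end HeightFunction

end DoubleCover

/-! ### Continuous sections of holomorphic maps are holomorphic -/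

namespace SymProd

open Topology

/-- A continuous local right inverse of a holomorphic function is holomorphic. -/
theorem differentiableAt_of_continuous_rightInverse {f s : ℂ → ℂ} {ζ : ℂ}
    (hf : ∀ᶠ w in 𝓝 (s ζ), DifferentiableAt ℂ f w)
    (hs : ∀ᶠ x in 𝓝 ζ, ContinuousAt s x ∧ f (s x) = x) : DifferentiableAt ℂ s ζ := by
  have hsc : ContinuousAt s ζ := hs.self_of_nhds.1
  have hfa : AnalyticAt ℂ f (s ζ) := Complex.analyticAt_iff_eventually_differentiableAt.2 hf
  -- If the zeros of the derivative accumulated, `f` would be constant near `s ζ`, contrary to `f ∘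
  -- s = id`.
  have hne : ∀ᶠ w in 𝓝[≠] (s ζ), deriv f w ≠ 0 := by
    refine hfa.deriv.eventually_eq_zero_or_eventually_ne_zero.resolve_left fun h0 => ?_
    obtain ⟨ε, hε, hb⟩ := Metric.eventually_nhds_iff_ball.1 (h0.and hf)
    have hconst : ∀ w ∈ Metric.ball (s ζ) ε, f w = ζ := fun w hw => by
      refine (Metric.isOpen_ball.is_const_of_deriv_eq_zero
        (convex_ball _ _).isPreconnected
        (fun x hx => (hb x hx).2.differentiableWithinAt) (fun x hx => (hb x hx).1)
        hw (Metric.mem_ball_self hε)).trans hs.self_of_nhds.2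
    have h1 : ∀ᶠ x in 𝓝 ζ, x = ζ := by
      filter_upwards [hs, hsc.eventually_mem (Metric.ball_mem_nhds _ hε)] with x hx hx'
      rw [← hx.2, hconst _ hx']
    have h2 : ∀ᶠ x in 𝓝[≠] ζ, False := by
      filter_upwards [h1.filter_mono nhdsWithin_le_nhds, self_mem_nhdsWithin] with x hx hx'
      exact hx' hx
    exact h2.exists.elim fun _ => id
  -- Away from `ζ` the inverse function rule applies; continuity makes the singularity at `ζ`
  -- removable.
  refine (Complex.analyticAt_of_differentiable_on_punctured_nhds_of_continuousAt ?_
    hsc).differentiableAt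
  rw [eventually_nhdsWithin_iff] at hne ⊢
  filter_upwards [hs.eventually_nhds, hsc.eventually hne, hsc.eventually hf] with x hx hx1 hx2 hxζ
  have hsx := hx.self_of_nhds
  refine (HasDerivAt.of_local_left_inverse hsx.1 hx2.hasDerivAt (hx1 fun h => hxζ ?_)
    (hx.mono fun _ h => h.2)).differentiableAt
  have h : s x = s ζ := h
  change x = ζ
  rw [← hsx.2, h, hs.self_of_nhds.2]

variable {A B : Type*} [TopologicalSpace A] [ChartedSpace ℂ A] [TopologicalSpace B]
  [ChartedSpace ℂ B]

theorem mdifferentiableAt_subtypeVal_comp_iff {U : TopologicalSpace.Opens B} {f : A → U} {a : A} :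
    MDifferentiableAt 𝓘(ℂ) 𝓘(ℂ) (Subtype.val ∘ f) a ↔ MDifferentiableAt 𝓘(ℂ) 𝓘(ℂ) f a := by
  rw [MDifferentiableAt, MDifferentiableAt]
  exact ChartedSpace.liftPropWithinAt_subtypeVal_comp_iff ..

variable [IsManifold 𝓘(ℂ) ω A] [IsManifold 𝓘(ℂ) ω B]

/-- A continuous local section of a holomorphic map between Riemann surfaces is holomorphic. -/
theorem mdifferentiableAt_of_continuous_section {π : A → B} (hπ : MDifferentiable 𝓘(ℂ) 𝓘(ℂ) π)
    {σ : B → A} {b : B} (hσ : ∀ᶠ x in 𝓝 b, ContinuousAt σ x ∧ π (σ x) = x) :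
    MDifferentiableAt 𝓘(ℂ) 𝓘(ℂ) σ b := by
  have hA : IsManifold 𝓘(ℂ) 1 A := IsManifold.of_le (n := ω) le_top
  have hB : IsManifold 𝓘(ℂ) 1 B := IsManifold.of_le (n := ω) le_top
  set φ := chartAt ℂ (σ b)
  set ψ := chartAt ℂ b
  have hφ : σ b ∈ φ.source := _root_.mem_chart_source ℂ _
  have hψ : b ∈ ψ.source := _root_.mem_chart_source ℂ _
  have hσb : ContinuousAt σ b := hσ.self_of_nhds.1
  have hψs : ContinuousAt ψ.symm (ψ b) := ψ.continuousAt_symm (ψ.map_source hψ)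
  have hs : DifferentiableAt ℂ (φ ∘ σ ∘ ψ.symm) (ψ b) := by
    refine differentiableAt_of_continuous_rightInverse (f := ψ ∘ π ∘ φ.symm) ?_ ?_
    · simp only [Function.comp_apply, ψ.left_inv hψ]
      have h1 : ∀ᶠ w in 𝓝 (φ (σ b)), w ∈ φ.target := φ.open_target.mem_nhds (φ.map_source hφ)
      have hc : ContinuousAt (π ∘ φ.symm) (φ (σ b)) :=
        hπ.continuous.continuousAt.comp (φ.continuousAt_symm (φ.map_source hφ))
      have h2 : ∀ᶠ w in 𝓝 (φ (σ b)), π (φ.symm w) ∈ ψ.source := by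
        refine hc.eventually_mem (ψ.open_source.mem_nhds ?_)
        rwa [Function.comp_apply, φ.left_inv hφ, hσ.self_of_nhds.2]
      filter_upwards [h1, h2] with w h1 h2
      rw [← mdifferentiableAt_iff_differentiableAt]
      exact (mdifferentiableAt_atlas (chart_mem_atlas ℂ b) h2).comp w
        ((hπ _).comp w (mdifferentiableAt_atlas_symm (chart_mem_atlas ℂ (σ b)) h1))
    · rw [← ψ.left_inv hψ] at hσ
      have h3 : ∀ᶠ x in 𝓝 (ψ b), σ (ψ.symm x) ∈ φ.source := by
        refine ContinuousAt.eventually_mem (f := σ ∘ ψ.symm)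
          (ContinuousAt.comp (by rwa [ψ.left_inv hψ]) hψs) (φ.open_source.mem_nhds ?_)
        rwa [Function.comp_apply, ψ.left_inv hψ]
      filter_upwards [hψs.eventually hσ, ψ.open_target.mem_nhds (ψ.map_source hψ), h3]
        with x hx hxt hx3
      refine ⟨ContinuousAt.comp (g := φ) (φ.continuousAt hx3)
        (ContinuousAt.comp (g := σ) hx.1 (ψ.continuousAt_symm hxt)), ?_⟩
      simp only [Function.comp_apply]
      rw [φ.left_inv hx3, hx.2, ψ.right_inv hxt]
  have h1 := ((mdifferentiableAt_atlas_symm (I := 𝓘(ℂ)) (chart_mem_atlas ℂ (σ b))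
    (x := (φ ∘ σ ∘ ψ.symm) (ψ b))
    (by simp only [Function.comp_apply, ψ.left_inv hψ]; exact φ.map_source hφ)).comp (ψ b)
    hs.mdifferentiableAt).comp b (mdifferentiableAt_atlas (chart_mem_atlas ℂ b) hψ)
  refine h1.congr_of_eventuallyEq ?_
  filter_upwards [ψ.open_source.mem_nhds hψ, hσb.eventually_mem (φ.open_source.mem_nhds hφ)]
    with x hx hx'
  simp only [Function.comp_apply]
  rw [ψ.left_inv hx, φ.left_inv hx']

end SymProd

/-! ### The induced cover of punctured surfaces -/

namespace DoubleCover

open Topology SymProd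

variable {S St Y Yt Yh : Type*} [TopologicalSpace S] [TopologicalSpace St]

section Cover

variable [ChartedSpace ℂ S] [ChartedSpace ℂ St] [TopologicalSpace Y] [TopologicalSpace Yt]

/-- An induced double cover of surfaces has continuous local sections. -/
theorem IsInducedSurfaceCover.exists_continuous_section {e : S → Y} {p : Yt → Y} {π : C(St, S)}
    {et : St → Yt} (h : IsInducedSurfaceCover e p π et) (he : IsEmbedding e)
    (hp : IsLocalHomeomorph p) (a : St) :
    ∃ σ : S → St, (∀ᶠ x in 𝓝 (π a), ContinuousAt σ x ∧ π (σ x) = x) ∧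
      ∀ᶠ b in 𝓝 a, σ (π b) = b := by
  obtain ⟨E, haE, hE⟩ := hp (et a)
  -- A local inverse of `p` maps points of the surface into `p⁻¹` of the surface, which is the image
  -- of `et`.
  have hsec : ∀ x, e x ∈ E.target → ∃ b, et b = E.symm (e x) := fun x hx => by
    have : E.symm (e x) ∈ Set.range et := by
      rw [h.range_eq]
      exact ⟨x, by rw [hE, E.right_inv hx]⟩
    exact this
  have := Nonempty.intro a
  choose! σ hσ using hsec
  have hat : e (π a) ∈ E.target := by rw [← h.comm, hE]; exact E.map_source haE
  have hopen : IsOpen {x | e x ∈ E.target} := E.open_target.preimage he.continuous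
  refine ⟨σ, ?_, ?_⟩
  · filter_upwards [hopen.mem_nhds hat] with x hx
    constructor
    · rw [h.isEmbedding.continuousAt_iff]
      refine ContinuousAt.congr (f := fun x => E.symm (e x)) ?_ ?_
      · exact ContinuousAt.comp (g := E.symm) (E.continuousAt_symm hx) he.continuous.continuousAt
      · filter_upwards [hopen.mem_nhds hx] with x hx
        exact (hσ x hx).symm
    · apply he.injective
      rw [← h.comm, hσ x hx, hE, E.right_inv hx]
  · filter_upwards [h.isEmbedding.continuous.continuousAt.eventually_mem
      (E.open_source.mem_nhds haE)] with b hb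
    have hb' : e (π b) = E (et b) := by rw [← h.comm, hE]
    apply h.isEmbedding.injective
    rw [hσ _ (by rw [hb']; exact E.map_source hb), hb', E.left_inv hb]

theorem mdifferentiable_restrictCover [T1Space S] {π : C(St, S)} (hπ : MDifferentiable 𝓘(ℂ) 𝓘(ℂ) π) (z : S) :
    MDifferentiable 𝓘(ℂ) 𝓘(ℂ) (restrictCover π z) := fun a => by
  rw [← mdifferentiableAt_subtypeVal_comp_iff]
  exact (hπ a.1).comp a
    ((contMDiff_subtype_val (I := 𝓘(ℂ)) (n := 1)).mdifferentiable one_ne_zero a)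

/-- The restriction to punctured surfaces of an induced double cover is a holomorphic double
cover. -/
theorem IsInducedSurfaceCover.isHolDoubleCover [T1Space S] [IsManifold 𝓘(ℂ) ω S]
    [IsManifold 𝓘(ℂ) ω St] {e : S → Y} {p : Yt → Y} {π : C(St, S)}
    {et : St → Yt} (h : IsInducedSurfaceCover e p π et) (he : IsEmbedding e)
    (hp : IsLocalHomeomorph p) (hcard : ∀ x, (π ⁻¹' {x}).ncard = 2) (z : S) :
    IsHolDoubleCover (restrictCover π z) where
  ncard := ncard_restrictCover hcard z
  mdifferentiable := mdifferentiable_restrictCover h.holomorphic z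
  exists_section a := by
    classical
    obtain ⟨σ, hσ, hσ'⟩ := h.exists_continuous_section he hp a.1
    -- The section is restricted to the punctured surface. The value `a` is a filler that does not
    -- occur near the point considered.
    let τ : puncture z → punctureCover π z := fun x =>
      if hx : π (σ x.1) ∈ puncture z then ⟨σ x.1, hx⟩ else a
    have hev : ∀ᶠ x : puncture z in 𝓝 (restrictCover π z a),
        ContinuousAt σ x.1 ∧ π (σ x.1) = x.1 :=
      (continuous_subtype_val.tendsto (restrictCover π z a)).eventually hσ
    have hτ : ∀ x : puncture z, π (σ x.1) = x.1 → (τ x).1 = σ x.1 := fun x hx => by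
      have : π (σ x.1) ∈ puncture z := by rw [hx]; exact x.2
      simp only [τ, dif_pos this]
    have hevτ : ∀ᶠ x in 𝓝 (restrictCover π z a),
        ContinuousAt τ x ∧ restrictCover π z (τ x) = x := by
      filter_upwards [hev.eventually_nhds] with x hx
      constructor
      · rw [IsInducing.subtypeVal.continuousAt_iff]
        refine ContinuousAt.congr (f := fun x : puncture z => σ x.1) ?_ ?_
        · exact ContinuousAt.comp (g := σ) hx.self_of_nhds.1 continuous_subtype_val.continuousAt
        · exact hx.mono fun x hx => (hτ x hx.2).symm
      · apply Subtype.ext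
        change π (τ x).1 = x.1
        rw [hτ x hx.self_of_nhds.2, hx.self_of_nhds.2]
    refine ⟨τ, ?_, ?_⟩
    · filter_upwards [hevτ.eventually_nhds] with x hx
      exact ⟨mdifferentiableAt_of_continuous_section
        (mdifferentiable_restrictCover h.holomorphic z) hx, hx.self_of_nhds.2⟩
    · filter_upwards [(continuous_subtype_val (p := (· ∈ punctureCover π z))).continuousAt.eventually
        hσ'] with b hb
      apply Subtype.ext
      have : (restrictCover π z b).1 = π b.1 := rfl
      rw [hτ, this, hb]
      rw [this, hb]

end Cover

end DoubleCover

/-! ### Attaching circles of a Heegaard diagram and their lifts -/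

namespace SymProd

open Topology

variable {B : Type*} [TopologicalSpace B] {g : ℕ}

theorem sigmaCompactSpace [SigmaCompactSpace B] : SigmaCompactSpace (Sym B g) := by
  rw [← isSigmaCompact_univ_iff, ← (isQuotientMap_ofFun (S := B) (n := g)).surjective.range_eq]
  exact isSigmaCompact_range isQuotientMap_ofFun.continuous

end SymProd

namespace DoubleCover

open Topology SymProd

section Curves

variable {S : Type*} [TopologicalSpace S] [ChartedSpace ℂ S]

theorem contDiffAt_chartAt_comp {c : ℝ → S} (hc : ContMDiff 𝓘(ℝ) 𝓘(ℝ, ℂ) ∞ c) (s : ℝ) :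
    ContDiffAt ℝ ∞ (fun t => chartAt ℂ (c s) (c t)) s := by
  have := (contMDiffAt_iff_target.1 (hc s)).2
  rw [contMDiffAt_iff_contDiffAt] at this
  simpa only [Function.comp_def, mfld_simps] using this

theorem velocity_eq {c : ℝ → S} (hc : ContMDiff 𝓘(ℝ) 𝓘(ℝ, ℂ) ∞ c) (s : ℝ) :
    (velocity c s : ℂ) = deriv (fun t => chartAt ℂ (c s) (c t)) s := by
  have h : MDifferentiableAt 𝓘(ℝ) 𝓘(ℝ, ℂ) c s := (hc s).mdifferentiableAt (by simp)
  rw [velocity, h.mfderiv]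
  simp only [Function.comp_def, mfld_simps, fderivWithin_univ]
  rfl

variable [IsManifold 𝓘(ℂ) ω S]

/-- In a chart a holomorphic function is analytic, in particular real `C¹`, and so is its
composition with the smooth curve. -/
theorem isHolCurve_of_contMDiff {c : ℝ → S} (hc : ContMDiff 𝓘(ℝ) 𝓘(ℝ, ℂ) ∞ c) :
    IsHolCurve c where
  continuous := hc.continuous
  contDiffAt s h hh := by
    have hS : IsManifold 𝓘(ℂ) 1 S := IsManifold.of_le (n := ω) le_top
    set φ := chartAt ℂ (c s)
    have hs : c s ∈ φ.source := _root_.mem_chart_source ℂ _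
    have h1 : AnalyticAt ℂ (h ∘ φ.symm) (φ (c s)) := by
      refine Complex.analyticAt_iff_eventually_differentiableAt.2 ?_
      have hev : ∀ᶠ w in 𝓝 (φ (c s)), MDifferentiableAt 𝓘(ℂ) 𝓘(ℂ) h (φ.symm w) := by
        refine (φ.continuousAt_symm (φ.map_source hs)).eventually ?_
        rwa [φ.left_inv hs]
      filter_upwards [hev, φ.open_target.mem_nhds (φ.map_source hs)] with w hw hwt
      rw [← mdifferentiableAt_iff_differentiableAt]
      exact hw.comp w (mdifferentiableAt_atlas_symm (chart_mem_atlas ℂ (c s)) hwt)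
    have h2 : ContDiffAt ℝ 1 (h ∘ φ.symm) (φ (c s)) := (h1.contDiffAt (n := 1)).restrict_scalars ℝ
    refine (h2.comp s ((contDiffAt_chartAt_comp hc s).of_le (by simp))).congr_of_eventuallyEq ?_
    filter_upwards [hc.continuous.continuousAt.eventually_mem (φ.open_source.mem_nhds hs)] with t ht
    simp only [Function.comp_apply]
    exact congrArg h (φ.left_inv ht).symm

theorem holAt_chartAt_comp_val {U : TopologicalSpace.Opens S} (a : U) :
    HolAt (fun b : U => chartAt ℂ a.1 b.1) a := by
  have hS : IsManifold 𝓘(ℂ) 1 S := IsManifold.of_le (n := ω) le_top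
  filter_upwards [(continuous_subtype_val (p := (· ∈ U))).continuousAt.eventually_mem
    ((chartAt ℂ a.1).open_source.mem_nhds (_root_.mem_chart_source ℂ a.1))] with b hb
  exact (mdifferentiableAt_atlas (chart_mem_atlas ℂ a.1) hb).comp b
    ((contMDiff_subtype_val (I := 𝓘(ℂ)) (n := 1)).mdifferentiable one_ne_zero b)

/-- Disjoint smoothly embedded closed curves form a curve system in any open set containing them. -/
theorem isCurveSystem_of_isSimpleClosedCurve {κ : Type*} {U : TopologicalSpace.Opens S}
    {c : κ → ℝ → S} (hc : ∀ k, IsSimpleClosedCurve (c k))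
    (hd : ∀ k k', k ≠ k' → ∀ s s', c k s ≠ c k' s') (hU : ∀ k s, c k s ∈ U) :
    IsCurveSystem (fun k s => (⟨c k s, hU k s⟩ : U)) where
  isHolCurve k := isHolCurve_of_contMDiff (S := U)
    ((ContMDiff.subtypeVal_comp_iff U _).1 (hc k).smooth)
  periodic k s := Subtype.ext ((hc k).periodic s)
  eq_of_eq k k' s s' h := by
    have h := congrArg Subtype.val h
    obtain rfl : k = k' := by
      by_contra hne
      exact hd k k' hne s s' h
    have hfract : ∀ t, c k (Int.fract t) = c k t := fun t => by
      have := (hc k).periodic.int_mul (-⌊t⌋) t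
      rw [← this, Int.fract]
      congr 1; push_cast; ring
    have h2 : Int.fract s = Int.fract s' := (hc k).injOn
      ⟨Int.fract_nonneg _, Int.fract_lt_one _⟩ ⟨Int.fract_nonneg _, Int.fract_lt_one _⟩
      (by rw [hfract, hfract]; exact h)
    refine ⟨rfl, ⌊s'⌋ - ⌊s⌋, ?_⟩
    rw [Int.fract, Int.fract] at h2
    push_cast
    linarith
  immersed k s := ⟨_, holAt_chartAt_comp_val (⟨c k s, hU k s⟩ : U), by
    change deriv (fun t => chartAt ℂ (c k s) (c k t)) s ≠ 0
    rw [← velocity_eq (hc k).smooth]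
    exact (hc k).immersed s⟩

end Curves

section Diagram

variable {g : ℕ} {S Y : Type*} [TopologicalSpace S] [ChartedSpace ℂ S] [TopologicalSpace Y]

/-- The lift of an attaching circle has a continuous phase. -/
theorem IsInducedSurfaceCover.exists_phase_along_lift {St Yt Yh : Type*} [TopologicalSpace St]
    [ChartedSpace ℂ St] [TopologicalSpace Yt] [TopologicalSpace Yh] {e : S → Y} {U : Set Y}
    {c : Fin g → ℝ → S} (hU : IsHandlebody e c U) {p : Yt → Y} {r : Yh → Y} {T : Yh ≃ₜ Yh}
    {q : Yh → Yt} (hp : IsInducedDoubleCover p r T q) {π : C(St, S)} {et : St → Yt}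
    (hπ : IsInducedSurfaceCover e p π et) {h : Yh → ℝ} (hh : Continuous h) {u : Yt → ℂ}
    (hu : ∀ a, u (q a) = Complex.exp (Complex.I * (Real.pi * h a : ℝ))) {i : Fin g} {cl : ℝ → St}
    (hcl : Continuous cl) (hlift : ∀ t, π (cl t) = c i t) :
    ∃ θ : ℝ → ℝ, Continuous θ ∧ Function.Periodic θ 1 ∧
      ∀ t, u (et (cl t)) = Complex.exp (Complex.I * θ t) := by
  obtain ⟨d, hd, -, -, -, -, hbd, -⟩ := hU.exists_discs
  -- The attaching circle is the boundary of the core disc `D² × {0}` of the `i`-th thickened disc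
  -- of the handlebody.
  refine hp.exists_phase_along hh hu (δ := fun z => d i (z, 0)) ?_
    (hπ.isEmbedding.continuous.comp hcl) fun t => ?_
  · refine (hd i).comp (by fun_prop) fun z hz => ⟨hz, ?_⟩
    simp
  · rw [hπ.comm, hlift, hbd]

variable [T1Space S] [IsManifold 𝓘(ℂ) ω S]

theorem HeegaardDiagram.isCurveSystem_αPunct (D : HeegaardDiagram g S Y) :
    IsCurveSystem D.αPunct :=
  isCurveSystem_of_isSimpleClosedCurve D.curve_α D.disjoint_α D.base_α

theorem HeegaardDiagram.isCurveSystem_βPunct (D : HeegaardDiagram g S Y) :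
    IsCurveSystem D.βPunct :=
  isCurveSystem_of_isSimpleClosedCurve D.curve_β D.disjoint_β D.base_β

theorem HeegaardDiagram.exists_transverse (D : HeegaardDiagram g S Y) (i j : Fin g) (s t : ℝ)
    (h : D.αPunct i s = D.βPunct j t) : ∃ φ : puncture D.z → ℂ, HolAt φ (D.αPunct i s) ∧
      LinearIndependent ℝ ![deriv (fun s => φ (D.αPunct i s)) s,
        deriv (fun t => φ (D.βPunct j t)) t] := by
  have h' : D.α i s = D.β j t := congrArg Subtype.val h
  have := D.transverse i j s t h'
  rw [velocity_eq (D.curve_α i).smooth, velocity_eq (D.curve_β j).smooth, ← h'] at this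
  exact ⟨_, holAt_chartAt_comp_val (D.αPunct i s), this⟩

theorem exists_transverse_lift {A B : Type*} [TopologicalSpace A] [ChartedSpace ℂ A]
    [TopologicalSpace B] [ChartedSpace ℂ B] {π : A → B} (hπ : IsHolDoubleCover π)
    {a b : Fin g → ℝ → B} {al bl : Fin g × Fin 2 → ℝ → A} (hal : IsLift π a al)
    (hbl : IsLift π b bl)
    (ht : ∀ i j s t, a i s = b j t → ∃ φ : B → ℂ, HolAt φ (a i s) ∧
      LinearIndependent ℝ ![deriv (fun s => φ (a i s)) s, deriv (fun t => φ (b j t)) t])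
    (k l : Fin g × Fin 2) (s t : ℝ) (h : al k s = bl l t) :
    ∃ φ : A → ℂ, HolAt φ (al k s) ∧
      LinearIndependent ℝ ![deriv (fun s => φ (al k s)) s, deriv (fun t => φ (bl l t)) t] := by
  obtain ⟨φ, hφ, hli⟩ := ht k.1 l.1 s t (by rw [← hal.lift, ← hbl.lift, h])
  refine ⟨φ ∘ π, ?_, ?_⟩
  · rw [← hal.lift k s] at hφ
    exact hφ.comp (Filter.Eventually.of_forall hπ.mdifferentiable)
  · simpa only [Function.comp_apply, hal.lift, hbl.lift] using hli

end Diagram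

end DoubleCover

theorem mainTheorem9 {g : ℕ} {S St Y Yt Yh : Type*}
    -- the closed Riemann surface `S` and the surface `St` of its double cover
    [TopologicalSpace S] [T2Space S] [CompactSpace S] [ConnectedSpace S] [ChartedSpace ℂ S]
    [IsManifold 𝓘(ℂ) ω S]
    [TopologicalSpace St] [T2Space St] [ChartedSpace ℂ St] [IsManifold 𝓘(ℂ) ω St]
    -- the closed three-manifold `Y`, its double cover `Yt` and its `ℤ`-fold cover `Yh`
    [TopologicalSpace Y] [T2Space Y] [CompactSpace Y] [ChartedSpace (EuclideanSpace ℝ (Fin 3)) Y]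
    [TopologicalSpace Yt] [TopologicalSpace Yh]
    (D : DoubleCover.HeegaardDiagram g S Y)
    (p : Yt → Y) (r : Yh → Y) (T : Yh ≃ₜ Yh) (q : Yh → Yt)
    (hp : DoubleCover.IsInducedDoubleCover p r T q)
    (π : C(St, S)) (et : St → Yt) (hπ : DoubleCover.IsInducedSurfaceCover D.embed p π et)
    -- the lifted curves in the punctured surface
    (αt βt : Fin g × Fin 2 → ℝ → DoubleCover.punctureCover π D.z)
    (hαt : DoubleCover.IsLift (DoubleCover.restrictCover π D.z) D.αPunct αt)
    (hβt : DoubleCover.IsLift (DoubleCover.restrictCover π D.z) D.βPunct βt)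
    -- the form on `Sym²ᵍ (St - π⁻¹ z)`
    (form : ∀ E : Sym (DoubleCover.punctureCover π D.z) (2 * g),
      DoubleCover.SymTangent (DoubleCover.punctureCover π D.z) (2 * g) E →ₗ[ℝ]
        DoubleCover.SymTangent (DoubleCover.punctureCover π D.z) (2 * g) E →ₗ[ℝ] ℝ)
    (hcompat : DoubleCover.IsCompatibleForm form)
    (hinv : DoubleCover.IsDeckInvariant (DoubleCover.restrictCover π D.z) form)
    (hLα : ∀ E ∈ DoubleCover.torus (DoubleCover.card_lifts g) αt,
      DoubleCover.IsLagrangian ⊤ (form E)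
        (DoubleCover.torusTangent (DoubleCover.card_lifts g) αt E))
    (hLβ : ∀ E ∈ DoubleCover.torus (DoubleCover.card_lifts g) βt,
      DoubleCover.IsLagrangian ⊤ (form E)
        (DoubleCover.torusTangent (DoubleCover.card_lifts g) βt E)) :
    let hfib := DoubleCover.ncard_restrictCover
      (hπ.ncard_fibre D.isEmbedding.injective hp.ncard_fibre) D.z
    let L₀ := DoubleCover.torus (Fintype.card_fin g) D.αPunct
    let L₁ := DoubleCover.torus (Fintype.card_fin g) D.βPunct
    let normal := DoubleCover.normalPolarization (DoubleCover.restrictCover π D.z) hfib form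
      (DoubleCover.card_lifts g) αt βt L₀ L₁
    let tangential := DoubleCover.tangentialPolarization (DoubleCover.restrictCover π D.z) hfib form
      (Fintype.card_fin g) D.αPunct D.βPunct L₀ L₁
    normal.IsPolarization ∧ tangential.IsPolarization ∧ normal.Isomorphic tangential := by
  intro hfib L₀ L₁ normal tangential
  have hcard := hπ.ncard_fibre D.isEmbedding.injective hp.ncard_fibre
  have hcov : DoubleCover.IsHolDoubleCover (DoubleCover.restrictCover π D.z) :=
    hπ.isHolDoubleCover D.isEmbedding hp.isCoveringMap.isLocalHomeomorph hcard D.z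
  -- The punctured surface is locally compact and second countable. Its symmetric product is thus
  -- locally compact and `σ`-compact, as partitions of unity require.
  have : SecondCountableTopology S := ChartedSpace.secondCountable_of_sigmaCompact ℂ S
  have : LocallyCompactSpace (DoubleCover.puncture D.z) :=
    (DoubleCover.puncture D.z).isOpen.locallyCompactSpace
  have : SecondCountableTopology (DoubleCover.puncture D.z) :=
    inferInstanceAs (SecondCountableTopology {x // x ∈ DoubleCover.puncture D.z})
  have : SigmaCompactSpace (DoubleCover.puncture D.z) := inferInstance
  have : SigmaCompactSpace (Sym (DoubleCover.puncture D.z) g) := SymProd.sigmaCompactSpace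
  have : LocallyCompactSpace (Sym (DoubleCover.puncture D.z) g) :=
    ChartedSpace.locallyCompactSpace (Fin g → ℂ) _
  obtain ⟨h, hh, hhT⟩ := hp.exists_height
  obtain ⟨u, hu, huq, hodd⟩ := hp.exists_phase hh hhT
  have hnorm : ∀ y, ‖u y‖ = 1 := fun y => by
    obtain ⟨a, rfl⟩ := hp.surjective y
    rw [huq, mul_comm]
    exact Complex.norm_exp_ofReal_mul_I _
  -- The function on the covering surface is the restriction of the odd phase on `Yt`. The deck
  -- transformation of the surface exchanges the points of a fibre of `p`, so the restriction is odd
  -- too.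
  obtain ⟨V, Θ, hΘ⟩ := hcov.exists_isTwist (g := g) (u := fun a => u (et a.1))
    (hu.comp (hπ.isEmbedding.continuous.comp continuous_subtype_val)) (fun a => by
      have hd := DoubleCover.deck_spec hcov.ncard a
      refine hodd _ _ ?_ fun hE => hd.2 (Subtype.ext (hπ.isEmbedding.injective hE).symm)
      rw [hπ.comm, hπ.comm]
      exact congrArg D.embed (congrArg Subtype.val hd.1).symm) fun a => hnorm _
  -- The `α`-curves bound discs in `U₀` and the `β`-curves in `U₁`, so one phase `u` has logarithms
  -- along the lifts of both families, and a single twist serves both tori.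
  choose θ₀ hθ₀ hθp₀ hθu₀ using fun i => hπ.exists_phase_along_lift D.handlebody₀ hp hh huq (i := i)
    (continuous_subtype_val.comp (hαt.continuous (i, 0)))
    fun t => congrArg Subtype.val (hαt.lift (i, 0) t)
  choose θ₁ hθ₁ hθp₁ hθu₁ using fun i => hπ.exists_phase_along_lift D.handlebody₁ hp hh huq (i := i)
    (continuous_subtype_val.comp (hβt.continuous (i, 0)))
    fun t => congrArg Subtype.val (hβt.lift (i, 0) t)
  obtain ⟨X₀, Y₀, l₀, h₀⟩ := hαt.isTorusFrame hΘ D.isCurveSystem_αPunct hθ₀ hθp₀ hθu₀ hLα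
  obtain ⟨X₁, Y₁, l₁, h₁⟩ := hβt.isTorusFrame hΘ D.isCurveSystem_βPunct hθ₁ hθp₁ hθu₁ hLβ
  have hlift : ∀ {c cl}, DoubleCover.IsCurveSystem c →
      DoubleCover.IsLift (DoubleCover.restrictCover π D.z) c cl →
      ∀ x ∈ DoubleCover.torus (Fintype.card_fin g) c,
        DoubleCover.pullbackSym (DoubleCover.restrictCover π D.z) hcov.ncard g x ∈
          DoubleCover.torus (DoubleCover.card_lifts g) cl := by
    rintro c cl hc hcl _ ⟨t, rfl⟩
    exact ⟨_, (hcl.pullbackSym_torusPoint hcov hc t).symm⟩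
  refine ⟨DoubleCover.isPolarization_normal hΘ hcompat h₀ h₁ fun x hx => ?_,
    DoubleCover.isPolarization_tangential hcompat h₀ h₁ fun x hx => ?_,
    DoubleCover.isomorphic_normal_tangential hΘ hcompat h₀ h₁⟩
  · exact DoubleCover.torusTangent_inf_eq_bot (hαt.isCurveSystem hcov D.isCurveSystem_αPunct)
      (hβt.isCurveSystem hcov D.isCurveSystem_βPunct)
      (DoubleCover.exists_transverse_lift hcov hαt hβt D.exists_transverse)
      (hlift D.isCurveSystem_αPunct hαt x hx.1) (hlift D.isCurveSystem_βPunct hβt x hx.2)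
  · exact DoubleCover.torusTangent_inf_eq_bot D.isCurveSystem_αPunct D.isCurveSystem_βPunct
      D.exists_transverse hx.1 hx.2
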